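/- **Setting.** Let $F$ be a connected oriented punctured surface with an ideal triangulation $\Delta$ (finitely many triangles, vertices at the punctures). A *broken hyperbolic structure* $H$ on $(F,\Delta)$ makes every face of $\Delta$ a hyperbolic ideal triangle so that (i) $F$ is the quotient of the disjoint union of these triangles by gluing maps between their sides that are orientation-reversing homotheties, i.e. an arc of the common edge of $f_1,f_2$ of length $\rho_1$ in $f_1$ has length $\rho_2=\sigma(f_1,f_2)\rho_1$ in $f_2$; (ii) the product of the factors $\sigma(f_i,f_{i+1})$ along consecutive faces once around any puncture is $1$; (iii) the structure is complete: near each puncture the leaves of the horocyclic foliation (by arcs of horocycles centered at the vertices of the ideal triangles) are closed. A *decoration* is a choice of a closed horocyclic leaf for each puncture; $\delta_H(t,e)\ge 0$ denotes the distance, in the metric of the face $t$, between the two chosen leaves along the edge $e$ of $t$, and $\lambda_H(t,e)=\sqrt{2\exp\delta_H(t,e)}$ is the $\lambda$-length. Let $\langle\cdot,\cdot\rangle$ be the Minkowski form on $\mathbb R^3$ with quadratic form $x^2+y^2-z^2$, $\mathbf H=\{\langle u,u\rangle=-1,\ z>0\}$ the hyperbolic plane, $L^+=\{\langle u,u\rangle=0,\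 z>0\}$, and $h(u)=\{w\in\mathbf H:\langle w,u\rangle=-1\}$ the horocycle of $u\in L^+$; put $\lambda(h(u),h(v))=\sqrt{-\langle u,v\rangle}$. For $K>1$, a *stretch map with factor $K$* between ideal triangles is a $K$-Lipschitz homeomorphism that multiplies arclength by $K$ on each side and whose Lipschitz constant on every closed disk in the interior is $<K$; for $K=1$ it is an isometry, and for $0<K<1$ the inverse of a stretch map with factor $1/K$. **Development.** Let $p:\widetilde F\to F$ be the universal cover with lifted triangulation $\widetilde\Delta$. Fix a decorated broken hyperbolic structure $H$, a face $T_0$ of $\widetilde\Delta$, and an ideal triangle $t_0$ in $\mathbf H$ with labelled vertices. A *development* consists of a rescaling factor $c(T)>0$ for each face $T$ of $\widetilde\Delta$ and lifts $z(T,v)\in L^+$ of its vertices such that: $c(T_0)=1$; if $T,T'$ are adjacent along an edge then $c(T')\,\sigma(T,T')=c(T)$ (so the rescaled edge metrics agree); the $z(T_0,v)$ lie on the rays of the vertices of $t_0$; for any edge $e$ of $T$ with endpoints $v,w$, $$\lambda\bigl(h(z(T,v)),h(z(T,w))\bigr)=\sqrt{2\exp\bigl(c(T)\,\delta_H(T,e)\bigr)};$$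 adjacent faces have the same lifts of their two common vertices $u,v$, and the lifts of their other vertices lie on opposite sides of the plane through $0$, $z(u)$, $z(v)$. **Proposition.** The development exists and is unique. It is realized by a map $D:\widetilde F\to\mathbf H$, a homeomorphism onto an open subset, that takes every face $T$ of $\widetilde\Delta$ onto the ideal triangle with vertices $z(T,\cdot)$, acts on each side of $T$ as a homothety multiplying the arclength of $H$ by $c(T)$, and takes the points where the decoration meets the edges of $T$ to the horocycles $h(z(T,\cdot))$, such that the hyperbolic structure on $\widetilde F$ pulled back by $D$ is a covering hyperbolic structure: the lifted triangulation is a geodesic triangulation by ideal triangles, and there is a homomorphism $\varphi$ from the group of covering translations of $p$ (that is, $\pi_1(F)$) to $\mathbb R_+$ such that every covering translation $\alpha$ restricts, on each triangle of $\widetilde\Delta$, to a stretch map with factor $\varphi(\alpha)$ onto the image triangle. -/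

import Mathlib

open Topology

noncomputable section

/-! ## The hyperboloid model -/

/-- The Minkowski inner product with quadratic form `x² + y² - z²`. -/
def mink (u v : Fin 3 → ℝ) : ℝ := u 0 * v 0 + u 1 * v 1 - u 2 * v 2

/-- The hyperbolic plane: the upper sheet of the hyperboloid `⟨u, u⟩ = -1`. -/
abbrev HypPlane : Type := {u : Fin 3 → ℝ // mink u u = -1 ∧ 0 < u 2}

/-- The hyperbolic distance. -/
def hdist (u v : HypPlane) : ℝ := Real.arcosh (-mink u.1 v.1)

/-- The open positive light cone; the point `u` stands for the horocycle `horocycle u`. -/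
def lightCone : Set (Fin 3 → ℝ) := {u | mink u u = 0 ∧ 0 < u 2}

/-- The horocycle that corresponds to a point of the light cone. -/
def horocycle (u : Fin 3 → ℝ) : Set HypPlane := {w | mink w.1 u = -1}

/-- The λ-length of the two horocycles `horocycle u` and `horocycle v`. -/
def lambdaCone (u v : Fin 3 → ℝ) : ℝ := Real.sqrt (-mink u v)

/-- The λ-length of two horocycles at signed distance `δ`. -/
def lambdaOfDist (δ : ℝ) : ℝ := Real.sqrt (2 * Real.exp δ)

/-! ## Ideal triangles -/

/-- Three points on the light cone that span three distinct ideal points. -/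
def IsIdealTriple (u : Fin 3 → Fin 3 → ℝ) : Prop :=
  (∀ k, u k ∈ lightCone) ∧ LinearIndependent ℝ u

/-- The ideal triangle (with its sides, without its ideal vertices) whose ideal vertices are the
rays through `u 0`, `u 1`, `u 2`. It depends on the rays only. -/
def idealTriangle (u : Fin 3 → Fin 3 → ℝ) : Set HypPlane :=
  {w | ∃ a : Fin 3 → ℝ, (∀ k, 0 ≤ a k) ∧ w.1 = ∑ k, a k • u k}

/-- The interior of an ideal triangle. -/
def idealInterior (u : Fin 3 → Fin 3 → ℝ) : Set HypPlane :=
  {w | ∃ a : Fin 3 → ℝ, (∀ k, 0 < a k) ∧ w.1 = ∑ k, a k • u k}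

/-- The side of an ideal triangle opposite to the vertex `i`: the complete geodesic that joins
the vertices `i + 1` and `i + 2` (indices modulo 3). -/
def idealSide (u : Fin 3 → Fin 3 → ℝ) (i : Fin 3) : Set HypPlane :=
  {w | ∃ a : Fin 3 → ℝ, (∀ k, 0 ≤ a k) ∧ a i = 0 ∧ w.1 = ∑ k, a k • u k}

/-! ## Stretch maps between ideal triangles -/

/-- `K`-Lipschitz stretch maps for `K > 1`: a `K`-Lipschitz homeomorphism that multiplies arclength
by `K` on every side, and whose Lipschitz constant is strictly less than `K` on every closed disk
in the interior (equivalently, on every compact subset of the interior). -/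
structure IsExpandingStretch (K : ℝ) {u v : Fin 3 → Fin 3 → ℝ}
    (f : idealTriangle u ≃ₜ idealTriangle v) : Prop where
  lipschitz : ∀ x y, hdist (f x) (f y) ≤ K * hdist x y
  side : ∀ i, ∃ j, (∀ x : idealTriangle u, x.1 ∈ idealSide u i ↔ (f x).1 ∈ idealSide v j) ∧
    ∀ x y : idealTriangle u, x.1 ∈ idealSide u i → y.1 ∈ idealSide u i →
      hdist (f x) (f y) = K * hdist x y
  strict : ∀ C : Set (idealTriangle u), IsCompact C → (∀ x ∈ C, x.1 ∈ idealInterior u) →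
    ∃ L < K, ∀ x ∈ C, ∀ y ∈ C, hdist (f x) (f y) ≤ L * hdist x y

/-- Stretch maps between ideal triangles with factor `K > 0`: as above for `K > 1`, isometries for
`K = 1`, and inverses of stretch maps with factor `1 / K` for `K < 1`. -/
def IsStretchMap (K : ℝ) {u v : Fin 3 → Fin 3 → ℝ}
    (f : idealTriangle u ≃ₜ idealTriangle v) : Prop :=
  (1 < K ∧ IsExpandingStretch K f) ∨
  (K = 1 ∧ ∀ x y, hdist (f x) (f y) = hdist x y) ∨
  (0 < K ∧ K < 1 ∧ IsExpandingStretch K⁻¹ f.symm)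

/-! ## The standard ideal triangle -/

/-- Light-like vectors over the third roots of unity, in counterclockwise order, normalized so that
the three horocycles are pairwise tangent, at the distinguished points of the three sides. -/
def stdVertex : Fin 3 → Fin 3 → ℝ :=
  ![![2 / Real.sqrt 3, 0, 2 / Real.sqrt 3],
    ![-(1 / Real.sqrt 3), 1, 2 / Real.sqrt 3],
    ![-(1 / Real.sqrt 3), -1, 2 / Real.sqrt 3]]

/-- The standard ideal triangle. -/
abbrev StdTriangle : Type := idealTriangle stdVertex

lemma mink_stdVertex (i j : Fin 3) :
    mink (stdVertex i) (stdVertex j) = if i = j then 0 else -2 := by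
  have h : Real.sqrt 3 ^ 2 = 3 := Real.sq_sqrt (by norm_num)
  have h0 : Real.sqrt 3 ≠ 0 := by positivity
  fin_cases i <;> fin_cases j <;> simp [mink, stdVertex] <;> field_simp <;>
    nlinarith [h]

/-- The vector of the point with parameter `s` on the side `i` of the standard ideal triangle. -/
def sideVec (i : Fin 3) (s : ℝ) : Fin 3 → ℝ :=
  (Real.exp (-s) / 2) • stdVertex (i + 1) + (Real.exp s / 2) • stdVertex (i + 2)

lemma sideVec_mem (i : Fin 3) (s : ℝ) :
    mink (sideVec i s) (sideVec i s) = -1 ∧ 0 < sideVec i s 2 := by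
  have hz : ∀ k, stdVertex k 2 = 2 / Real.sqrt 3 := by
    intro k; fin_cases k <;> simp [stdVertex]
  have hne : i + 1 ≠ i + 2 := by fin_cases i <;> decide
  have e : Real.exp (-s) * Real.exp s = 1 := by rw [← Real.exp_add]; simp
  have key : ∀ (a b : ℝ) (u v : Fin 3 → ℝ), mink (a • u + b • v) (a • u + b • v)
      = a * a * mink u u + 2 * (a * b) * mink u v + b * b * mink v v := by
    intro a b u v; simp [mink]; ring
  refine ⟨?_, ?_⟩
  · rw [sideVec, key]
    simp only [mink_stdVertex, if_neg hne, if_true]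
    nlinarith [e]
  · simp only [sideVec, Pi.add_apply, Pi.smul_apply, smul_eq_mul, hz]
    positivity

/-- The arclength parametrization of the side `i` of the standard ideal triangle, in the direction
from the vertex `i + 1` to the vertex `i + 2` (the boundary orientation). The parameter vanishes
at the distinguished point of the side, the foot of the perpendicular from the center. -/
def sidePoint (i : Fin 3) (s : ℝ) : StdTriangle :=
  ⟨⟨sideVec i s, sideVec_mem i s⟩,
    fun k => if k = i + 1 then Real.exp (-s) / 2 else if k = i + 2 then Real.exp s / 2 else 0,
    fun k => by dsimp only; split_ifs <;> positivity,
    by fin_cases i <;> simp [sideVec, Fin.sum_univ_three, add_comm]⟩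

/-! ## Broken hyperbolic structures -/

/-- Gluing data for ideal triangles. The faces are copies of the standard ideal triangle; the side
`i` of the face `f` (the triangle-edge pair `(f, i)`) is glued to the side `pair (f, i)`, and the
gluing, expressed in the arclength parameters of the two sides, is the orientation-reversing
homothety `s ↦ -(scale (f, i) * s + shift (f, i))`. -/
structure GluingData where
  Face : Type
  finite_face : Finite Face
  pair : Face × Fin 3 → Face × Fin 3
  pair_pair : ∀ x, pair (pair x) = x
  pair_ne : ∀ x, pair x ≠ x
  /-- the homothetic scaling factor: (length in the face across the edge) / (length in `f`) -/
  scale : Face × Fin 3 → ℝ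
  scale_pos : ∀ x, 0 < scale x
  shift : Face × Fin 3 → ℝ
  /-- the gluing map of `pair x` is inverse to the gluing map of `x` -/
  scale_pair : ∀ x, scale (pair x) * scale x = 1
  shift_pair : ∀ x, shift (pair x) * scale x = shift x

namespace GluingData

variable (G : GluingData)

/-- A corner `(f, k)` is the face `f` at its vertex `k`. `exitSide` is the side that one crosses
when one turns counterclockwise about that vertex. -/
def exitSide (x : G.Face × Fin 3) : G.Face × Fin 3 := (x.1, x.2 + 1)

/-- The next corner, counterclockwise, at the same puncture. -/
def next (x : G.Face × Fin 3) : G.Face × Fin 3 :=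
  ((G.pair (G.exitSide x)).1, (G.pair (G.exitSide x)).2 + 1)

/-- Product of the scaling factors along `n` consecutive faces about a puncture. -/
def holonomy (x : G.Face × Fin 3) : ℕ → ℝ
  | 0 => 1
  | n + 1 => holonomy x n * G.scale (G.exitSide (G.next^[n] x))

/-- In a corner `(f, k)` the horocyclic arc of depth `d` is the arc centered at the vertex `k` that
meets the two sides adjacent to this vertex at distance `d` from their distinguished points, towards
the vertex. The leaf of the horocyclic foliation that contains the arc of depth `d` of the corner `x`
has depth `transport x n d` in the `n`-th following corner. -/
def transport (x : G.Face × Fin 3) : ℕ → ℝ → ℝ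
  | 0, d => d
  | n + 1, d => G.scale (G.exitSide (G.next^[n] x)) * transport x n d
      + G.shift (G.exitSide (G.next^[n] x))

/-- No horocyclic holonomy about the punctures. -/
def NoHorocyclicHolonomy : Prop :=
  ∀ x n, G.next^[n] x = x → G.holonomy x n = 1

/-- Completeness: near every puncture the leaves of the horocyclic foliation close up. -/
def Complete : Prop :=
  ∀ x n, G.next^[n] x = x → ∀ᶠ d in Filter.atTop, G.transport x n d = d

end GluingData

/-- An ideal triangulation of the surface `F` together with a broken hyperbolic structure on it.
For every face `f`, the map `chart f` is the (orientation-preserving) isometry of the standard ideal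
triangle onto the completed face followed by the map of the latter to `F`; the surface is the
quotient of the disjoint union of the ideal triangles by the gluing maps between their sides. -/
structure BrokenHyperbolicStructure (F : Type*) [TopologicalSpace F] extends GluingData where
  chart : Face → StdTriangle → F
  isQuotientMap_chart : IsQuotientMap (fun x : (Σ _ : Face, StdTriangle) => chart x.1 x.2)
  chart_eq_iff : ∀ (f g : Face) (x y : StdTriangle), chart f x = chart g y ↔
    (f = g ∧ x = y) ∨ ∃ (i j : Fin 3) (s : ℝ), pair (f, i) = (g, j) ∧ x = sidePoint i s ∧
      y = sidePoint j (-(scale (f, i) * s + shift (f, i)))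
  noHorocyclicHolonomy : toGluingData.NoHorocyclicHolonomy
  complete : toGluingData.Complete

/-- A decoration: a closed leaf of the horocyclic foliation about every puncture, given by its
depths in the corners. -/
structure Decoration {F : Type*} [TopologicalSpace F] (H : BrokenHyperbolicStructure F) where
  depth : H.Face × Fin 3 → ℝ
  depth_nonneg : ∀ x, 0 ≤ depth x
  depth_next : ∀ x, depth (H.next x) =
    H.scale (H.exitSide x) * depth x + H.shift (H.exitSide x)

/-- The distance, in the metric of the face, between the two horocyclic arcs that meet the side `i`
of the face `f`. The λ-length of the triangle-edge pair `(f, i)` is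
`lambdaOfDist (horoDist dec (f, i))`. -/
def horoDist {F : Type*} [TopologicalSpace F] {H : BrokenHyperbolicStructure F}
    (dec : Decoration H) (x : H.Face × Fin 3) : ℝ :=
  dec.depth (x.1, x.2 + 1) + dec.depth (x.1, x.2 + 2)

/-! ## The universal cover and the lifted triangulation -/

/-- The group of covering translations of `p`. -/
def coveringTranslations {E F : Type*} [TopologicalSpace E] (p : E → F) : Subgroup (E ≃ₜ E) where
  carrier := {α | ∀ x, p (α x) = p x}
  mul_mem' := by
    intro a b ha hb x
    show p (a (b x)) = p x
    rw [ha, hb]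
  one_mem' := fun _ => rfl
  inv_mem' := by
    intro a ha x
    show p (a.symm x) = p x
    rw [← ha (a.symm x), Homeomorph.apply_symm_apply]

/-- A triangle of the lifted triangulation: a face together with a lift of its chart. -/
structure LiftedFace {E F : Type*} [TopologicalSpace E] [TopologicalSpace F]
    (H : BrokenHyperbolicStructure F) (p : E → F) where
  face : H.Face
  lift : StdTriangle → E
  continuous_lift : Continuous lift
  lift_spec : ∀ x, p (lift x) = H.chart face x

/-- The lifted triangle `T` along its side `i` meets the lifted triangle `T'` along its side `j`. -/
def LiftedFace.Adj {E F : Type*} [TopologicalSpace E] [TopologicalSpace F]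
    {H : BrokenHyperbolicStructure F} {p : E → F}
    (T : LiftedFace H p) (i : Fin 3) (T' : LiftedFace H p) (j : Fin 3) : Prop :=
  H.pair (T.face, i) = (T'.face, j) ∧
  ∀ s, T.lift (sidePoint i s) =
    T'.lift (sidePoint j (-(H.scale (T.face, i) * s + H.shift (T.face, i))))

/-! ## The development of a broken hyperbolic structure -/

/-- The development, with the lifted triangle `T₀` normalized to the ideal triangle with vertices on
the rays of `r`. The metric of every lifted triangle `T` is rescaled by a factor `c T` such that the
metrics induced on common edges agree (`c T₀ = 1`); `z T k` is the lift to the light cone of the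
vertex `k` of `T`. The λ-lengths of the rescaled triangles are realized, adjacent triangles share
the lifts of their common vertices, and their remaining vertices are lifted to opposite sides of the
plane through the lifts of the common ones. -/
structure IsDevelopment {E F : Type*} [TopologicalSpace E] [TopologicalSpace F]
    {H : BrokenHyperbolicStructure F} (dec : Decoration H) (p : E → F)
    (T₀ : LiftedFace H p) (r : Fin 3 → Fin 3 → ℝ)
    (c : LiftedFace H p → ℝ) (z : LiftedFace H p → Fin 3 → Fin 3 → ℝ) : Prop where
  scale_base : c T₀ = 1
  scale_adj : ∀ T i T' j, T.Adj i T' j → c T' * H.scale (T.face, i) = c T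
  mem_cone : ∀ T k, z T k ∈ lightCone
  base : ∀ k, ∃ t : ℝ, 0 < t ∧ z T₀ k = t • r k
  lambda : ∀ T i, lambdaCone (z T (i + 1)) (z T (i + 2)) =
    lambdaOfDist (c T * horoDist dec (T.face, i))
  share : ∀ T i T' j, T.Adj i T' j → z T' (j + 1) = z T (i + 2) ∧ z T' (j + 2) = z T (i + 1)
  opposite : ∀ T i T' j, T.Adj i T' j →
    Matrix.det (Matrix.of ![z T (i + 1), z T (i + 2), z T i]) *
      Matrix.det (Matrix.of ![z T (i + 1), z T (i + 2), z T' j]) < 0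

/-- A map from the universal cover to the hyperbolic plane that realizes the development `(c, z)`:
an injection (a homeomorphism onto an open set) that takes every lifted triangle `T` onto the
ideal triangle with vertices `z T`, acts on every side of `T` as a homothety that multiplies the
arclength of the broken structure by `c T`, and takes the points where the decoration meets the
sides to the horocycles of `z T`. -/
structure RealizesDevelopment {E F : Type*} [TopologicalSpace E] [TopologicalSpace F]
    {H : BrokenHyperbolicStructure F} (dec : Decoration H) (p : E → F)
    (c : LiftedFace H p → ℝ) (z : LiftedFace H p → Fin 3 → Fin 3 → ℝ)
    (D : E → HypPlane) : Prop where
  isOpenEmbedding : IsOpenEmbedding D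
  image_face : ∀ T : LiftedFace H p, Set.range (fun x => D (T.lift x)) = idealTriangle (z T)
  image_side : ∀ (T : LiftedFace H p) i,
    Set.range (fun s => D (T.lift (sidePoint i s))) = idealSide (z T) i
  homothety : ∀ (T : LiftedFace H p) i s t,
    hdist (D (T.lift (sidePoint i s))) (D (T.lift (sidePoint i t))) =
      c T * hdist (sidePoint i s).1 (sidePoint i t).1
  horocycle_head : ∀ (T : LiftedFace H p) i,
    D (T.lift (sidePoint i (dec.depth (T.face, i + 2)))) ∈ horocycle (z T (i + 2))
  horocycle_tail : ∀ (T : LiftedFace H p) i,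
    D (T.lift (sidePoint i (-dec.depth (T.face, i + 1)))) ∈ horocycle (z T (i + 1))

/-! ## Covering hyperbolic structures -/

/-- A hyperbolic structure on the simply connected surface `E`, given by its developing map `D` (a
local homeomorphism to the hyperbolic plane, from which the metric is pulled back), is a covering
hyperbolic structure with stretch homomorphism `φ` if the lifted triangulation is a geodesic
triangulation by ideal triangles and every covering translation `α` restricts to a stretch map with
factor `φ α` from each of its triangles to the image triangle. -/
structure IsCoveringHyperbolicStructure {E F : Type*} [TopologicalSpace E] [TopologicalSpace F]
    (H : BrokenHyperbolicStructure F) (p : E → F)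
    (φ : coveringTranslations p →* {t : ℝ // 0 < t}) (D : E → HypPlane) : Prop where
  isLocalHomeomorph : IsLocalHomeomorph D
  geodesic : ∀ T : LiftedFace H p, Function.Injective (fun x => D (T.lift x)) ∧
    ∃ u, IsIdealTriple u ∧ Set.range (fun x => D (T.lift x)) = idealTriangle u ∧
      ∀ i, Set.range (fun s => D (T.lift (sidePoint i s))) = idealSide u i
  stretch : ∀ (α : coveringTranslations p) (T : LiftedFace H p),
    ∃ u v, IsIdealTriple u ∧ IsIdealTriple v ∧
      Set.range (fun x => D (T.lift x)) = idealTriangle u ∧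
      Set.range (fun x => D (α.1 (T.lift x))) = idealTriangle v ∧
      ∃ f : idealTriangle u ≃ₜ idealTriangle v, IsStretchMap (φ α : ℝ) f ∧
        ∀ (x : StdTriangle) (hx : D (T.lift x) ∈ idealTriangle u),
          (f ⟨D (T.lift x), hx⟩ : HypPlane) = D (α.1 (T.lift x))

end

/-! A development amounts to giving every lifted triangle `T` a factor `c T` and a triple `Z T` of
light-like vectors with pairwise product `-2` over its ideal vertices. Crossing a side divides `c`
by the gluing factor and replaces `Z` by the triple `unfold` of the neighbouring triangle, shifted
along the common side. Crossing back undoes this, so the pairs `(c, Z)` are labels with invertible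
transitions across the edges. Punctures are not points of the surface, so there is no condition at
vertices: the labels form a covering space of `F`, and over the simply connected `E` every initial
label extends (`exists_labelling`). The lifts `z T k` are the vectors `Z T k` multiplied by `exp (c
T * depth)`; the rule for depths of a closed leaf makes adjacent triangles share them. Uniqueness
propagates along adjacencies, since a light-like vector is determined by its products with two
vectors and its side of their plane (`eq_of_mink_eq_of_det`).

The developing map sends `T` to the ideal triangle of `Z T` by a standard self-map that multiplies
side parameters by `c T`, so it glues along the sides. It is injective because each unfolding lies
beyond the side it was unfolded over (`adj_of_chain`), and open because at most two triangles meet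
at a point (`mem_nhds_of_forall`).

For covering translations to act by stretch maps, the self-maps are taken from a flow
`Bary.stretch`, used at time `log (c T)`. In a spike with horizontal coordinate `x` and depth `η`
the obvious flow has speed `η` along the geodesics to the ideal vertex; it multiplies lengths on all
of these by `exp t`, so its Lipschitz constant is not smaller in the interior. The speed used here
is `η + φ² exp (-2η)` with `φ = (1 - x²)/16`, cut off at zero. The correction vanishes on the sides
and makes vertical expansion strictly weaker inside; the variation of `φ` between leaves is paid for
by the shrinking of horocyclic arcs (`spike_estimate`). By `lt_of_speed_ne_zero` the three flows
have disjoint supports, and cutting geodesic segments at resting points gives the estimate on the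
whole triangle (`hypDist_stretch_le_of_spikes`). -/

noncomputable section

/-! ### Completeness of Lipschitz vector fields -/

open Set Metric in
lemma exists_solution_uniform_time {E : Type*} [NormedAddCommGroup E] [NormedSpace ℝ E]
    [CompleteSpace E] {v : E → E} {K : NNReal} (hv : LipschitzWith K v) :
    ∃ T : ℝ, 0 < T ∧ ∀ x, ∃ γ : ℝ → E, γ 0 = x ∧ ∀ t ∈ Ioo (-T) T, HasDerivAt γ (v (γ t)) t := by
  have hK : (0 : ℝ) ≤ K := K.2
  refine ⟨1 / (2 * (K + 1)), by positivity, fun x => ?_⟩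
  set T : ℝ := 1 / (2 * (K + 1)) with hT
  have hT0 : 0 < T := by positivity
  have h0 : (0 : ℝ) ∈ Icc (-T) T := ⟨by linarith, hT0.le⟩
  -- On the ball of radius `‖v x‖` the field is bounded by `(1 + K) ‖v x‖`, so solutions travel at
  -- most `‖v x‖ / 2` in time `T`. A radius proportional to the initial speed makes `T` independent
  -- of `x`.
  have hpl : IsPicardLindelof (fun _ => v) (⟨0, h0⟩ : Icc (-T) T) x ‖v x‖₊ 0
      (‖v x‖₊ * (1 + K)) K := by
    refine IsPicardLindelof.of_time_independent ?_ hv.lipschitzOnWith ?_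
    · intro y hy
      have h1 : ‖v y - v x‖ ≤ K * ‖y - x‖ := hv.norm_sub_le y x
      have h2 : ‖y - x‖ ≤ ‖v x‖ := by simpa [dist_eq_norm] using hy
      have h3 : ‖v y‖ ≤ ‖v y - v x‖ + ‖v x‖ := norm_le_norm_sub_add (v y) (v x)
      have h4 := mul_le_mul_of_nonneg_left h2 hK
      push_cast
      nlinarith
    · simp only [sub_zero, zero_sub, neg_neg, max_self]
      push_cast
      have : (1 + (K : ℝ)) * T = 1 / 2 := by rw [hT]; field_simp; ring
      nlinarith [norm_nonneg (v x)]
  obtain ⟨γ, h1, h2⟩ := hpl.exists_eq_forall_mem_Icc_hasDerivWithinAt₀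
  exact ⟨γ, h1, fun t ht => (h2 t (Ioo_subset_Icc_self ht)).hasDerivAt (Icc_mem_nhds ht.1 ht.2)⟩

open Set in
lemma solution_unique_Ioo {E : Type*} [NormedAddCommGroup E] [NormedSpace ℝ E]
    {v : E → E} {K : NNReal} (hv : LipschitzWith K v) {a b s : ℝ} (hs : s ∈ Ioo a b) {γ γ' : ℝ → E}
    (h : ∀ t ∈ Ioo a b, HasDerivAt γ (v (γ t)) t) (h' : ∀ t ∈ Ioo a b, HasDerivAt γ' (v (γ' t)) t)
    (hh : γ s = γ' s) : EqOn γ γ' (Ioo a b) :=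
  ODE_solution_unique_of_mem_Ioo (v := fun _ => v) (s := fun _ => univ) (K := K)
    (fun _ _ => hv.lipschitzOnWith) hs (fun t ht => ⟨h t ht, trivial⟩)
    (fun t ht => ⟨h' t ht, trivial⟩) hh

-- Solutions restarted at times `T / 2` and `-(T / 2)` agree with the original one on overlaps by
-- uniqueness, and reach to `T / 2 + T`. Since the existence time is uniform in `x`, this can be
-- iterated.
open Set in
lemma exists_solution_longer_time {E : Type*} [NormedAddCommGroup E] [NormedSpace ℝ E]
    {v : E → E} {K : NNReal} (hv : LipschitzWith K v) {T : ℝ} (hT : 0 < T)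
    (h : ∀ x, ∃ γ : ℝ → E, γ 0 = x ∧ ∀ t ∈ Ioo (-T) T, HasDerivAt γ (v (γ t)) t) (x : E) :
    ∃ γ : ℝ → E, γ 0 = x ∧ ∀ t ∈ Ioo (-(3 / 2 * T)) (3 / 2 * T), HasDerivAt γ (v (γ t)) t := by
  obtain ⟨α, hα, hα'⟩ := h x
  obtain ⟨β, hβ, hβ'⟩ := h (α (T / 2))
  obtain ⟨δ, hδ, hδ'⟩ := h (α (-(T / 2)))
  have hb : ∀ t ∈ Ioo (-(T / 2)) (3 / 2 * T),
      HasDerivAt (fun t => β (t - T / 2)) (v (β (t - T / 2))) t := fun t ht =>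
    (hβ' (t - T / 2) ⟨by linarith [ht.1], by linarith [ht.2]⟩).comp_sub_const t (T / 2)
  have hd : ∀ t ∈ Ioo (-(3 / 2 * T)) (T / 2),
      HasDerivAt (fun t => δ (t + T / 2)) (v (δ (t + T / 2))) t := fun t ht =>
    (hδ' (t + T / 2) ⟨by linarith [ht.1], by linarith [ht.2]⟩).comp_add_const t (T / 2)
  have eb : EqOn α (fun t => β (t - T / 2)) (Ioo (-(T / 2)) T) :=
    solution_unique_Ioo hv (s := T / 2) ⟨by linarith, by linarith⟩
      (fun t ht => hα' t ⟨by linarith [ht.1], ht.2⟩)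
      (fun t ht => hb t ⟨ht.1, by linarith [ht.2]⟩) (by simp [hβ])
  have ed : EqOn α (fun t => δ (t + T / 2)) (Ioo (-T) (T / 2)) :=
    solution_unique_Ioo hv (s := -(T / 2)) ⟨by linarith, by linarith⟩
      (fun t ht => hα' t ⟨ht.1, by linarith [ht.2]⟩)
      (fun t ht => hd t ⟨by linarith [ht.1], ht.2⟩) (by simp [hδ])
  let γ : ℝ → E := fun t => if t ≤ -(T / 2) then δ (t + T / 2) else
    if T / 2 ≤ t then β (t - T / 2) else α t
  have gd : EqOn γ (fun t => δ (t + T / 2)) (Ioo (-(3 / 2 * T)) (T / 2)) := by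
    intro t ht
    by_cases h1 : t ≤ -(T / 2)
    · simp [γ, h1]
    · simp only [γ, if_neg h1, if_neg (not_le.2 ht.2)]
      exact ed ⟨by linarith, ht.2⟩
  have gb : EqOn γ (fun t => β (t - T / 2)) (Ioo (-(T / 2)) (3 / 2 * T)) := by
    intro t ht
    simp only [γ, if_neg (not_le.2 ht.1)]
    split_ifs with h1
    · rfl
    · exact eb ⟨ht.1, by linarith⟩
  refine ⟨γ, ?_, fun t ht => ?_⟩
  · simp only [γ, if_neg (show ¬ (0 : ℝ) ≤ -(T / 2) by linarith),
      if_neg (show ¬ T / 2 ≤ 0 by linarith), hα]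
  · rcases lt_or_ge t (T / 2) with h1 | h1
    · have m : t ∈ Ioo (-(3 / 2 * T)) (T / 2) := ⟨ht.1, h1⟩
      rw [gd m]
      exact (hd t m).congr_of_eventuallyEq (gd.eventuallyEq_of_mem (isOpen_Ioo.mem_nhds m))
    · have m : t ∈ Ioo (-(T / 2)) (3 / 2 * T) := ⟨by linarith, ht.2⟩
      rw [gb m]
      exact (hb t m).congr_of_eventuallyEq (gb.eventuallyEq_of_mem (isOpen_Ioo.mem_nhds m))

open Set in
/-- Lipschitz vector fields on Banach spaces are complete. -/
theorem LipschitzWith.exists_global_solution {E : Type*} [NormedAddCommGroup E] [NormedSpace ℝ E]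
    [CompleteSpace E] {v : E → E} {K : NNReal} (hv : LipschitzWith K v) (x : E) :
    ∃ γ : ℝ → E, γ 0 = x ∧ ∀ t, HasDerivAt γ (v (γ t)) t := by
  obtain ⟨T, hT, h⟩ := exists_solution_uniform_time hv
  have key : ∀ n : ℕ, ∀ x, ∃ γ : ℝ → E, γ 0 = x ∧
      ∀ t ∈ Ioo (-((3 / 2) ^ n * T)) ((3 / 2) ^ n * T), HasDerivAt γ (v (γ t)) t := by
    intro n
    induction n with
    | zero => simpa using h
    | succ n ih =>
      intro x
      have := exists_solution_longer_time hv (by positivity) ih x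
      simpa only [pow_succ', mul_assoc] using this
  choose γ h0 hγ using fun n => key n x
  have big : ∀ r : ℝ, ∃ n : ℕ, r < (3 / 2) ^ n * T := by
    intro r
    obtain ⟨n, hn⟩ := pow_unbounded_of_one_lt (r / T) (show (1 : ℝ) < 3 / 2 by norm_num)
    exact ⟨n, by rwa [div_lt_iff₀ hT] at hn⟩
  choose N hN using big
  have agree : ∀ m n : ℕ, ∀ t : ℝ, |t| < (3 / 2) ^ m * T → |t| < (3 / 2) ^ n * T →
      γ m t = γ n t := by
    intro m n t hm hn
    set r := min ((3 / 2 : ℝ) ^ m * T) ((3 / 2) ^ n * T)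
    have hr : |t| < r := lt_min hm hn
    have h1 : r ≤ (3 / 2 : ℝ) ^ m * T := min_le_left _ _
    have h2 : r ≤ (3 / 2 : ℝ) ^ n * T := min_le_right _ _
    have hr0 : 0 < r := (abs_nonneg t).trans_lt hr
    exact solution_unique_Ioo hv (a := -r) (b := r) (s := 0) ⟨by linarith, hr0⟩
      (fun s hs => hγ m s ⟨by linarith [hs.1], by linarith [hs.2]⟩)
      (fun s hs => hγ n s ⟨by linarith [hs.1], by linarith [hs.2]⟩)
      ((h0 m).trans (h0 n).symm) (abs_lt.1 hr)
  -- At each time a solution is chosen whose interval contains that time; by `agree` the resulting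
  -- curve coincides near `t` with a single solution.
  refine ⟨fun t => γ (N |t|) t, h0 _, fun t => ?_⟩
  have hb := hN (|t| + 1)
  set n := N (|t| + 1)
  have ht : |t| < (3 / 2) ^ n * T := by linarith
  have e : (fun s => γ (N |s|) s) =ᶠ[𝓝 t] γ n := by
    have : ∀ᶠ s in 𝓝 t, |s| < (3 / 2) ^ n * T :=
      (continuous_abs.tendsto t).eventually (gt_mem_nhds ht)
    filter_upwards [this] with s hs using agree _ _ s (hN _) hs
  have e' : γ (N |t|) t = γ n t := e.eq_of_nhds
  show HasDerivAt _ (v (γ (N |t|) t)) t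
  rw [e']
  exact (hγ n t (abs_lt.1 ht)).congr_of_eventuallyEq e

/-! ## The vertical flow in a spike -/

/-- The speed of the stretch flow at horocyclic depth `η` on the leaf with parameter `f`. -/
def spikeSpeed (f η : ℝ) : ℝ := max 0 (η + f * Real.exp (-2 * max η (-1 / 2)))

lemma exp_one_lt_three : Real.exp 1 < 3 := lt_trans Real.exp_one_lt_d9 (by norm_num)

lemma exp_neg_two_max_le (η : ℝ) : Real.exp (-2 * max η (-1 / 2)) ≤ 3 := by
  have h : -2 * max η (-1 / 2) ≤ 1 := by linarith [le_max_right η (-1 / 2)]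
  exact (Real.exp_le_exp.2 h).trans exp_one_lt_three.le

lemma abs_exp_sub_exp_le {a b M : ℝ} (ha : a ≤ M) (hb : b ≤ M) :
    |Real.exp a - Real.exp b| ≤ Real.exp M * |a - b| := by
  wlog h : b ≤ a generalizing a b
  · rw [abs_sub_comm, abs_sub_comm a b]
    exact this hb ha (le_of_not_ge h)
  rw [abs_of_nonneg (sub_nonneg.2 (Real.exp_le_exp.2 h)), abs_of_nonneg (sub_nonneg.2 h)]
  have h1 : 1 - (a - b) ≤ Real.exp (b - a) := by linarith [Real.add_one_le_exp (b - a)]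
  have h2 : Real.exp b = Real.exp a * Real.exp (b - a) := by rw [← Real.exp_add]; ring_nf
  have h3 : Real.exp a ≤ Real.exp M := Real.exp_le_exp.2 ha
  rw [h2]
  nlinarith [Real.exp_pos a, mul_le_mul_of_nonneg_right h3 (sub_nonneg.2 h)]

/-- The cutoff at `-1 / 2` keeps the exponential below `e < 3`, and `f ≤ 1 / 64` makes its
contribution to the slope at most `6 / 64`. The dependence on `f` is needed for continuity of the
flow across leaves. -/
lemma abs_spikeSpeed_sub_le {f f' η η' : ℝ} (hf : 0 ≤ f) (hf' : f ≤ 1 / 64) :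
    |spikeSpeed f η - spikeSpeed f' η'| ≤ 2 * |η - η'| + 3 * |f - f'| := by
  unfold spikeSpeed
  set k := Real.exp (-2 * max η (-1 / 2))
  set k' := Real.exp (-2 * max η' (-1 / 2))
  have hk : |k - k'| ≤ 6 * |η - η'| := by
    have h1 : -2 * max η (-1 / 2) ≤ 1 := by linarith [le_max_right η (-1 / 2)]
    have h2 : -2 * max η' (-1 / 2) ≤ 1 := by linarith [le_max_right η' (-1 / 2)]
    have h3 : |max η (-1 / 2) - max η' (-1 / 2)| ≤ |η - η'| := abs_max_sub_max_le_abs _ _ _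
    calc |k - k'| ≤ Real.exp 1 * |-2 * max η (-1 / 2) - -2 * max η' (-1 / 2)| :=
          abs_exp_sub_exp_le h1 h2
      _ = Real.exp 1 * 2 * |max η (-1 / 2) - max η' (-1 / 2)| := by
          rw [← mul_sub, abs_mul]; norm_num; ring
      _ ≤ 3 * 2 * |η - η'| := by
          gcongr
          exact exp_one_lt_three.le
      _ = 6 * |η - η'| := by ring
  have hk3 : k' ≤ 3 := exp_neg_two_max_le η'
  have hk0 : 0 < k' := Real.exp_pos _
  calc |max 0 (η + f * k) - max 0 (η' + f' * k')|
      ≤ |(η + f * k) - (η' + f' * k')| := by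
        rw [max_comm 0, max_comm 0]; exact abs_max_sub_max_le_abs _ _ _
    _ = |(η - η') + f * (k - k') + (f - f') * k'| := by congr 1; ring
    _ ≤ |η - η'| + |f * (k - k')| + |(f - f') * k'| := abs_add_three _ _ _
    _ ≤ |η - η'| + 1 / 64 * (6 * |η - η'|) + |f - f'| * 3 := by
        rw [abs_mul, abs_mul, abs_of_nonneg hf, abs_of_pos hk0]
        gcongr
    _ ≤ _ := by linarith [abs_nonneg (η - η')]

lemma lipschitzWith_spikeSpeed {f : ℝ} (hf : 0 ≤ f) (hf' : f ≤ 1 / 64) :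
    LipschitzWith 2 (spikeSpeed f) := by
  refine LipschitzWith.of_dist_le_mul fun η η' => ?_
  simpa [Real.dist_eq] using abs_spikeSpeed_sub_le (f' := f) (η := η) (η' := η') hf hf'

/-- The correction is at most `3 / 64` here and cannot outweigh `η`. Hence the flow rests away from
the spike. -/
lemma spikeSpeed_of_le {f η : ℝ} (hf' : f ≤ 1 / 64) (hη : η ≤ -1 / 2) :
    spikeSpeed f η = 0 := by
  refine max_eq_left ?_
  have h := exp_neg_two_max_le η
  have h0 := Real.exp_pos (-2 * max η (-1 / 2))
  nlinarith

lemma spikeSpeed_of_ge {f η : ℝ} (hη : -1 / 2 ≤ η) :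
    spikeSpeed f η = max 0 (η + f * Real.exp (-2 * η)) := by
  rw [spikeSpeed, max_eq_left hη]

open Classical in
/-- The flow of `spikeSpeed f` (the identity for parameters that do not occur). -/
def spikeFlow (f η : ℝ) : ℝ → ℝ :=
  if h : 0 ≤ f ∧ f ≤ 1 / 64 then
    ((lipschitzWith_spikeSpeed h.1 h.2).exists_global_solution η).choose
  else fun _ => η

section
variable {f : ℝ} (hf : 0 ≤ f) (hf' : f ≤ 1 / 64)
include hf hf'

lemma hasDerivAt_spikeFlow (η t : ℝ) :
    HasDerivAt (spikeFlow f η) (spikeSpeed f (spikeFlow f η t)) t := by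
  have h : 0 ≤ f ∧ f ≤ 1 / 64 := ⟨hf, hf'⟩
  rw [spikeFlow, dif_pos h]
  exact ((lipschitzWith_spikeSpeed h.1 h.2).exists_global_solution η).choose_spec.2 t

lemma spikeFlow_zero (η : ℝ) : spikeFlow f η 0 = η := by
  have h : 0 ≤ f ∧ f ≤ 1 / 64 := ⟨hf, hf'⟩
  rw [spikeFlow, dif_pos h]
  exact ((lipschitzWith_spikeSpeed h.1 h.2).exists_global_solution η).choose_spec.1

lemma spikeFlow_eq_of_hasDerivAt {γ : ℝ → ℝ} (hγ : ∀ t, HasDerivAt γ (spikeSpeed f (γ t)) t) :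
    spikeFlow f (γ 0) = γ :=
  ODE_solution_unique_univ (v := fun _ => spikeSpeed f) (s := fun _ => Set.univ) (K := 2) (t₀ := 0)
    (fun _ => (lipschitzWith_spikeSpeed hf hf').lipschitzOnWith)
    (fun t => ⟨hasDerivAt_spikeFlow hf hf' _ t, trivial⟩) (fun t => ⟨hγ t, trivial⟩)
    (spikeFlow_zero hf hf' _)

lemma spikeFlow_add (η s t : ℝ) : spikeFlow f η (s + t) = spikeFlow f (spikeFlow f η s) t := by
  have h := spikeFlow_eq_of_hasDerivAt hf hf' (γ := fun t => spikeFlow f η (s + t))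
    (fun t => (hasDerivAt_spikeFlow hf hf' η (s + t)).comp_const_add s t)
  simp only [add_zero] at h
  rw [h]

lemma spikeFlow_neg_cancel (η t : ℝ) : spikeFlow f (spikeFlow f η t) (-t) = η := by
  rw [← spikeFlow_add hf hf', add_neg_cancel, spikeFlow_zero hf hf']

lemma spikeFlow_of_speed_eq_zero {η : ℝ} (h : spikeSpeed f η = 0) (t : ℝ) :
    spikeFlow f η t = η := by
  have := spikeFlow_eq_of_hasDerivAt hf hf' (γ := fun _ => η)
    (fun t => by simpa [h] using hasDerivAt_const t η)
  exact congrFun this t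

/-- A resting point also rests backwards in time, so no moving point can arrive at one. -/
lemma spikeSpeed_spikeFlow_eq_zero_iff (η t : ℝ) :
    spikeSpeed f (spikeFlow f η t) = 0 ↔ spikeSpeed f η = 0 := by
  constructor
  · intro h
    have h1 := spikeFlow_of_speed_eq_zero hf hf' h (-t)
    rw [spikeFlow_neg_cancel hf hf'] at h1
    rwa [← h1] at h
  · intro h
    rwa [spikeFlow_of_speed_eq_zero hf hf' h]

lemma neg_half_le_spikeFlow {η : ℝ} (hη : -1 / 2 ≤ η) (t : ℝ) : -1 / 2 ≤ spikeFlow f η t := by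
  by_contra! h
  have h1 := spikeFlow_of_speed_eq_zero hf hf' (spikeSpeed_of_le hf' h.le) (-t)
  rw [spikeFlow_neg_cancel hf hf'] at h1
  linarith

/-- The speed is at most `η + 1`. This bounds depths up to time `t`, and so bounds from below the
correction term, which decays with depth. -/
lemma spikeFlow_le {η t : ℝ} (hη : -1 / 2 ≤ η) (ht : 0 ≤ t) :
    spikeFlow f η t ≤ (η + 1) * Real.exp t := by
  have hd : ∀ t, HasDerivAt (fun t => (spikeFlow f η t + 1) * Real.exp (-t))
      (spikeSpeed f (spikeFlow f η t) * Real.exp (-t)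
        + (spikeFlow f η t + 1) * (Real.exp (-t) * -1)) t := fun t =>
    ((hasDerivAt_spikeFlow hf hf' η t).add_const 1).mul ((hasDerivAt_neg t).exp)
  have hanti : Antitone (fun t => (spikeFlow f η t + 1) * Real.exp (-t)) := by
    refine antitone_of_deriv_nonpos (fun t => (hd t).differentiableAt) fun t => ?_
    rw [(hd t).deriv]
    have h1 : spikeSpeed f (spikeFlow f η t) ≤ spikeFlow f η t + 1 := by
      have h2 := neg_half_le_spikeFlow hf hf' hη t
      refine max_le (by linarith) ?_
      have := exp_neg_two_max_le (spikeFlow f η t)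
      have h0 := Real.exp_pos (-2 * max (spikeFlow f η t) (-1 / 2))
      nlinarith
    nlinarith [Real.exp_pos (-t)]
  have h := hanti ht
  simp only [spikeFlow_zero hf hf', neg_zero, Real.exp_zero, mul_one] at h
  have e : Real.exp (-t) * Real.exp t = 1 := by rw [← Real.exp_add]; simp
  have h2 := mul_le_mul_of_nonneg_right h (Real.exp_pos t).le
  rw [mul_assoc, e] at h2
  linarith

lemma injective_spikeFlow {η η' t : ℝ} (h : spikeFlow f η t = spikeFlow f η' t) : η = η' := by
  rw [← spikeFlow_neg_cancel hf hf' η t, h, spikeFlow_neg_cancel hf hf']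

end

/-- The sides of the triangle are leaves with parameter `0`; this is why the flow stretches them by
exactly `exp t`. -/
lemma spikeFlow_param_zero {η : ℝ} (hη : 0 ≤ η) (t : ℝ) :
    spikeFlow 0 η t = η * Real.exp t := by
  have := spikeFlow_eq_of_hasDerivAt (f := 0) le_rfl (by norm_num)
    (γ := fun t => η * Real.exp t) (fun t => ?_)
  · simp only [Real.exp_zero, mul_one] at this
    rw [this]
  · have h : spikeSpeed 0 (η * Real.exp t) = η * Real.exp t := by
      simp only [spikeSpeed, zero_mul, add_zero]
      exact max_eq_right (by positivity)
    rw [h]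
    exact (Real.hasDerivAt_exp t).const_mul η

-- Grönwall's inequality, with the change of parameter treated as an error of size `3 |f - f'|` in
-- the equation. The sign `σ` covers both directions of time.
open Set in
lemma abs_spikeFlow_sub_le {f f' η η' σ t : ℝ} (hf : f ∈ Icc 0 (1 / 64))
    (hf' : f' ∈ Icc 0 (1 / 64)) (hσ : |σ| = 1) (ht : 0 ≤ t) :
    |spikeFlow f η (σ * t) - spikeFlow f' η' (σ * t)| ≤
      gronwallBound |η - η'| 2 (0 + 3 * |f - f'|) t := by
  have hd : ∀ {f} (_ : f ∈ Icc (0 : ℝ) (1 / 64)) η s, HasDerivAt (fun s => spikeFlow f η (σ * s))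
      (σ * spikeSpeed f (spikeFlow f η (σ * s))) s := fun hf η s => by
    rw [mul_comm σ (spikeSpeed _ _)]
    exact (hasDerivAt_spikeFlow hf.1 hf.2 η (σ * s)).comp s
      (by simpa using (hasDerivAt_id s).const_mul σ)
  have hc : ∀ {f} (_ : f ∈ Icc (0 : ℝ) (1 / 64)) η, Continuous (fun s => spikeFlow f η (σ * s)) :=
    fun hf η => continuous_iff_continuousAt.2 fun s => (hd hf η s).continuousAt
  have h := dist_le_of_approx_trajectories_ODE (v := fun _ η => σ * spikeSpeed f η) (K := 2)
    (f := fun s => spikeFlow f η (σ * s)) (g := fun s => spikeFlow f' η' (σ * s))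
    (f' := fun s => σ * spikeSpeed f (spikeFlow f η (σ * s)))
    (g' := fun s => σ * spikeSpeed f' (spikeFlow f' η' (σ * s))) (a := 0) (b := t) (εf := 0)
    (εg := 3 * |f - f'|) (δ := |η - η'|)
    (fun _ => LipschitzWith.of_dist_le_mul fun x y => by
      rw [Real.dist_eq, ← mul_sub, abs_mul, hσ, one_mul, ← Real.dist_eq]
      exact (lipschitzWith_spikeSpeed hf.1 hf.2).dist_le_mul x y)
    (hc hf η).continuousOn (fun s _ => (hd hf η s).hasDerivWithinAt) (by simp)
    (hc hf' η').continuousOn (fun s _ => (hd hf' η' s).hasDerivWithinAt)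
    (fun s _ => by
      have := abs_spikeSpeed_sub_le (f := f') (f' := f) (η := spikeFlow f' η' (σ * s))
        (η' := spikeFlow f' η' (σ * s)) hf'.1 hf'.2
      rw [Real.dist_eq, ← mul_sub, abs_mul, hσ, one_mul]
      simpa [abs_sub_comm f f'] using this)
    (by simp [spikeFlow_zero hf.1 hf.2, spikeFlow_zero hf'.1 hf'.2, Real.dist_eq]) t ⟨ht, le_rfl⟩
  simpa [Real.dist_eq] using h

lemma tendsto_gronwallBound_zero (t : ℝ) :
    Filter.Tendsto (fun p : ℝ × ℝ => gronwallBound p.1 2 p.2 t) (𝓝 0) (𝓝 0) := by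
  have h : Continuous (fun p : ℝ × ℝ => gronwallBound p.1 2 p.2 t) := by
    simp only [gronwallBound_of_K_ne_0 (show (2 : ℝ) ≠ 0 by norm_num)]
    fun_prop
  have := h.tendsto 0
  simpa [gronwallBound_ε0_δ0] using this

open Set in
lemma continuousOn_spikeFlow (t : ℝ) :
    ContinuousOn (fun p : ℝ × ℝ => spikeFlow p.1 p.2 t) (Icc 0 (1 / 64) ×ˢ univ) := by
  obtain ⟨σ, s, hσ, hs, rfl⟩ : ∃ σ s : ℝ, |σ| = 1 ∧ 0 ≤ s ∧ t = σ * s := by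
    rcases le_total 0 t with h | h
    · exact ⟨1, t, by simp, h, by simp⟩
    · exact ⟨-1, -t, by simp, by linarith, by simp⟩
  rintro ⟨f, η⟩ ⟨hf, -⟩
  refine tendsto_iff_dist_tendsto_zero.2 ?_
  have hlim : Filter.Tendsto (fun p : ℝ × ℝ => gronwallBound |p.2 - η| 2 (0 + 3 * |p.1 - f|) s)
      (𝓝[Icc 0 (1 / 64) ×ˢ univ] (f, η)) (𝓝 0) := by
    have hc : Continuous (fun p : ℝ × ℝ => (|p.2 - η|, 0 + 3 * |p.1 - f|)) := by fun_prop
    have := hc.tendsto (f, η)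
    simp only [sub_self, abs_zero, mul_zero, add_zero] at this
    exact ((tendsto_gronwallBound_zero s).comp this).mono_left nhdsWithin_le_nhds
  refine squeeze_zero' (Filter.Eventually.of_forall fun _ => dist_nonneg) ?_ hlim
  filter_upwards [self_mem_nhdsWithin] with p hp
  exact abs_spikeFlow_sub_le hp.1 hf hσ hs

/-! ## The two-point estimate for the stretch flow -/

lemma sinh_le_mul_cosh {x : ℝ} (hx : 0 ≤ x) : Real.sinh x ≤ x * Real.cosh x := by
  have hd : ∀ x, HasDerivAt (fun x => x * Real.cosh x - Real.sinh x)
      (1 * Real.cosh x + x * Real.sinh x - Real.cosh x) x := fun x =>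
    ((hasDerivAt_id x).mul (Real.hasDerivAt_cosh x)).sub (Real.hasDerivAt_sinh x)
  have hm : MonotoneOn (fun x => x * Real.cosh x - Real.sinh x) (Set.Ici 0) := by
    refine monotoneOn_of_deriv_nonneg (convex_Ici 0)
      (fun x _ => (hd x).continuousAt.continuousWithinAt)
      (fun x _ => (hd x).differentiableAt.differentiableWithinAt) fun x hx => ?_
    rw [interior_Ici] at hx
    rw [(hd x).deriv]
    nlinarith [mul_nonneg (le_of_lt hx) (Real.sinh_nonneg_iff.2 (le_of_lt hx))]
  have := hm (Set.mem_Ici.2 le_rfl) (Set.mem_Ici.2 hx) hx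
  simpa using this

/-- The function `x sinh x - 2 cosh x` is increasing, its derivative being `x cosh x - sinh x`. With
`l` the difference of depths and `d` the distance, `cosh d - cosh l` is the horizontal contribution;
this surplus later absorbs the difference in speed between leaves. -/
lemma mul_sinh_add_le {l d : ℝ} (hl : 0 ≤ l) (hd : l ≤ d) :
    l * Real.sinh l + 2 * (Real.cosh d - Real.cosh l) ≤ d * Real.sinh d := by
  have hd' : ∀ x, HasDerivAt (fun x => x * Real.sinh x - 2 * Real.cosh x)
      (1 * Real.sinh x + x * Real.cosh x - 2 * Real.sinh x) x := fun x =>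
    ((hasDerivAt_id x).mul (Real.hasDerivAt_sinh x)).sub ((Real.hasDerivAt_cosh x).const_mul 2)
  have hm : MonotoneOn (fun x => x * Real.sinh x - 2 * Real.cosh x) (Set.Ici 0) := by
    refine monotoneOn_of_deriv_nonneg (convex_Ici 0)
      (fun x _ => (hd' x).continuousAt.continuousWithinAt)
      (fun x _ => (hd' x).differentiableAt.differentiableWithinAt) fun x hx => ?_
    rw [interior_Ici] at hx
    rw [(hd' x).deriv]
    nlinarith [sinh_le_mul_cosh (le_of_lt hx)]
  have := hm (Set.mem_Ici.2 hl) (Set.mem_Ici.2 (hl.trans hd)) hd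
  simp only at this
  linarith

/-- The algebra of the contraction estimate; `z`, `w`, `S` stand for `exp l`, `exp (-l)`,
`sinh l`. -/
lemma spike_estimate_algebra {φ₁ φ₂ η₁ η₂ l E δ z w S R ε : ℝ} (hl : l = η₁ - η₂) (hl0 : 0 ≤ l)
    (hSl : l ≤ S) (hzw : z * w = 1) (hw0 : 0 < w) (hw1 : w ≤ 1) (hS : S = (z - w) / 2)
    (hE : 0 < E) (hδ : 0 ≤ δ) (hu : E * (φ₁ - φ₂) ^ 2 ≤ δ / 2)
    (hv₁ : 0 ≤ η₁ + φ₁ ^ 2 * (E * w)) (hv₂ : 0 ≤ η₂ + φ₂ ^ 2 * (E * z))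
    (hmain : l * S + 2 * δ ≤ R) (hε : 0 ≤ ε) (hε' : ε ≤ 1 / 2) (hε₂ : ε ≤ E * φ₂ ^ 2) :
    S * ((η₁ + φ₁ ^ 2 * (E * w)) - (η₂ + φ₂ ^ 2 * (E * z)))
      - ((η₁ + φ₁ ^ 2 * (E * w)) + (η₂ + φ₂ ^ 2 * (E * z))) * δ ≤ (1 - ε) * R := by
  -- Completing a square. With `p = φ₂ S` and `q = (φ₁ - φ₂) w`, what remains is `2 p² ≤ (2 p - q)²
  -- + q²`, that is, `2 (p - q)² ≥ 0`, together with `w ≤ 1`.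
  have key : (φ₁ ^ 2 * w - φ₂ ^ 2 * z) * S ≤ (φ₁ - φ₂) ^ 2 - φ₂ ^ 2 * S ^ 2 := by
    have h1 : (φ₁ ^ 2 * w - φ₂ ^ 2 * z) * S
        = ((φ₁ - φ₂) ^ 2 - (2 * φ₂ * S - (φ₁ - φ₂) * w) ^ 2) / 2 := by
      rw [hS]
      linear_combination ((φ₁ - φ₂) ^ 2 / 2) * hzw
    have h2 : w ^ 2 ≤ 1 := pow_le_one₀ hw0.le hw1
    have h3 : (φ₁ - φ₂) ^ 2 * w ^ 2 ≤ (φ₁ - φ₂) ^ 2 :=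
      mul_le_of_le_one_right (sq_nonneg _) h2
    rw [h1]
    nlinarith [sq_nonneg (φ₂ * S - (φ₁ - φ₂) * w)]
  have hk2 := mul_le_mul_of_nonneg_left key hE.le
  have hS2 : l * S ≤ S ^ 2 := by
    rw [sq]
    exact mul_le_mul_of_nonneg_right hSl (hl0.trans hSl)
  have hεS : ε * S ^ 2 ≤ E * φ₂ ^ 2 * S ^ 2 := mul_le_mul_of_nonneg_right hε₂ (sq_nonneg S)
  have h5 : ε * (l * S) ≤ ε * S ^ 2 := mul_le_mul_of_nonneg_left hS2 hε
  have h6 := mul_le_mul_of_nonneg_left hmain (show 0 ≤ 1 - ε by linarith)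
  have h7 : 0 ≤ ((η₁ + φ₁ ^ 2 * (E * w)) + (η₂ + φ₂ ^ 2 * (E * z))) * δ :=
    mul_nonneg (add_nonneg hv₁ hv₂) hδ
  have h9 : S * (η₁ + φ₁ ^ 2 * (E * w) - (η₂ + φ₂ ^ 2 * (E * z)))
      = l * S + E * ((φ₁ ^ 2 * w - φ₂ ^ 2 * z) * S) := by rw [hl]; ring
  -- The leaf variation costs at most `δ / 2`, while the surplus supplies `2 (1 - ε) δ ≥ δ`.
  have h10 : 0 ≤ (1 / 2 - ε) * δ := mul_nonneg (by linarith) hδ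
  rw [h9]
  linarith

/-- The contraction estimate behind the stretch flow, for two points of the same spike. -/
lemma spike_estimate_of_le {φ₁ φ₂ η₁ η₂ Δ d ε : ℝ} (hφ : |φ₁ - φ₂| ≤ |Δ| / 4)
    (hη : η₂ ≤ η₁) (hd : 0 ≤ d)
    (hcosh : Real.cosh d = Real.cosh (η₁ - η₂) + Δ ^ 2 * Real.exp (-η₁ - η₂) / 8)
    (hv₁ : 0 ≤ η₁ + φ₁ ^ 2 * Real.exp (-2 * η₁)) (hv₂ : 0 ≤ η₂ + φ₂ ^ 2 * Real.exp (-2 * η₂))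
    (hε : 0 ≤ ε) (hε' : ε ≤ 1 / 2) (hε₂ : ε ≤ Real.exp (-η₁ - η₂) * φ₂ ^ 2) :
    Real.sinh (η₁ - η₂) *
        ((η₁ + φ₁ ^ 2 * Real.exp (-2 * η₁)) - (η₂ + φ₂ ^ 2 * Real.exp (-2 * η₂)))
      - ((η₁ + φ₁ ^ 2 * Real.exp (-2 * η₁)) + (η₂ + φ₂ ^ 2 * Real.exp (-2 * η₂)))
        * (Δ ^ 2 * Real.exp (-η₁ - η₂) / 8) ≤ (1 - ε) * (d * Real.sinh d) := by
  have hl0 : 0 ≤ η₁ - η₂ := by linarith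
  have hE := Real.exp_pos (-η₁ - η₂)
  have hδ0 : 0 ≤ Δ ^ 2 * Real.exp (-η₁ - η₂) / 8 := by positivity
  have e1 : Real.exp (-2 * η₁) = Real.exp (-η₁ - η₂) * Real.exp (-(η₁ - η₂)) := by
    rw [← Real.exp_add]; ring_nf
  have e2 : Real.exp (-2 * η₂) = Real.exp (-η₁ - η₂) * Real.exp (η₁ - η₂) := by
    rw [← Real.exp_add]; ring_nf
  have hld : η₁ - η₂ ≤ d := by
    have h := Real.cosh_le_cosh.1 (show Real.cosh (η₁ - η₂) ≤ Real.cosh d by linarith)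
    rwa [abs_of_nonneg hl0, abs_of_nonneg hd] at h
  have hmain := mul_sinh_add_le hl0 hld
  have hu : Real.exp (-η₁ - η₂) * (φ₁ - φ₂) ^ 2 ≤ Δ ^ 2 * Real.exp (-η₁ - η₂) / 8 / 2 := by
    have h1 : (φ₁ - φ₂) ^ 2 ≤ (|Δ| / 4) ^ 2 := sq_le_sq' (by linarith [neg_abs_le (φ₁ - φ₂)])
      ((le_abs_self _).trans hφ)
    rw [div_pow, sq_abs] at h1
    have := mul_le_mul_of_nonneg_left h1 hE.le
    linarith
  rw [e1] at hv₁ ⊢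
  rw [e2] at hv₂ ⊢
  exact spike_estimate_algebra rfl hl0 (Real.self_le_sinh_iff.2 hl0)
    (by rw [← Real.exp_add]; simp) (Real.exp_pos _) (Real.exp_le_one_iff.2 (by linarith))
    (Real.sinh_eq _) hE hδ0 hu hv₁ hv₂ (by linarith) hε hε' hε₂

lemma spike_estimate {φ₁ φ₂ η₁ η₂ Δ d ε : ℝ} (hφ : |φ₁ - φ₂| ≤ |Δ| / 4) (hd : 0 ≤ d)
    (hcosh : Real.cosh d = Real.cosh (η₁ - η₂) + Δ ^ 2 * Real.exp (-η₁ - η₂) / 8)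
    (hv₁ : 0 ≤ η₁ + φ₁ ^ 2 * Real.exp (-2 * η₁)) (hv₂ : 0 ≤ η₂ + φ₂ ^ 2 * Real.exp (-2 * η₂))
    (hε : 0 ≤ ε) (hε' : ε ≤ 1 / 2) (hε₁ : ε ≤ Real.exp (-η₁ - η₂) * φ₁ ^ 2)
    (hε₂ : ε ≤ Real.exp (-η₁ - η₂) * φ₂ ^ 2) :
    Real.sinh (η₁ - η₂) *
        ((η₁ + φ₁ ^ 2 * Real.exp (-2 * η₁)) - (η₂ + φ₂ ^ 2 * Real.exp (-2 * η₂)))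
      - ((η₁ + φ₁ ^ 2 * Real.exp (-2 * η₁)) + (η₂ + φ₂ ^ 2 * Real.exp (-2 * η₂)))
        * (Δ ^ 2 * Real.exp (-η₁ - η₂) / 8) ≤ (1 - ε) * (d * Real.sinh d) := by
  rcases le_total η₂ η₁ with h | h
  · exact spike_estimate_of_le hφ h hd hcosh hv₁ hv₂ hε hε' hε₂
  · have e : -η₁ - η₂ = -η₂ - η₁ := by ring
    have e' : η₁ - η₂ = -(η₂ - η₁) := by ring
    rw [e] at hcosh hε₁ ⊢
    rw [e', Real.cosh_neg] at hcosh
    rw [e', Real.sinh_neg]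
    have := spike_estimate_of_le (by rwa [abs_sub_comm]) h hd hcosh hv₂ hv₁ hε hε' hε₁
    linarith

/-- Hyperbolic cosine of the distance of two points in horocyclic coordinates `(x, η)` about an
ideal vertex; `Δ` is the difference of the coordinates `x`. -/
def horoCosh (Δ η₁ η₂ : ℝ) : ℝ :=
  Real.cosh (η₁ - η₂) + Δ ^ 2 * Real.exp (-η₁ - η₂) / 8

lemma one_le_horoCosh (Δ η₁ η₂ : ℝ) : 1 ≤ horoCosh Δ η₁ η₂ := by
  have h1 := Real.one_le_cosh (η₁ - η₂)
  have h2 : 0 ≤ Δ ^ 2 * Real.exp (-η₁ - η₂) / 8 := by positivity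
  unfold horoCosh; linarith

lemma one_lt_horoCosh {Δ η₁ η₂ : ℝ} (h : Δ ≠ 0 ∨ η₁ ≠ η₂) : 1 < horoCosh Δ η₁ η₂ := by
  have h1 := Real.one_le_cosh (η₁ - η₂)
  have h2 : 0 ≤ Δ ^ 2 * Real.exp (-η₁ - η₂) / 8 := by positivity
  unfold horoCosh
  rcases h with h | h
  · have : 0 < Δ ^ 2 * Real.exp (-η₁ - η₂) / 8 := by positivity
    linarith
  · have : 1 < Real.cosh (η₁ - η₂) := Real.one_lt_cosh.2 (sub_ne_zero.2 h)
    linarith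

open Set in
/-- The flow stretches distances in a spike at most by the factor `exp ((1 - ε) t)`. -/
theorem arcosh_horoCosh_spikeFlow_le {φ₁ φ₂ η₁ η₂ Δ ε t : ℝ} (hφ₁ : φ₁ ^ 2 ≤ 1 / 64)
    (hφ₂ : φ₂ ^ 2 ≤ 1 / 64) (hφ : |φ₁ - φ₂| ≤ |Δ| / 4)
    (h₁ : -1 / 2 ≤ η₁) (h₂ : -1 / 2 ≤ η₂)
    (hv₁ : 0 ≤ η₁ + φ₁ ^ 2 * Real.exp (-2 * η₁)) (hv₂ : 0 ≤ η₂ + φ₂ ^ 2 * Real.exp (-2 * η₂))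
    (ht : 0 ≤ t) (hε : 0 ≤ ε) (hε' : ε ≤ 1 / 2)
    (hε₁ : ∀ s ∈ Icc 0 t, ε ≤
      Real.exp (-spikeFlow (φ₁ ^ 2) η₁ s - spikeFlow (φ₂ ^ 2) η₂ s) * φ₁ ^ 2)
    (hε₂ : ∀ s ∈ Icc 0 t, ε ≤
      Real.exp (-spikeFlow (φ₁ ^ 2) η₁ s - spikeFlow (φ₂ ^ 2) η₂ s) * φ₂ ^ 2) :
    Real.arcosh (horoCosh Δ (spikeFlow (φ₁ ^ 2) η₁ t) (spikeFlow (φ₂ ^ 2) η₂ t)) ≤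
      Real.exp ((1 - ε) * t) * Real.arcosh (horoCosh Δ η₁ η₂) := by
  have hp₁ := sq_nonneg φ₁
  have hp₂ := sq_nonneg φ₂
  by_cases hne : Δ ≠ 0 ∨ η₁ ≠ η₂
  swap
  · push Not at hne
    obtain ⟨rfl, rfl⟩ := hne
    have : φ₁ = φ₂ := by simpa [sub_eq_zero] using hφ
    subst this
    simp [horoCosh]
  set Φ₁ := spikeFlow (φ₁ ^ 2) η₁
  set Φ₂ := spikeFlow (φ₂ ^ 2) η₂
  have speed : ∀ {φ η : ℝ}, φ ^ 2 ≤ 1 / 64 → -1 / 2 ≤ η →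
      0 ≤ η + φ ^ 2 * Real.exp (-2 * η) → ∀ s ∈ Icc 0 t,
      0 ≤ spikeFlow (φ ^ 2) η s + φ ^ 2 * Real.exp (-2 * spikeFlow (φ ^ 2) η s) ∧
      HasDerivAt (spikeFlow (φ ^ 2) η)
        (spikeFlow (φ ^ 2) η s + φ ^ 2 * Real.exp (-2 * spikeFlow (φ ^ 2) η s)) s := by
    intro φ η hφ hη hv s hs
    have hp := sq_nonneg φ
    have hd := hasDerivAt_spikeFlow hp hφ η s
    have hge := neg_half_le_spikeFlow hp hφ hη s
    rw [spikeSpeed_of_ge hge] at hd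
    suffices h : 0 ≤ spikeFlow (φ ^ 2) η s + φ ^ 2 * Real.exp (-2 * spikeFlow (φ ^ 2) η s) from
      ⟨h, by rwa [max_eq_right h] at hd⟩
    -- A point where the untruncated speed is negative is at rest, so it is its own starting point,
    -- where that speed is nonnegative.
    by_contra! hneg
    have h0 : spikeSpeed (φ ^ 2) (spikeFlow (φ ^ 2) η s) = 0 := by
      rw [spikeSpeed_of_ge hge, max_eq_left hneg.le]
    have h1 := spikeFlow_of_speed_eq_zero hp hφ
      ((spikeSpeed_spikeFlow_eq_zero_iff hp hφ η s).1 h0) s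
    rw [h1] at hneg
    linarith
  -- The points never meet: either they lie on different leaves, or on one leaf where the flow is
  -- injective. Hence `arcosh` stays differentiable along the motion.
  have hC1 : ∀ s, 1 < horoCosh Δ (Φ₁ s) (Φ₂ s) := by
    intro s
    refine one_lt_horoCosh ?_
    by_cases hΔ : Δ = 0
    · right
      subst hΔ
      have hφe : φ₁ = φ₂ := by simpa [sub_eq_zero] using hφ
      subst hφe
      exact fun h => (hne.resolve_left (by simp)) (injective_spikeFlow hp₁ hφ₁ h)
    · exact Or.inl hΔ
  have hderiv : ∀ s ∈ Icc 0 t, ∃ D, D ≤ 0 ∧ HasDerivAt (fun s =>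
      Real.arcosh (horoCosh Δ (Φ₁ s) (Φ₂ s)) * Real.exp (-((1 - ε) * s))) D s := by
    intro s hs
    obtain ⟨n₁, d₁⟩ := speed hφ₁ h₁ hv₁ s hs
    obtain ⟨n₂, d₂⟩ := speed hφ₂ h₂ hv₂ s hs
    have dC : HasDerivAt (fun s => horoCosh Δ (Φ₁ s) (Φ₂ s)) _ s :=
      ((d₁.sub d₂).cosh).add (((((d₁.neg).sub d₂).exp).const_mul (Δ ^ 2)).div_const 8)
    have dA := (Real.hasDerivAt_arcosh (hC1 s)).comp s dC
    have dE : HasDerivAt (fun s => Real.exp (-((1 - ε) * s))) _ s :=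
      ((hasDerivAt_id s).const_mul (1 - ε)).neg.exp
    refine ⟨_, ?_, dA.mul dE⟩
    set d := Real.arcosh (horoCosh Δ (Φ₁ s) (Φ₂ s)) with hd
    have hd0 : 0 ≤ d := Real.arcosh_nonneg (hC1 s).le
    have hcosh : Real.cosh d = horoCosh Δ (Φ₁ s) (Φ₂ s) := Real.cosh_arcosh (hC1 s).le
    have hest := spike_estimate hφ hd0 hcosh n₁ n₂ hε hε' (hε₁ s hs) (hε₂ s hs)
    have hsinh : Real.sinh d = √(horoCosh Δ (Φ₁ s) (Φ₂ s) ^ 2 - 1) :=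
      Real.sinh_arcosh (hC1 s).le
    rw [← hsinh]
    have hs0 : 0 < Real.sinh d := by
      rw [hsinh]; exact Real.sqrt_pos.2 (by nlinarith [hC1 s])
    have hE := Real.exp_pos (-((1 - ε) * s))
    have h2 : (Real.sinh d)⁻¹ * (Real.sinh (Φ₁ s - Φ₂ s) *
        ((Φ₁ s + φ₁ ^ 2 * Real.exp (-2 * Φ₁ s)) - (Φ₂ s + φ₂ ^ 2 * Real.exp (-2 * Φ₂ s)))
      - ((Φ₁ s + φ₁ ^ 2 * Real.exp (-2 * Φ₁ s)) + (Φ₂ s + φ₂ ^ 2 * Real.exp (-2 * Φ₂ s)))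
        * (Δ ^ 2 * Real.exp (-Φ₁ s - Φ₂ s) / 8)) ≤ (1 - ε) * d := by
      rw [inv_mul_le_iff₀ hs0]
      linarith
    have h3 := mul_le_mul_of_nonneg_right h2 hE.le
    simp only [Function.comp_apply, id, mul_one, ← hd]
    refine le_trans (le_of_eq ?_) (sub_nonpos.2 h3)
    simp only [Pi.sub_apply, Pi.neg_apply]
    ring
  have hanti : AntitoneOn (fun s =>
      Real.arcosh (horoCosh Δ (Φ₁ s) (Φ₂ s)) * Real.exp (-((1 - ε) * s))) (Icc 0 t) := by
    refine antitoneOn_of_deriv_nonpos (convex_Icc 0 t) (fun s hs => ?_) (fun s hs => ?_)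
      fun s hs => ?_
    · obtain ⟨D, -, hD⟩ := hderiv s hs
      exact hD.continuousAt.continuousWithinAt
    · obtain ⟨D, -, hD⟩ := hderiv s (interior_subset hs)
      exact hD.differentiableAt.differentiableWithinAt
    · obtain ⟨D, h, hD⟩ := hderiv s (interior_subset hs)
      rwa [hD.deriv]
  have h := hanti ⟨le_rfl, ht⟩ ⟨ht, le_rfl⟩ ht
  simp only [mul_zero, neg_zero, Real.exp_zero, mul_one] at h
  have e₁ : Φ₁ 0 = η₁ := spikeFlow_zero hp₁ hφ₁ _
  have e₂ : Φ₂ 0 = η₂ := spikeFlow_zero hp₂ hφ₂ _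
  rw [e₁, e₂, Real.exp_neg, ← div_eq_mul_inv, div_le_iff₀ (Real.exp_pos _)] at h
  linarith

/-! ## Barycentric coordinates of the points of an ideal triangle -/

/-- Coordinates of the points of an ideal triangle with respect to null vectors `u k` that span its
ideal vertices and satisfy `⟨u i, u j⟩ = -2` for `i ≠ j`. -/
abbrev Bary : Type :=
  {a : Fin 3 → ℝ // (∀ k, 0 ≤ a k) ∧ 4 * (a 0 * a 1 + a 1 * a 2 + a 2 * a 0) = 1}

namespace Bary

lemma nonneg (a : Bary) (k : Fin 3) : 0 ≤ a.1 k := a.2.1 k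

lemma norm_eq (a : Bary) (k : Fin 3) :
    4 * (a.1 k * (a.1 (k + 1) + a.1 (k + 2)) + a.1 (k + 1) * a.1 (k + 2)) = 1 := by
  have := a.2.2
  fin_cases k <;> simp [Fin.reduceAdd] <;> linarith

lemma norm_of_cyclic {a : Fin 3 → ℝ} (k : Fin 3)
    (h : 4 * (a k * (a (k + 1) + a (k + 2)) + a (k + 1) * a (k + 2)) = 1) :
    4 * (a 0 * a 1 + a 1 * a 2 + a 2 * a 0) = 1 := by
  fin_cases k <;> simp [Fin.reduceAdd] at h <;> linarith

lemma ext_cyclic {a b : Bary} (k : Fin 3) (h0 : a.1 k = b.1 k) (h1 : a.1 (k + 1) = b.1 (k + 1))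
    (h2 : a.1 (k + 2) = b.1 (k + 2)) : a = b := by
  refine Subtype.ext (funext fun j => ?_)
  fin_cases k <;> fin_cases j <;> simp_all [Fin.reduceAdd]

/-- Hyperbolic cosine of the distance. -/
def coshDist (a b : Bary) : ℝ :=
  2 * (a.1 0 * b.1 1 + a.1 1 * b.1 0 + a.1 1 * b.1 2 + a.1 2 * b.1 1 + a.1 2 * b.1 0
    + a.1 0 * b.1 2)

lemma coshDist_eq (a b : Bary) (k : Fin 3) : coshDist a b =
    2 * (a.1 k * (b.1 (k + 1) + b.1 (k + 2)) + b.1 k * (a.1 (k + 1) + a.1 (k + 2))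
      + a.1 (k + 1) * b.1 (k + 2) + a.1 (k + 2) * b.1 (k + 1)) := by
  fin_cases k <;> simp [Fin.reduceAdd, coshDist] <;> ring

/-- The hyperbolic distance. -/
def hypDist (a b : Bary) : ℝ := Real.arcosh (coshDist a b)

/-- Horocyclic size at the vertex `k`. -/
def size (k : Fin 3) (a : Bary) : ℝ := a.1 (k + 1) + a.1 (k + 2)

lemma size_pos (k : Fin 3) (a : Bary) : 0 < size k a := by
  have h0 := a.nonneg k
  have h1 := a.nonneg (k + 1)
  have h2 := a.nonneg (k + 2)
  have h := a.norm_eq k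
  rcases (add_nonneg h1 h2).lt_or_eq with h3 | h3
  · exact h3
  · have h4 : a.1 (k + 1) = 0 := by linarith
    have h5 : a.1 (k + 2) = 0 := by linarith
    rw [h4, h5] at h
    norm_num at h

/-- Horizontal coordinate in the spike at the vertex `k`, constant along geodesics to `k`. -/
def horo (k : Fin 3) (a : Bary) : ℝ := (a.1 (k + 1) - a.1 (k + 2)) / size k a

/-- Depth of the horocycle through a point in the spike at the vertex `k`. -/
def depth (k : Fin 3) (a : Bary) : ℝ := -Real.log (2 * size k a)

lemma exp_depth (k : Fin 3) (a : Bary) : Real.exp (depth k a) = (2 * size k a)⁻¹ := by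
  rw [depth, Real.exp_neg, Real.exp_log (by have := size_pos k a; positivity)]

lemma exp_neg_depth (k : Fin 3) (a : Bary) : Real.exp (-depth k a) = 2 * size k a := by
  rw [Real.exp_neg, exp_depth, inv_inv]

lemma coord_add_one (k : Fin 3) (a : Bary) : a.1 (k + 1) = size k a * (1 + horo k a) / 2 := by
  have := (size_pos k a).ne'
  rw [horo]; field_simp; rw [size]; ring

lemma coord_add_two (k : Fin 3) (a : Bary) : a.1 (k + 2) = size k a * (1 - horo k a) / 2 := by
  have := (size_pos k a).ne'
  rw [horo]; field_simp; rw [size]; ring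

lemma coord_self (k : Fin 3) (a : Bary) :
    a.1 k = (4 * size k a)⁻¹ - size k a * (1 - horo k a ^ 2) / 4 := by
  have h := a.norm_eq k
  have hs := (size_pos k a).ne'
  have e : a.1 (k + 1) + a.1 (k + 2) = size k a := rfl
  rw [e, coord_add_one, coord_add_two] at h
  field_simp
  linarith

lemma abs_horo_le (k : Fin 3) (a : Bary) : |horo k a| ≤ 1 := by
  have hs := size_pos k a
  have h1 := a.nonneg (k + 1)
  have h2 := a.nonneg (k + 2)
  rw [horo, abs_div, abs_of_pos hs, div_le_one hs, abs_le, size]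
  constructor <;> linarith

/-- In the half-plane with the vertex `k` at infinity the point has abscissa `horo k` and height `1
/ size k = 2 exp (depth k)`; the formula is the half-plane distance in these coordinates. -/
lemma coshDist_eq_horoCosh (k : Fin 3) (a b : Bary) :
    coshDist a b = horoCosh (horo k a - horo k b) (depth k a) (depth k b) := by
  have ha := size_pos k a
  have hb := size_pos k b
  have h1 : Real.exp (depth k a - depth k b) = size k b / size k a := by
    rw [sub_eq_add_neg, Real.exp_add, exp_depth, exp_neg_depth]; field_simp
  have h2 : Real.exp (-(depth k a - depth k b)) = size k a / size k b := by
    rw [Real.exp_neg, h1, inv_div]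
  have h3 : Real.exp (-depth k a - depth k b) = 4 * size k a * size k b := by
    rw [sub_eq_add_neg, Real.exp_add, exp_neg_depth, exp_neg_depth]; ring
  rw [horoCosh, Real.cosh_eq, h1, h2, h3, coshDist_eq a b k, coord_add_one k a,
    coord_add_two k a, coord_self k a, coord_add_one k b, coord_add_two k b, coord_self k b]
  field_simp
  ring

lemma one_le_coshDist (a b : Bary) : 1 ≤ coshDist a b := by
  rw [coshDist_eq_horoCosh 0]; exact one_le_horoCosh _ _ _

lemma cosh_hypDist (a b : Bary) : Real.cosh (hypDist a b) = coshDist a b :=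
  Real.cosh_arcosh (one_le_coshDist a b)

lemma hypDist_nonneg (a b : Bary) : 0 ≤ hypDist a b := Real.arcosh_nonneg (one_le_coshDist a b)

lemma hypDist_eq_of_cosh {a b : Bary} {d : ℝ} (hd : 0 ≤ d) (h : Real.cosh d = coshDist a b) :
    hypDist a b = d := by rw [hypDist, ← h, Real.arcosh_cosh hd]

lemma hypDist_comm (a b : Bary) : hypDist a b = hypDist b a := by
  rw [hypDist, hypDist, coshDist, coshDist]; congr 1; ring

/-- The point of the upper half-plane, where the vertex `0` lies at infinity. -/
def toHalfPlane (a : Bary) : UpperHalfPlane :=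
  ⟨⟨horo 0 a, (size 0 a)⁻¹⟩, inv_pos.2 (size_pos 0 a)⟩

lemma hypDist_eq_dist (a b : Bary) : hypDist a b = dist (toHalfPlane a) (toHalfPlane b) := by
  refine hypDist_eq_of_cosh dist_nonneg ?_
  have ha := size_pos 0 a
  have hb := size_pos 0 b
  have h1 : Real.exp (depth 0 a - depth 0 b) = size 0 b / size 0 a := by
    rw [sub_eq_add_neg, Real.exp_add, exp_depth, exp_neg_depth]; field_simp
  have h2 : Real.exp (-(depth 0 a - depth 0 b)) = size 0 a / size 0 b := by
    rw [Real.exp_neg, h1, inv_div]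
  have h3 : Real.exp (-depth 0 a - depth 0 b) = 4 * size 0 a * size 0 b := by
    rw [sub_eq_add_neg, Real.exp_add, exp_neg_depth, exp_neg_depth]; ring
  rw [UpperHalfPlane.cosh_dist', coshDist_eq_horoCosh 0, horoCosh, Real.cosh_eq, h1, h2, h3]
  simp only [toHalfPlane, UpperHalfPlane.re, UpperHalfPlane.im]
  field_simp
  ring

lemma hypDist_triangle (a b c : Bary) : hypDist a c ≤ hypDist a b + hypDist b c := by
  simp only [hypDist_eq_dist]; exact dist_triangle _ _ _

lemma continuous_coord (k : Fin 3) : Continuous fun a : Bary => a.1 k :=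
  (continuous_apply k).comp continuous_subtype_val

lemma continuous_size (k : Fin 3) : Continuous (size k) :=
  (continuous_coord _).add (continuous_coord _)

lemma continuous_horo (k : Fin 3) : Continuous (horo k) :=
  ((continuous_coord _).sub (continuous_coord _)).div (continuous_size k)
    fun a => (size_pos k a).ne'

lemma continuous_depth (k : Fin 3) : Continuous (depth k) :=
  (((continuous_size k).const_mul 2).log fun a => by have := size_pos k a; positivity).neg

/-- The point with given horocyclic coordinates in the spike at the vertex `k`. -/
def ofHoro (k : Fin 3) (x η : ℝ) (hx : |x| ≤ 1) (hη : (1 - x ^ 2) / 4 ≤ Real.exp (2 * η)) :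
    Bary :=
  ⟨fun j => if j = k then Real.exp η / 2 - Real.exp (-η) * (1 - x ^ 2) / 8
    else if j = k + 1 then Real.exp (-η) * (1 + x) / 4 else Real.exp (-η) * (1 - x) / 4, by
    have hx' := abs_le.1 hx
    have hE := Real.exp_pos η
    have hE' := Real.exp_pos (-η)
    have e : Real.exp η * Real.exp (-η) = 1 := by rw [← Real.exp_add]; simp
    have e2 : Real.exp (2 * η) * Real.exp (-η) = Real.exp η := by rw [← Real.exp_add]; ring_nf
    have k1 : k + 1 ≠ k := by fin_cases k <;> decide
    have k2 : k + 2 ≠ k := by fin_cases k <;> decide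
    have k3 : k + 2 ≠ k + 1 := by fin_cases k <;> decide
    refine ⟨fun j => ?_, ?_⟩
    · dsimp only
      split_ifs
      · have := mul_le_mul_of_nonneg_right hη hE'.le
        rw [e2] at this
        linarith
      · have : 0 ≤ 1 + x := by linarith
        positivity
      · have : 0 ≤ 1 - x := by linarith
        positivity
    · refine norm_of_cyclic (a := fun j => if j = k then _ else if j = k + 1 then _ else _) k ?_
      simp only [if_true, if_neg k1, if_neg k2, if_neg k3]
      linear_combination e⟩

section
variable {k : Fin 3} {x η : ℝ} {hx : |x| ≤ 1} {hη : (1 - x ^ 2) / 4 ≤ Real.exp (2 * η)}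

lemma ofHoro_add_one : (ofHoro k x η hx hη).1 (k + 1) = Real.exp (-η) * (1 + x) / 4 := by
  simp [ofHoro]

lemma ofHoro_add_two : (ofHoro k x η hx hη).1 (k + 2) = Real.exp (-η) * (1 - x) / 4 := by
  have k2 : k + 2 ≠ k := by fin_cases k <;> decide
  have k3 : k + 2 ≠ k + 1 := by fin_cases k <;> decide
  simp only [ofHoro, if_neg k2, if_neg k3]

lemma size_ofHoro : size k (ofHoro k x η hx hη) = Real.exp (-η) / 2 := by
  rw [size, ofHoro_add_one, ofHoro_add_two]; ring

lemma horo_ofHoro : horo k (ofHoro k x η hx hη) = x := by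
  have := Real.exp_pos (-η)
  rw [horo, size_ofHoro, ofHoro_add_one, ofHoro_add_two]; field_simp; ring

lemma depth_ofHoro : depth k (ofHoro k x η hx hη) = η := by
  rw [depth, size_ofHoro, mul_div_cancel₀ _ two_ne_zero, Real.log_exp, neg_neg]

end

lemma ext_horo {a b : Bary} (k : Fin 3) (h1 : horo k a = horo k b) (h2 : depth k a = depth k b) :
    a = b := by
  have h3 : size k a = size k b := by
    have := exp_neg_depth k a
    rw [h2, exp_neg_depth] at this
    linarith
  refine ext_cyclic k ?_ ?_ ?_
  · rw [coord_self, coord_self k b, h1, h3]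
  · rw [coord_add_one, coord_add_one k b, h1, h3]
  · rw [coord_add_two, coord_add_two k b, h1, h3]

/-! ### The stretch flow in a spike -/

/-- Square root of the parameter of the flow on a leaf `horo k = const`. -/
def leafParam (k : Fin 3) (a : Bary) : ℝ := (1 - horo k a ^ 2) / 16

lemma horo_sq_le (k : Fin 3) (a : Bary) : horo k a ^ 2 ≤ 1 := (sq_le_one_iff_abs_le_one _).2
  (abs_horo_le k a)

lemma leafParam_nonneg (k : Fin 3) (a : Bary) : 0 ≤ leafParam k a := by
  have := horo_sq_le k a
  unfold leafParam; linarith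

lemma leafParam_sq_le (k : Fin 3) (a : Bary) : leafParam k a ^ 2 ≤ 1 / 64 := by
  have h1 := leafParam_nonneg k a
  have h2 : leafParam k a ≤ 1 / 8 := by
    have := sq_nonneg (horo k a)
    unfold leafParam; linarith
  nlinarith

lemma abs_leafParam_sub_le (k : Fin 3) (a b : Bary) :
    |leafParam k a - leafParam k b| ≤ |horo k a - horo k b| / 4 := by
  have e : leafParam k a - leafParam k b
      = -((horo k a + horo k b) / 16 * (horo k a - horo k b)) := by unfold leafParam; ring
  have h : |(horo k a + horo k b) / 16| ≤ 1 / 4 := by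
    have := abs_add_le (horo k a) (horo k b)
    rw [abs_div]
    have := abs_horo_le k a
    have := abs_horo_le k b
    norm_num
    linarith
  rw [e, abs_neg, abs_mul]
  nlinarith [abs_nonneg (horo k a - horo k b)]

/-- Depth after time `t`. -/
def flowDepth (k : Fin 3) (t : ℝ) (a : Bary) : ℝ := spikeFlow (leafParam k a ^ 2) (depth k a) t

lemma exp_two_depth_ge (k : Fin 3) (a : Bary) :
    (1 - horo k a ^ 2) / 4 ≤ Real.exp (2 * depth k a) := by
  have h0 := a.nonneg k
  have hs := size_pos k a
  rw [coord_self] at h0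
  have e : Real.exp (2 * depth k a) = (4 * size k a)⁻¹ * (size k a)⁻¹ := by
    rw [two_mul, Real.exp_add, exp_depth]; field_simp; norm_num
  rw [e, ← div_eq_mul_inv, le_div_iff₀ hs]
  linarith

/-- The flow does not leave the triangle: the side opposite to `k` lies at depths at most `-log 2 <
-1 / 2`, where nothing moves. -/
lemma exp_two_flowDepth_ge (k : Fin 3) (t : ℝ) (a : Bary) :
    (1 - horo k a ^ 2) / 4 ≤ Real.exp (2 * flowDepth k t a) := by
  rcases le_total (-1 / 2) (depth k a) with h | h
  · have h1 := neg_half_le_spikeFlow (sq_nonneg _) (leafParam_sq_le k a) h t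
    have h2 : Real.exp (-1) ≤ Real.exp (2 * flowDepth k t a) := Real.exp_le_exp.2 (by
      unfold flowDepth; linarith)
    have h3 : (1 : ℝ) / 4 ≤ Real.exp (-1) := by
      rw [Real.exp_neg, ← one_div]
      exact one_div_le_one_div_of_le (Real.exp_pos 1) (by linarith [exp_one_lt_three])
    linarith [sq_nonneg (horo k a)]
  · rw [flowDepth, spikeFlow_of_speed_eq_zero (sq_nonneg _) (leafParam_sq_le k a)
      (spikeSpeed_of_le (leafParam_sq_le k a) h)]
    exact exp_two_depth_ge k a

/-- The time `t` map of the flow in the spike at the vertex `k`. -/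
def spikeMap (k : Fin 3) (t : ℝ) (a : Bary) : Bary :=
  ofHoro k (horo k a) (flowDepth k t a) (abs_horo_le k a) (exp_two_flowDepth_ge k t a)

@[simp] lemma horo_spikeMap (k : Fin 3) (t : ℝ) (a : Bary) :
    horo k (spikeMap k t a) = horo k a := horo_ofHoro

@[simp] lemma depth_spikeMap (k : Fin 3) (t : ℝ) (a : Bary) :
    depth k (spikeMap k t a) = flowDepth k t a := depth_ofHoro

@[simp] lemma leafParam_spikeMap (k : Fin 3) (t : ℝ) (a : Bary) :
    leafParam k (spikeMap k t a) = leafParam k a := by simp [leafParam]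

lemma spikeMap_zero (k : Fin 3) (a : Bary) : spikeMap k 0 a = a :=
  ext_horo k (by simp) (by simp [flowDepth, spikeFlow_zero (sq_nonneg _) (leafParam_sq_le k a)])

lemma spikeMap_add (k : Fin 3) (s t : ℝ) (a : Bary) :
    spikeMap k (s + t) a = spikeMap k t (spikeMap k s a) :=
  ext_horo k (by simp) (by simp [flowDepth, spikeFlow_add (sq_nonneg _) (leafParam_sq_le k a)])

lemma continuous_leafParam (k : Fin 3) : Continuous (leafParam k) :=
  (continuous_const.sub ((continuous_horo k).pow 2)).div_const 16

lemma continuous_flowDepth (k : Fin 3) (t : ℝ) : Continuous (flowDepth k t) :=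
  (continuousOn_spikeFlow t).comp_continuous
    (((continuous_leafParam k).pow 2).prodMk (continuous_depth k))
    fun a => ⟨⟨sq_nonneg _, leafParam_sq_le k a⟩, trivial⟩

lemma continuous_spikeMap (k : Fin 3) (t : ℝ) : Continuous (spikeMap k t) := by
  refine Continuous.subtype_mk (continuous_pi fun j => ?_) _
  have h1 := (continuous_flowDepth k t).rexp
  have h2 := (continuous_flowDepth k t).neg.rexp
  have h3 := continuous_horo k
  split_ifs <;> fun_prop

/-- The time `t` map of the flow in the spike at the vertex `k`, as a homeomorphism. -/
def spikeHomeo (k : Fin 3) (t : ℝ) : Bary ≃ₜ Bary where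
  toFun := spikeMap k t
  invFun := spikeMap k (-t)
  left_inv a := by rw [← spikeMap_add, add_neg_cancel, spikeMap_zero]
  right_inv a := by rw [← spikeMap_add, neg_add_cancel, spikeMap_zero]
  continuous_toFun := continuous_spikeMap k t
  continuous_invFun := continuous_spikeMap k (-t)

/-- Speed of the flow at a point. -/
def speed (k : Fin 3) (a : Bary) : ℝ := spikeSpeed (leafParam k a ^ 2) (depth k a)

lemma spikeMap_of_speed_eq_zero {k : Fin 3} {a : Bary} (h : speed k a = 0) (t : ℝ) :
    spikeMap k t a = a :=
  ext_horo k (by simp) (by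
    simp [flowDepth, spikeFlow_of_speed_eq_zero (sq_nonneg _) (leafParam_sq_le k a) h])

lemma speed_spikeMap_eq_zero_iff {k : Fin 3} {a : Bary} {t : ℝ} :
    speed k (spikeMap k t a) = 0 ↔ speed k a = 0 := by
  simp only [speed, leafParam_spikeMap, depth_spikeMap, flowDepth]
  exact spikeSpeed_spikeFlow_eq_zero_iff (sq_nonneg _) (leafParam_sq_le k a) _ _

/-- The closed region of the spike at the vertex `k` in which the flow is not cut off. -/
def InSpike (k : Fin 3) (a : Bary) : Prop :=
  -1 / 2 ≤ depth k a ∧ 0 ≤ depth k a + leafParam k a ^ 2 * Real.exp (-2 * depth k a)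

lemma inSpike_of_speed_ne_zero {k : Fin 3} {a : Bary} (h : speed k a ≠ 0) :
    -1 / 2 ≤ depth k a ∧ 0 < depth k a + leafParam k a ^ 2 * Real.exp (-2 * depth k a) := by
  have h1 : -1 / 2 ≤ depth k a := by
    by_contra! h2
    exact h (spikeSpeed_of_le (leafParam_sq_le k a) h2.le)
  refine ⟨h1, ?_⟩
  by_contra! h2
  rw [speed, spikeSpeed_of_ge h1] at h
  exact h (max_eq_left h2)

/-- The supports of the three flows are separated by the bisectors. -/
lemma lt_of_speed_ne_zero {k : Fin 3} {a : Bary} (h : speed k a ≠ 0) :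
    a.1 (k + 1) < a.1 k ∧ a.1 (k + 2) < a.1 k := by
  obtain ⟨h1, h2⟩ := inSpike_of_speed_ne_zero h
  have hs := size_pos k a
  set x := horo k a with hx
  set η := depth k a with hη
  have hx1 : x ^ 2 ≤ 1 := horo_sq_le k a
  have e : Real.exp (2 * η) = (4 * size k a)⁻¹ * (size k a)⁻¹ := by
    rw [two_mul, Real.exp_add, hη, exp_depth]; field_simp; norm_num
  -- The cases `y = x` and `y = -x` compare with the two other coordinates. If the inequality fails,
  -- `u = exp (2η)` satisfies `u ≤ 1 - (1 - y)² / 4`, so `η ≤ (u - 1) / 2 ≤ -(1 - y)² / 8`. As `u ≥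
  -- 1 / 3`, the term `u η ≤ -(1 - y)² / 24` outweighs `φ² ≤ (1 - y)² / 64`, and the speed would not
  -- be positive. The denominator 16 in `leafParam` is large enough for this.
  have key : ∀ y : ℝ, y ^ 2 = x ^ 2 → (1 + y) / 2 < Real.exp (2 * η) - (1 - x ^ 2) / 4 := by
    intro y hy
    by_contra! hc
    have hy1 : y ≤ 1 := by nlinarith
    have hy2 : -1 ≤ y := by nlinarith
    set u := Real.exp (2 * η) with hu
    have hu3 : 1 / 3 ≤ u := by
      have h3 : Real.exp (-1) ≤ u := Real.exp_le_exp.2 (by linarith)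
      refine le_trans ?_ h3
      rw [Real.exp_neg, ← one_div]
      exact one_div_le_one_div_of_le (Real.exp_pos 1) exp_one_lt_three.le
    have hlog : 2 * η ≤ u - 1 := by linarith [Real.add_one_le_exp (2 * η)]
    have hu1 : u ≤ 1 - (1 - y) ^ 2 / 4 := by rw [← hy] at hc; linarith
    have hφ : leafParam k a ^ 2 ≤ (1 - y) ^ 2 / 64 := by
      have : leafParam k a = (1 - y) * (1 + y) / 16 := by
        rw [leafParam, ← hx, ← hy]; ring
      rw [this]
      nlinarith [mul_nonneg (sq_nonneg (1 - y)) (show 0 ≤ (1 - y) * (3 + y) by nlinarith)]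
    have e' : u * Real.exp (-2 * η) = 1 := by rw [hu, ← Real.exp_add]; simp
    have hpos : 0 < u * (η + leafParam k a ^ 2 * Real.exp (-2 * η)) :=
      mul_pos (Real.exp_pos _) h2
    have : u * (η + leafParam k a ^ 2 * Real.exp (-2 * η)) = u * η + leafParam k a ^ 2 := by
      linear_combination (leafParam k a ^ 2) * e'
    rw [this] at hpos
    nlinarith [sq_nonneg (1 - y)]
  have hk : a.1 k = size k a * (Real.exp (2 * η) - (1 - x ^ 2) / 4) := by
    rw [coord_self, e, ← hx]; field_simp
  constructor
  · rw [coord_add_one, hk, mul_div_assoc]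
    exact mul_lt_mul_of_pos_left (key x rfl) hs
  · rw [coord_add_two, hk, mul_div_assoc, sub_eq_add_neg]
    exact mul_lt_mul_of_pos_left (key (-x) (neg_sq x)) hs

lemma speed_eq_zero_of_ne {k l : Fin 3} {a : Bary} (h : speed k a ≠ 0) (hl : l ≠ k) :
    speed l a = 0 := by
  by_contra h'
  obtain ⟨h1, h2⟩ := lt_of_speed_ne_zero h
  obtain ⟨h3, h4⟩ := lt_of_speed_ne_zero h'
  fin_cases k <;> fin_cases l <;> simp [Fin.reduceAdd] at * <;> linarith

/-- The stretch flow on an ideal triangle: side parameters are multiplied by `exp t`. -/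
def stretch (t : ℝ) : Bary ≃ₜ Bary :=
  (spikeHomeo 0 t).trans ((spikeHomeo 1 t).trans (spikeHomeo 2 t))

lemma stretch_apply (t : ℝ) (a : Bary) :
    stretch t a = spikeMap 2 t (spikeMap 1 t (spikeMap 0 t a)) := rfl

/-- The supports of the three flows are disjoint, and each is invariant under its own flow, so only
one factor acts. -/
lemma stretch_of_speed_ne_zero {k : Fin 3} {a : Bary} (h : speed k a ≠ 0) (t : ℝ) :
    stretch t a = spikeMap k t a := by
  have h' : speed k (spikeMap k t a) ≠ 0 := fun h0 => h (speed_spikeMap_eq_zero_iff.1 h0)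
  rw [stretch_apply]
  fin_cases k <;> simp only [Fin.zero_eta, Fin.mk_one, Fin.reduceFinMk] at *
  · rw [spikeMap_of_speed_eq_zero (k := 1) (speed_eq_zero_of_ne h' (by decide)),
      spikeMap_of_speed_eq_zero (k := 2) (speed_eq_zero_of_ne h' (by decide))]
  · rw [spikeMap_of_speed_eq_zero (k := 0) (speed_eq_zero_of_ne h (by decide)),
      spikeMap_of_speed_eq_zero (k := 2) (speed_eq_zero_of_ne h' (by decide))]
  · rw [spikeMap_of_speed_eq_zero (k := 0) (speed_eq_zero_of_ne h (by decide)),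
      spikeMap_of_speed_eq_zero (k := 1) (speed_eq_zero_of_ne h (by decide))]

lemma stretch_of_speed_eq_zero {a : Bary} (h : ∀ k, speed k a = 0) (t : ℝ) : stretch t a = a := by
  rw [stretch_apply, spikeMap_of_speed_eq_zero (h 0), spikeMap_of_speed_eq_zero (h 1),
    spikeMap_of_speed_eq_zero (h 2)]

lemma stretch_add (s t : ℝ) (a : Bary) : stretch (s + t) a = stretch t (stretch s a) := by
  by_cases h : ∀ k, speed k a = 0
  · simp only [stretch_of_speed_eq_zero h]
  · push Not at h
    obtain ⟨k, hk⟩ := h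
    rw [stretch_of_speed_ne_zero hk, stretch_of_speed_ne_zero hk, stretch_of_speed_ne_zero (k := k)
      (fun h0 => hk (speed_spikeMap_eq_zero_iff.1 h0)), spikeMap_add]

lemma stretch_zero (a : Bary) : stretch 0 a = a := by
  simp [stretch_apply, spikeMap_zero]

lemma stretch_symm_apply (t : ℝ) (a : Bary) : (stretch t).symm a = stretch (-t) a := by
  rw [Homeomorph.symm_apply_eq, ← stretch_add, neg_add_cancel, stretch_zero]

/-! ### Geodesic segments -/

lemma seg_norm (a b : Bary) (u : ℝ) :
    4 * (((1 - u) * a.1 0 + u * b.1 0) * ((1 - u) * a.1 1 + u * b.1 1)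
      + ((1 - u) * a.1 1 + u * b.1 1) * ((1 - u) * a.1 2 + u * b.1 2)
      + ((1 - u) * a.1 2 + u * b.1 2) * ((1 - u) * a.1 0 + u * b.1 0))
      = 1 + 2 * (u * (1 - u)) * (coshDist a b - 1) := by
  have ha := a.2.2
  have hb := b.2.2
  rw [coshDist]
  linear_combination (1 - u) ^ 2 * ha + u ^ 2 * hb

lemma segNorm_pos (a b : Bary) {u : ℝ} (hu : u ∈ Set.Icc (0 : ℝ) 1) :
    0 < 1 + 2 * (u * (1 - u)) * (coshDist a b - 1) := by
  have h1 := one_le_coshDist a b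
  have h2 : 0 ≤ u * (1 - u) := mul_nonneg hu.1 (by linarith [hu.2])
  have := mul_nonneg h2 (sub_nonneg.2 h1)
  linarith

/-- The geodesic segment from `a` to `b`. -/
def seg (a b : Bary) (u : Set.Icc (0 : ℝ) 1) : Bary :=
  ⟨fun k => ((1 - u.1) * a.1 k + u.1 * b.1 k) /
    √(1 + 2 * (u.1 * (1 - u.1)) * (coshDist a b - 1)), by
    have hN := segNorm_pos a b u.2
    have hu0 := u.2.1
    have hu1 : 0 ≤ 1 - u.1 := by linarith [u.2.2]
    refine ⟨fun k => div_nonneg (add_nonneg (mul_nonneg hu1 (a.nonneg k))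
      (mul_nonneg hu0 (b.nonneg k))) (Real.sqrt_nonneg _), ?_⟩
    have h := seg_norm a b u.1
    have hs : √(1 + 2 * (u.1 * (1 - u.1)) * (coshDist a b - 1)) ≠ 0 := (Real.sqrt_pos.2 hN).ne'
    have hq := Real.sq_sqrt hN.le
    generalize √(1 + 2 * (u.1 * (1 - u.1)) * (coshDist a b - 1)) = S at hs hq
    rw [← h] at hq
    field_simp
    rw [hq]; ring⟩

lemma seg_zero (a b : Bary) : seg a b ⟨0, by simp⟩ = a := Subtype.ext (by funext k; simp [seg])

lemma seg_one (a b : Bary) : seg a b ⟨1, by simp⟩ = b := Subtype.ext (by funext k; simp [seg])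

lemma continuous_seg (a b : Bary) : Continuous (seg a b) := by
  refine Continuous.subtype_mk (continuous_pi fun k => ?_) _
  refine Continuous.div (by fun_prop) (by fun_prop) fun u => ?_
  exact (Real.sqrt_pos.2 (segNorm_pos a b u.2)).ne'

/-- For a point `l a + m b` of the hyperboloid, the distances to `a` and `b` satisfy `sinh d₁ = m
sinh D` and `sinh d₂ = l sinh D`; the addition theorem then gives `cosh (d₁ + d₂) = cosh D`. -/
lemma hypDist_seg_aux {C p q l m d₁ d₂ D : ℝ} (hD : 0 ≤ D) (h₁ : 0 ≤ d₁) (h₂ : 0 ≤ d₂)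
    (hl : 0 ≤ l) (hm : 0 ≤ m) (hC : Real.cosh D = C) (hp : Real.cosh d₁ = p)
    (hq : Real.cosh d₂ = q) (ep : p = l + m * C) (eq : q = l * C + m)
    (hn : l ^ 2 + m ^ 2 + 2 * (l * m) * C = 1) : d₁ + d₂ = D := by
  have s1 : Real.sinh d₁ = m * Real.sinh D := by
    have e : Real.sinh d₁ ^ 2 = (m * Real.sinh D) ^ 2 := by
      rw [mul_pow, Real.sinh_sq, Real.sinh_sq, hp, hC, ep]; linear_combination hn
    exact (sq_eq_sq₀ (Real.sinh_nonneg_iff.2 h₁)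
      (mul_nonneg hm (Real.sinh_nonneg_iff.2 hD))).1 e
  have s2 : Real.sinh d₂ = l * Real.sinh D := by
    have e : Real.sinh d₂ ^ 2 = (l * Real.sinh D) ^ 2 := by
      rw [mul_pow, Real.sinh_sq, Real.sinh_sq, hq, hC, eq]; linear_combination hn
    exact (sq_eq_sq₀ (Real.sinh_nonneg_iff.2 h₂)
      (mul_nonneg hl (Real.sinh_nonneg_iff.2 hD))).1 e
  have hc : Real.cosh (d₁ + d₂) = Real.cosh D := by
    rw [Real.cosh_add, s1, s2, hp, hq, ep, eq, hC]
    have := Real.cosh_sq D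
    rw [hC] at this
    linear_combination C * hn - l * m * this
  have := Real.cosh_strictMonoOn.injOn (Set.mem_Ici.2 (add_nonneg h₁ h₂)) (Set.mem_Ici.2 hD) hc
  exact this

lemma hypDist_seg (a b : Bary) (u : Set.Icc (0 : ℝ) 1) :
    hypDist a (seg a b u) + hypDist (seg a b u) b = hypDist a b := by
  have hN := segNorm_pos a b u.2
  have hs := Real.sqrt_pos.2 hN
  have hq := Real.sq_sqrt hN.le
  have ha := a.2.2
  have hb := b.2.2
  refine hypDist_seg_aux (l := (1 - u.1) / √(1 + 2 * (u.1 * (1 - u.1)) * (coshDist a b - 1)))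
    (m := u.1 / √(1 + 2 * (u.1 * (1 - u.1)) * (coshDist a b - 1)))
    (hypDist_nonneg _ _) (hypDist_nonneg _ _) (hypDist_nonneg _ _)
    (div_nonneg (by linarith [u.2.2]) hs.le) (div_nonneg u.2.1 hs.le)
    (cosh_hypDist _ _) (cosh_hypDist _ _) (cosh_hypDist _ _) ?_ ?_ ?_
  all_goals
    simp only [coshDist, seg]
    simp only [coshDist] at hs hq hN
    generalize √_ = S at hs hq
    have hS := hs.ne'
    field_simp
  · linear_combination (1 - u.1) * ha
  · linear_combination u.1 * hb
  · rw [hq]; ring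

/-! ### Lipschitz estimates for the stretch flow -/

/-- There are two uses: `ε = 0` gives the global Lipschitz bound, and `ε > 0` the strict one. In the
second, depths bounded by `M` stay below `(M + 1) exp t`, which keeps the correction term at least
`ε` during the whole motion. -/
lemma hypDist_spikeMap_le {k : Fin 3} {a b : Bary} (ha : InSpike k a) (hb : InSpike k b)
    {t ε c M : ℝ} (ht : 0 ≤ t) (hε : 0 ≤ ε) (hε' : ε ≤ 1 / 2) (hc : 0 ≤ c)
    (hca : c ≤ leafParam k a) (hcb : c ≤ leafParam k b)
    (hM : ε = 0 ∨ depth k a ≤ M ∧ depth k b ≤ M ∧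
      ε ≤ Real.exp (-(2 * ((M + 1) * Real.exp t))) * c ^ 2) :
    hypDist (spikeMap k t a) (spikeMap k t b) ≤ Real.exp ((1 - ε) * t) * hypDist a b := by
  have hle : ∀ x : Bary, InSpike k x → depth k x ≤ M → ∀ s ∈ Set.Icc 0 t,
      spikeFlow (leafParam k x ^ 2) (depth k x) s ≤ (M + 1) * Real.exp t := by
    intro x hx hxM s hs
    refine (spikeFlow_le (sq_nonneg _) (leafParam_sq_le k x) hx.1 hs.1).trans ?_
    have h1 := hx.1
    exact mul_le_mul (by linarith) (Real.exp_le_exp.2 hs.2) (Real.exp_pos _).le (by linarith)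
  have hbound : ∀ s ∈ Set.Icc 0 t, ∀ x, c ≤ x → ε ≤
      Real.exp (-spikeFlow (leafParam k a ^ 2) (depth k a) s
        - spikeFlow (leafParam k b ^ 2) (depth k b) s) * x ^ 2 := by
    intro s hs x hx
    rcases hM with rfl | ⟨h1, h2, h3⟩
    · positivity
    · refine h3.trans (mul_le_mul (Real.exp_le_exp.2 ?_) (pow_le_pow_left₀ hc hx 2)
        (sq_nonneg _) (Real.exp_pos _).le)
      have := hle a ha h1 s hs
      have := hle b hb h2 s hs
      linarith
  rw [hypDist, hypDist, coshDist_eq_horoCosh k, coshDist_eq_horoCosh k]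
  simp only [horo_spikeMap, depth_spikeMap, flowDepth]
  exact arcosh_horoCosh_spikeFlow_le (leafParam_sq_le k a) (leafParam_sq_le k b)
    (abs_leafParam_sub_le k a b) ha.1 hb.1 ha.2 hb.2 ht hε hε'
    (fun s hs => hbound s hs _ hca) (fun s hs => hbound s hs _ hcb)

lemma inSpike_of_ne {k : Fin 3} {a : Bary} (h : speed k a ≠ 0) : InSpike k a :=
  ⟨(inSpike_of_speed_ne_zero h).1, (inSpike_of_speed_ne_zero h).2.le⟩

/-- A segment that leaves the support of the flow meets its boundary. -/
lemma exists_seg_boundary {k : Fin 3} {a b : Bary} (ha : speed k a ≠ 0) (hb : speed k b = 0) :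
    ∃ u, InSpike k (seg a b u) ∧ speed k (seg a b u) = 0 := by
  -- The speed without truncation at zero, so that the intermediate value theorem finds a zero of it
  -- on the segment.
  let g : Bary → ℝ := fun x =>
    depth k x + leafParam k x ^ 2 * Real.exp (-2 * max (depth k x) (-1 / 2))
  have hspeed : ∀ x, speed k x = max 0 (g x) := fun x => rfl
  have hg : Continuous g := by
    have := continuous_depth k
    have := continuous_leafParam k
    fun_prop
  have ha' : 0 ≤ g (seg a b ⟨0, by simp⟩) := by
    rw [seg_zero]
    by_contra! h
    exact ha (by rw [hspeed]; exact max_eq_left h.le)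
  have hb' : g (seg a b ⟨1, by simp⟩) ≤ 0 := by
    rw [seg_one, ← max_eq_left_iff, ← hspeed]; exact hb
  obtain ⟨u, hu⟩ := mem_range_of_exists_le_of_exists_ge (hg.comp (continuous_seg a b))
    ⟨_, hb'⟩ ⟨_, ha'⟩
  have hu0 : g (seg a b u) = 0 := hu
  refine ⟨u, ?_, by rw [hspeed, hu0, max_self]⟩
  have h1 : -1 / 2 ≤ depth k (seg a b u) := by
    by_contra! h
    have h2 := leafParam_sq_le k (seg a b u)
    have h3 := exp_neg_two_max_le (depth k (seg a b u))
    have h4 := mul_le_mul h2 h3 (Real.exp_pos _).le (by norm_num)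
    have : g (seg a b u) < 0 := by dsimp only [g]; linarith
    linarith
  refine ⟨h1, ?_⟩
  dsimp only [g] at hu0
  rw [max_eq_left h1] at hu0
  exact hu0.ge

section
variable {W : Set Bary} (hW : ∀ a ∈ W, ∀ b ∈ W, ∀ u, seg a b u ∈ W) {t L : ℝ} (hL : 1 ≤ L)
  (hlip : ∀ k, ∀ a ∈ W, ∀ b ∈ W, InSpike k a → InSpike k b →
    hypDist (spikeMap k t a) (spikeMap k t b) ≤ L * hypDist a b)
include hW hL hlip

/-- The segment is cut at a resting point on the boundary of the support: up to there the spike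
estimate applies, and beyond it both ends are fixed, which is harmless as `1 ≤ L`. The set `W`,
closed under segments, allows one argument for the global bound and for the strict bound on compact
sets. -/
lemma hypDist_stretch_le_of_speed_eq_zero {k : Fin 3} {a b : Bary} (haW : a ∈ W) (hbW : b ∈ W)
    (ha : speed k a ≠ 0) (hb : speed k b = 0) :
    hypDist (spikeMap k t a) b ≤ L * hypDist a b := by
  obtain ⟨u, h1, h2⟩ := exists_seg_boundary ha hb
  have h3 := hlip k a haW _ (hW a haW b hbW u) (inSpike_of_ne ha) h1
  rw [spikeMap_of_speed_eq_zero h2] at h3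
  have h4 := hypDist_triangle (spikeMap k t a) (seg a b u) b
  have h5 := le_mul_of_one_le_left (hypDist_nonneg (seg a b u) b) hL
  rw [← hypDist_seg a b u]
  linarith

lemma hypDist_stretch_le_of_spikes {a b : Bary} (haW : a ∈ W) (hbW : b ∈ W) :
    hypDist (stretch t a) (stretch t b) ≤ L * hypDist a b := by
  by_cases ha : ∀ k, speed k a = 0
  · by_cases hb : ∀ k, speed k b = 0
    · rw [stretch_of_speed_eq_zero ha, stretch_of_speed_eq_zero hb]
      exact le_mul_of_one_le_left (hypDist_nonneg _ _) hL
    · push Not at hb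
      obtain ⟨k, hk⟩ := hb
      rw [stretch_of_speed_eq_zero ha, stretch_of_speed_ne_zero hk, hypDist_comm,
        hypDist_comm a]
      exact hypDist_stretch_le_of_speed_eq_zero hW hL hlip hbW haW hk (ha k)
  push Not at ha
  obtain ⟨k, hk⟩ := ha
  rw [stretch_of_speed_ne_zero hk]
  by_cases hb : ∀ k, speed k b = 0
  · rw [stretch_of_speed_eq_zero hb]
    exact hypDist_stretch_le_of_speed_eq_zero hW hL hlip haW hbW hk (hb k)
  push Not at hb
  obtain ⟨l, hl⟩ := hb
  rw [stretch_of_speed_ne_zero hl]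
  by_cases hkl : l = k
  · subst hkl
    exact hlip l a haW b hbW (inSpike_of_ne hk) (inSpike_of_ne hl)
  -- For points in different spikes the segment is cut where coordinate `k` ties with the larger of
  -- the other two. No coordinate is strictly greater there than both others unless it is one of
  -- these, which the tie excludes; hence every flow rests.
  let g : Bary → ℝ := fun x => x.1 k - max (x.1 (k + 1)) (x.1 (k + 2))
  have hg : Continuous g := (continuous_coord _).sub
    ((continuous_coord _).max (continuous_coord _))
  have hl' := lt_of_speed_ne_zero hl
  have hcases : l = k + 1 ∨ l = k + 2 := by
    revert hkl; fin_cases k <;> fin_cases l <;> decide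
  have hga : 0 ≤ g (seg a b ⟨0, by simp⟩) := by
    rw [seg_zero]
    exact sub_nonneg.2 (max_le (lt_of_speed_ne_zero hk).1.le (lt_of_speed_ne_zero hk).2.le)
  have hgb : g (seg a b ⟨1, by simp⟩) ≤ 0 := by
    rw [seg_one]
    refine sub_nonpos.2 ?_
    rcases hcases with rfl | rfl
    · refine le_trans ?_ (le_max_left _ _)
      have : k + 1 + 2 = k := by rw [add_assoc]; simp
      rw [this] at hl'; exact hl'.2.le
    · refine le_trans ?_ (le_max_right _ _)
      have : k + 2 + 1 = k := by rw [add_assoc]; simp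
      rw [this] at hl'; exact hl'.1.le
  obtain ⟨u, hu⟩ := mem_range_of_exists_le_of_exists_ge (hg.comp (continuous_seg a b))
    ⟨_, hgb⟩ ⟨_, hga⟩
  have hu0 : (seg a b u).1 k = max ((seg a b u).1 (k + 1)) ((seg a b u).1 (k + 2)) :=
    sub_eq_zero.1 hu
  have hm : ∀ j, speed j (seg a b u) = 0 := by
    intro j
    by_contra hj
    have h := lt_of_speed_ne_zero hj
    have h1 := hu0.ge.trans' (le_max_left _ _)
    have h2 := hu0.ge.trans' (le_max_right _ _)
    have h3 := max_choice ((seg a b u).1 (k + 1)) ((seg a b u).1 (k + 2))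
    rw [← hu0] at h3
    fin_cases k <;> fin_cases j <;> simp [Fin.reduceAdd] at * <;>
      first | linarith | (rcases h3 with h3 | h3 <;> linarith)
  have hmW := hW a haW b hbW u
  have h1 := hypDist_stretch_le_of_speed_eq_zero hW hL hlip haW hmW hk (hm k)
  have h2 := hypDist_stretch_le_of_speed_eq_zero hW hL hlip hbW hmW hl (hm l)
  have h3 := hypDist_triangle (spikeMap k t a) (seg a b u) (spikeMap l t b)
  rw [hypDist_comm, hypDist_comm b] at h2
  rw [← hypDist_seg a b u, mul_add]
  linarith

end

theorem hypDist_stretch_le {t : ℝ} (ht : 0 ≤ t) (a b : Bary) :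
    hypDist (stretch t a) (stretch t b) ≤ Real.exp t * hypDist a b := by
  refine hypDist_stretch_le_of_spikes (W := Set.univ) (fun _ _ _ _ _ => trivial)
    (Real.one_le_exp ht) (fun k a _ b _ ha hb => ?_) trivial trivial
  have := hypDist_spikeMap_le (ε := 0) (c := 0) (M := 0) ha hb ht le_rfl (by norm_num) le_rfl
    (leafParam_nonneg k a) (leafParam_nonneg k b) (Or.inl rfl)
  simpa using this

lemma leafParam_eq (k : Fin 3) (a : Bary) :
    leafParam k a = a.1 (k + 1) * a.1 (k + 2) / (4 * size k a ^ 2) := by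
  have := (size_pos k a).ne'
  rw [leafParam, coord_add_one, coord_add_two]; field_simp; ring

theorem exists_hypDist_stretch_le_of_isCompact {t : ℝ} (ht : 0 < t) {C : Set Bary}
    (hC : IsCompact C) (hpos : ∀ a ∈ C, ∀ k, 0 < a.1 k) :
    ∃ L < Real.exp t, ∀ a ∈ C, ∀ b ∈ C,
      hypDist (stretch t a) (stretch t b) ≤ L * hypDist a b := by
  obtain ⟨ε, hε, hεC⟩ : ∃ ε > 0, ∀ a ∈ C, ∀ k, ε * (a.1 0 + a.1 1 + a.1 2) ≤ a.1 k := by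
    rcases C.eq_empty_or_nonempty with rfl | hne
    · exact ⟨1, one_pos, fun a ha => ha.elim⟩
    have hS : ∀ a : Bary, 0 < a.1 0 + a.1 1 + a.1 2 := fun a => by
      have := size_pos 0 a
      have := a.nonneg 0
      simp only [size, Fin.isValue, zero_add] at *
      linarith
    obtain ⟨m, hm, hmin⟩ := hC.exists_isMinOn hne
      (f := fun a : Bary => min (a.1 0) (min (a.1 1) (a.1 2)) / (a.1 0 + a.1 1 + a.1 2))
      (Continuous.continuousOn (Continuous.div ((continuous_coord _).min
        ((continuous_coord _).min (continuous_coord _))) (((continuous_coord _).add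
          (continuous_coord _)).add (continuous_coord _)) fun a => (hS a).ne'))
    refine ⟨_, div_pos (lt_min (hpos m hm 0) (lt_min (hpos m hm 1) (hpos m hm 2))) (hS m),
      fun a ha k => ?_⟩
    have h := hmin ha
    simp only [Set.mem_ofPred_eq] at h
    rw [le_div_iff₀ (hS a)] at h
    refine h.trans ?_
    fin_cases k <;> simp
  -- Homogeneous linear inequalities, so `W` is closed under geodesic segments. It contains `C`, and
  -- on it depths are bounded above and `leafParam` is bounded below.
  let W : Set Bary := {a | ∀ k, ε * (a.1 0 + a.1 1 + a.1 2) ≤ a.1 k}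
  have hW : ∀ a ∈ W, ∀ b ∈ W, ∀ u, seg a b u ∈ W := by
    intro a ha b hb u k
    have hu1 : 0 ≤ 1 - u.1 := by linarith [u.2.2]
    have h1 := mul_le_mul_of_nonneg_left (ha k) hu1
    have h2 := mul_le_mul_of_nonneg_left (hb k) u.2.1
    simp only [seg]
    rw [← add_div, ← add_div, ← mul_div_assoc]
    refine div_le_div_of_nonneg_right ?_ (Real.sqrt_nonneg _)
    linarith
  have hsum : ∀ (k : Fin 3) (a : Bary), a.1 0 + a.1 1 + a.1 2 = a.1 k + size k a := by
    intro k a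
    fin_cases k <;> simp [size, Fin.reduceAdd] <;> ring
  have hsize : ∀ (k : Fin 3), ∀ a ∈ W, ε ≤ size k a := by
    intro k a ha
    have h1 := ha (k + 1)
    have h2 := ha (k + 2)
    have h3 : size k a = a.1 (k + 1) + a.1 (k + 2) := rfl
    have h4 : 1 / 2 ≤ a.1 0 + a.1 1 + a.1 2 := by
      have := a.2.2
      have h0 := a.nonneg 0
      have h1 := a.nonneg 1
      have h2 := a.nonneg 2
      nlinarith [sq_nonneg (a.1 0), sq_nonneg (a.1 1), sq_nonneg (a.1 2)]
    nlinarith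
  have hleaf : ∀ (k : Fin 3), ∀ a ∈ W, ε ^ 2 / 4 ≤ leafParam k a := by
    intro k a ha
    have hs := size_pos k a
    have h0 := a.nonneg k
    have e := hsum k a
    have h3 : ε * size k a ≤ ε * (a.1 0 + a.1 1 + a.1 2) :=
      mul_le_mul_of_nonneg_left (by linarith) hε.le
    have h1 := h3.trans (ha (k + 1))
    have h2 := h3.trans (ha (k + 2))
    rw [leafParam_eq, div_le_div_iff₀ (by norm_num) (by positivity)]
    have := mul_le_mul h1 h2 (mul_pos hε hs).le (a.nonneg _)
    nlinarith
  have hdepth : ∀ (k : Fin 3), ∀ a ∈ W, depth k a ≤ -Real.log (2 * ε) := by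
    intro k a ha
    have := hsize k a ha
    exact neg_le_neg (Real.log_le_log (by positivity) (by linarith))
  let M := -Real.log (2 * ε)
  -- The rate allowed by `hypDist_spikeMap_le` with `c = ε² / 4` and depths at most `M`.
  let δ := min (1 / 2) (Real.exp (-(2 * ((M + 1) * Real.exp t))) * (ε ^ 2 / 4) ^ 2)
  have hδ : 0 < δ := lt_min (by norm_num) (by positivity)
  have hδ1 : δ ≤ 1 / 2 := min_le_left _ _
  refine ⟨Real.exp ((1 - δ) * t), Real.exp_lt_exp.2 (by nlinarith), fun a ha b hb => ?_⟩
  refine hypDist_stretch_le_of_spikes (W := W) hW (Real.one_le_exp (by nlinarith))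
    (fun k a ha b hb hka hkb => ?_) (hεC a ha) (hεC b hb)
  exact hypDist_spikeMap_le hka hkb ht.le hδ.le hδ1 (by positivity) (hleaf k a ha) (hleaf k b hb)
    (Or.inr ⟨hdepth k a ha, hdepth k b hb, min_le_right _ _⟩)

/-! ### The sides -/

/-- The point with arclength parameter `s` on the side opposite to the vertex `k`. -/
def side (k : Fin 3) (s : ℝ) : Bary :=
  ⟨fun j => if j = k then 0 else if j = k + 1 then Real.exp (-s) / 2 else Real.exp s / 2, by
    have e : Real.exp (-s) * Real.exp s = 1 := by rw [← Real.exp_add]; simp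
    have k1 : k + 1 ≠ k := by fin_cases k <;> decide
    have k2 : k + 2 ≠ k := by fin_cases k <;> decide
    have k3 : k + 2 ≠ k + 1 := by fin_cases k <;> decide
    refine ⟨fun j => ?_, ?_⟩
    · dsimp only
      split_ifs <;> positivity
    · refine norm_of_cyclic (a := fun j => if j = k then _ else if j = k + 1 then _ else _) k ?_
      simp only [if_true, if_neg k1, if_neg k2, if_neg k3]
      linear_combination e⟩

lemma side_self (k : Fin 3) (s : ℝ) : (side k s).1 k = 0 := by simp [side]

lemma side_add_one (k : Fin 3) (s : ℝ) : (side k s).1 (k + 1) = Real.exp (-s) / 2 := by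
  simp [side]

lemma side_add_two (k : Fin 3) (s : ℝ) : (side k s).1 (k + 2) = Real.exp s / 2 := by
  have k2 : k + 2 ≠ k := by fin_cases k <;> decide
  have k3 : k + 2 ≠ k + 1 := by fin_cases k <;> decide
  simp only [side, if_neg k2, if_neg k3]

lemma eq_side {k : Fin 3} {a : Bary} (h : a.1 k = 0) : a = side k (Real.log (2 * a.1 (k + 2))) := by
  have hn := a.norm_eq k
  rw [h] at hn
  have h2 : 0 < a.1 (k + 2) := by
    refine (a.nonneg _).lt_of_ne fun h0 => ?_
    rw [← h0] at hn; norm_num at hn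
  refine ext_cyclic k (by rw [h, side_self]) ?_ ?_
  · rw [side_add_one, Real.exp_neg, Real.exp_log (by positivity)]
    field_simp; linarith
  · rw [side_add_two, Real.exp_log (by positivity)]; ring

lemma coord_eq_zero_iff {k : Fin 3} {a : Bary} : a.1 k = 0 ↔ ∃ s, a = side k s :=
  ⟨fun h => ⟨_, eq_side h⟩, by rintro ⟨s, rfl⟩; exact side_self k s⟩

lemma hypDist_side (k : Fin 3) (s t : ℝ) : hypDist (side k s) (side k t) = |s - t| := by
  refine hypDist_eq_of_cosh (abs_nonneg _) ?_
  rw [coshDist_eq _ _ k, side_self, side_self, side_add_one, side_add_one, side_add_two,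
    side_add_two, Real.cosh_abs, Real.cosh_eq]
  have e1 : Real.exp (s - t) = Real.exp s * Real.exp (-t) := by rw [← Real.exp_add]; ring_nf
  have e2 : Real.exp (-(s - t)) = Real.exp (-s) * Real.exp t := by rw [← Real.exp_add]; ring_nf
  rw [e1, e2]; ring

section
variable (l : Fin 3) (s : ℝ)

lemma size_side_add_one : size (l + 1) (side l s) = Real.exp s / 2 := by
  have h1 : l + 1 + 1 = l + 2 := by rw [add_assoc]; rfl
  have h2 : l + 1 + 2 = l := by rw [add_assoc]; simp
  rw [size, h1, h2, side_self, side_add_two, add_zero]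

lemma size_side_add_two : size (l + 2) (side l s) = Real.exp (-s) / 2 := by
  have h1 : l + 2 + 1 = l := by rw [add_assoc]; simp
  have h2 : l + 2 + 2 = l + 1 := by rw [add_assoc]; rfl
  rw [size, h1, h2, side_self, side_add_one, zero_add]

lemma horo_side_add_one : horo (l + 1) (side l s) = 1 := by
  have h1 : l + 1 + 1 = l + 2 := by rw [add_assoc]; rfl
  have h2 : l + 1 + 2 = l := by rw [add_assoc]; simp
  rw [horo, size_side_add_one, h1, h2, side_self, side_add_two, sub_zero,
    div_self (by positivity)]

lemma horo_side_add_two : horo (l + 2) (side l s) = -1 := by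
  have h1 : l + 2 + 1 = l := by rw [add_assoc]; simp
  have h2 : l + 2 + 2 = l + 1 := by rw [add_assoc]; rfl
  rw [horo, size_side_add_two, h1, h2, side_self, side_add_one, zero_sub, neg_div,
    div_self (by positivity)]

lemma depth_side_add_one : depth (l + 1) (side l s) = -s := by
  rw [depth, size_side_add_one, mul_div_cancel₀ _ two_ne_zero, Real.log_exp]

lemma depth_side_add_two : depth (l + 2) (side l s) = s := by
  rw [depth, size_side_add_two, mul_div_cancel₀ _ two_ne_zero, Real.log_exp, neg_neg]

lemma leafParam_side_add_one : leafParam (l + 1) (side l s) = 0 := by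
  simp [leafParam, horo_side_add_one]

lemma leafParam_side_add_two : leafParam (l + 2) (side l s) = 0 := by
  simp [leafParam, horo_side_add_two]

end

lemma spikeSpeed_param_zero {η : ℝ} (h : 0 < η) : spikeSpeed 0 η ≠ 0 := by
  rw [spikeSpeed, zero_mul, add_zero, max_eq_right h.le]; exact h.ne'

theorem stretch_side (t : ℝ) (k : Fin 3) (s : ℝ) :
    stretch t (side k s) = side k (Real.exp t * s) := by
  rcases lt_trichotomy s 0 with hs | rfl | hs
  · have h : speed (k + 1) (side k s) ≠ 0 := by
      rw [speed, leafParam_side_add_one, depth_side_add_one, zero_pow two_ne_zero]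
      exact spikeSpeed_param_zero (by linarith)
    rw [stretch_of_speed_ne_zero h]
    refine ext_horo (k + 1) (by simp only [horo_spikeMap, horo_side_add_one]) ?_
    rw [depth_spikeMap, flowDepth, leafParam_side_add_one, depth_side_add_one,
      depth_side_add_one, zero_pow two_ne_zero, spikeFlow_param_zero (by linarith)]
    ring
  · rw [mul_zero]
    refine stretch_of_speed_eq_zero (fun j => ?_) t
    by_contra hj
    have h := lt_of_speed_ne_zero hj
    have h0 := side_self k 0
    have h1 := side_add_one k 0
    have h2 := side_add_two k 0
    rw [neg_zero] at h1
    rw [Real.exp_zero] at h1 h2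
    fin_cases k <;> fin_cases j <;> simp [Fin.reduceAdd] at * <;> linarith
  · have h : speed (k + 2) (side k s) ≠ 0 := by
      rw [speed, leafParam_side_add_two, depth_side_add_two, zero_pow two_ne_zero]
      exact spikeSpeed_param_zero hs
    rw [stretch_of_speed_ne_zero h]
    refine ext_horo (k + 2) (by simp only [horo_spikeMap, horo_side_add_two]) ?_
    rw [depth_spikeMap, flowDepth, leafParam_side_add_two, depth_side_add_two,
      depth_side_add_two, zero_pow two_ne_zero, spikeFlow_param_zero hs.le]
    ring

lemma stretch_coord_eq_zero_iff {t : ℝ} {k : Fin 3} {a : Bary} :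
    (stretch t a).1 k = 0 ↔ a.1 k = 0 := by
  have key : ∀ (t : ℝ) (a : Bary), a.1 k = 0 → (stretch t a).1 k = 0 := by
    intro t a h
    obtain ⟨s, rfl⟩ := coord_eq_zero_iff.1 h
    rw [stretch_side, side_self]
  refine ⟨fun h => ?_, key t a⟩
  have := key (-t) _ h
  rwa [← stretch_add, add_neg_cancel, stretch_zero] at this

end Bary

/-! ## Light-like vectors -/

lemma mink_comm (u v : Fin 3 → ℝ) : mink u v = mink v u := by simp only [mink]; ring

lemma mink_smul_left (a : ℝ) (u v : Fin 3 → ℝ) : mink (a • u) v = a * mink u v := by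
  simp only [mink, Pi.smul_apply, smul_eq_mul]; ring

lemma mink_smul_right (a : ℝ) (u v : Fin 3 → ℝ) : mink u (a • v) = a * mink u v := by
  simp only [mink, Pi.smul_apply, smul_eq_mul]; ring

lemma mink_add_left (u v w : Fin 3 → ℝ) : mink (u + v) w = mink u w + mink v w := by
  simp only [mink, Pi.add_apply]; ring

lemma mink_add_right (u v w : Fin 3 → ℝ) : mink u (v + w) = mink u v + mink u w := by
  simp only [mink, Pi.add_apply]; ring

lemma sum_fin_three_cyclic {M : Type*} [AddCommMonoid M] (f : Fin 3 → M) (i : Fin 3) :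
    ∑ k, f k = f i + f (i + 1) + f (i + 2) := by
  rw [Fin.sum_univ_three]
  fin_cases i <;> simp [Fin.reduceAdd] <;> abel

lemma Fin.forall_cyclic {P : Fin 3 → Prop} (i : Fin 3) :
    (∀ k, P k) ↔ P i ∧ P (i + 1) ∧ P (i + 2) := by
  constructor
  · exact fun h => ⟨h _, h _, h _⟩
  · rintro ⟨h0, h1, h2⟩ k
    fin_cases i <;> fin_cases k <;> simp_all [Fin.reduceAdd]

lemma smul_mem_lightCone {t : ℝ} (ht : 0 < t) {u : Fin 3 → ℝ} (hu : u ∈ lightCone) :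
    t • u ∈ lightCone := by
  refine ⟨?_, ?_⟩
  · rw [mink_smul_left, mink_smul_right, hu.1]; ring
  · exact mul_pos ht hu.2

/-- It exhibits the product of two vectors of the positive cone as minus a sum of squares over a
positive number: the product is nonpositive, and zero only on a common ray. -/
lemma two_mul_mink_of_null {u v : Fin 3 → ℝ} (hu : mink u u = 0) (hv : mink v v = 0) :
    (u 0 * v 2 - v 0 * u 2) ^ 2 + (u 1 * v 2 - v 1 * u 2) ^ 2 = -(2 * (u 2 * v 2)) * mink u v := by
  simp only [mink] at *
  linear_combination v 2 ^ 2 * hu + u 2 ^ 2 * hv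

lemma mink_nonpos {u v : Fin 3 → ℝ} (hu : u ∈ lightCone) (hv : v ∈ lightCone) : mink u v ≤ 0 := by
  have h := two_mul_mink_of_null hu.1 hv.1
  have h2 := mul_pos hu.2 hv.2
  by_contra! h3
  nlinarith [mul_pos h2 h3, sq_nonneg (u 0 * v 2 - v 0 * u 2), sq_nonneg (u 1 * v 2 - v 1 * u 2)]

lemma mink_neg_of_linearIndependent {u v : Fin 3 → ℝ} (hu : u ∈ lightCone) (hv : v ∈ lightCone)
    (h : LinearIndependent ℝ ![u, v]) : mink u v < 0 := by
  refine (mink_nonpos hu hv).lt_of_ne fun h0 => ?_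
  have e := two_mul_mink_of_null hu.1 hv.1
  rw [h0, mul_zero] at e
  have e0 : u 0 * v 2 - v 0 * u 2 = 0 := by nlinarith [sq_nonneg (u 1 * v 2 - v 1 * u 2)]
  have e1 : u 1 * v 2 - v 1 * u 2 = 0 := by nlinarith [sq_nonneg (u 0 * v 2 - v 0 * u 2)]
  have := (LinearIndependent.pair_iff.1 h (v 2) (-u 2) (by
    funext k
    fin_cases k <;> simp <;> linarith)).1
  exact hv.2.ne' this

lemma mem_lightCone_of_mink_neg {u v : Fin 3 → ℝ} (hu : mink u u = 0) (hv : v ∈ lightCone)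
    (h : mink u v < 0) : u ∈ lightCone := by
  refine ⟨hu, ?_⟩
  have h2 := hv.2
  have e := two_mul_mink_of_null hu hv.1
  by_contra! h3
  rcases h3.lt_or_eq with h4 | h4
  · have : 0 < u 2 * v 2 * mink u v := mul_pos_of_neg_of_neg (mul_neg_of_neg_of_pos h4 h2) h
    nlinarith [sq_nonneg (u 0 * v 2 - v 0 * u 2), sq_nonneg (u 1 * v 2 - v 1 * u 2)]
  · rw [h4] at e
    have e0 : u 0 * v 2 = 0 := by nlinarith [sq_nonneg (u 1 * v 2)]
    have e1 : u 1 * v 2 = 0 := by nlinarith [sq_nonneg (u 0 * v 2)]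
    have e0' := (mul_eq_zero.1 e0).resolve_right h2.ne'
    have e1' := (mul_eq_zero.1 e1).resolve_right h2.ne'
    simp [mink, e0', e1', h4] at h

lemma HypPlane.mink_neg (w : HypPlane) {v : Fin 3 → ℝ} (hv : v ∈ lightCone) : mink w.1 v < 0 := by
  obtain ⟨w, h1, h2⟩ := w
  obtain ⟨h3, h4⟩ := hv
  change mink w v < 0
  simp only [mink] at *
  have h5 : (w 0 * v 0 + w 1 * v 1) ^ 2 < (w 2 * v 2) ^ 2 := by
    have : w 2 ^ 2 = w 0 ^ 2 + w 1 ^ 2 + 1 := by linear_combination -h1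
    rw [mul_pow, this]
    nlinarith [sq_nonneg (w 0 * v 1 - w 1 * v 0), mul_pos h4 h4]
  have := abs_lt_of_sq_lt_sq' h5 (mul_pos h2 h4).le
  linarith [this.2]

lemma det_eq (u v w : Fin 3 → ℝ) : Matrix.det (Matrix.of ![u, v, w]) =
    u 0 * (v 1 * w 2 - v 2 * w 1) - u 1 * (v 0 * w 2 - v 2 * w 0)
      + u 2 * (v 0 * w 1 - v 1 * w 0) := by
  rw [Matrix.det_fin_three]
  simp
  ring

/-- A null vector is determined by its products with two vectors `v`, `w` and by its side of the
plane spanned by them. -/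
lemma eq_of_mink_eq_of_det {v w x y : Fin 3 → ℝ} {d : ℝ} (hx : mink x x = 0) (hy : mink y y = 0)
    (hv : mink x v = mink y v) (hw : mink x w = mink y w)
    (hdx : d * Matrix.det (Matrix.of ![v, w, x]) < 0)
    (hdy : d * Matrix.det (Matrix.of ![v, w, y]) < 0) : x = y := by
  -- The vector `x - y` is orthogonal to `v`, `w` and, both being null, to `x + y`. The two
  -- determinants have the same sign, so `v`, `w`, `x + y` form a basis and `x - y` vanishes.
  have h : d * (Matrix.det (Matrix.of ![v, w, x]) + Matrix.det (Matrix.of ![v, w, y])) ≠ 0 := by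
    rw [mul_add]; exact (add_neg hdx hdy).ne
  have h0 := right_ne_zero_of_mul h
  rw [det_eq, det_eq] at h0
  simp only [mink] at hx hy hv hw
  funext k
  refine sub_eq_zero.1 ((mul_eq_zero.1 ?_).resolve_left h0)
  fin_cases k <;> simp only [Fin.zero_eta, Fin.mk_one, Fin.reduceFinMk]
  · linear_combination (v 1 * w 2 - v 2 * w 1) * (hx - hy)
      - ((x 1 + y 1) * w 2 - (x 2 + y 2) * w 1) * hv + ((x 1 + y 1) * v 2 - (x 2 + y 2) * v 1) * hw
  · linear_combination (v 2 * w 0 - v 0 * w 2) * (hx - hy)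
      - ((x 2 + y 2) * w 0 - (x 0 + y 0) * w 2) * hv + ((x 2 + y 2) * v 0 - (x 0 + y 0) * v 2) * hw
  · linear_combination -(v 0 * w 1 - v 1 * w 0) * (hx - hy)
      + ((x 0 + y 0) * w 1 - (x 1 + y 1) * w 0) * hv - ((x 0 + y 0) * v 1 - (x 1 + y 1) * v 0) * hw

/-! ## Normalized triples -/

/-- Light-like vectors whose horocycles are pairwise tangent. -/
def IsNormalized (Z : Fin 3 → Fin 3 → ℝ) : Prop :=
  (∀ k, Z k ∈ lightCone) ∧ ∀ i j, i ≠ j → mink (Z i) (Z j) = -2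

/-- The point with coordinates `a`. -/
def comb (Z : Fin 3 → Fin 3 → ℝ) (a : Fin 3 → ℝ) : Fin 3 → ℝ := ∑ k, a k • Z k

/-- The coordinates of a vector with respect to a normalized triple. -/
def coord (Z : Fin 3 → Fin 3 → ℝ) (w : Fin 3 → ℝ) (k : Fin 3) : ℝ :=
  (mink w (Z k) - mink w (Z (k + 1)) - mink w (Z (k + 2))) / 4

lemma mink_comb (Z : Fin 3 → Fin 3 → ℝ) (a v : Fin 3 → ℝ) :
    mink (comb Z a) v = a 0 * mink (Z 0) v + a 1 * mink (Z 1) v + a 2 * mink (Z 2) v := by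
  simp only [comb, Fin.sum_univ_three, mink_add_left, mink_smul_left]

lemma comb_cyclic (Z : Fin 3 → Fin 3 → ℝ) (a : Fin 3 → ℝ) (i : Fin 3) :
    comb Z a = a i • Z i + a (i + 1) • Z (i + 1) + a (i + 2) • Z (i + 2) :=
  sum_fin_three_cyclic _ i

namespace IsNormalized

variable {Z : Fin 3 → Fin 3 → ℝ} (hZ : IsNormalized Z)
include hZ

lemma mink_eq (i j : Fin 3) : mink (Z i) (Z j) = if i = j then 0 else -2 := by
  split_ifs with h
  · rw [h]; exact (hZ.1 j).1
  · exact hZ.2 i j h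

lemma mink_comb_vertex (a : Fin 3 → ℝ) (i : Fin 3) :
    mink (comb Z a) (Z i) = -2 * (a (i + 1) + a (i + 2)) := by
  rw [mink_comb, hZ.mink_eq, hZ.mink_eq, hZ.mink_eq]
  fin_cases i <;> simp [Fin.reduceAdd] <;> ring

lemma mink_comb_comb (a b : Fin 3 → ℝ) : mink (comb Z a) (comb Z b) =
    -(2 * (a 0 * b 1 + a 1 * b 0 + a 1 * b 2 + a 2 * b 1 + a 2 * b 0 + a 0 * b 2)) := by
  rw [mink_comb, mink_comm, mink_comm (Z 1), mink_comm (Z 2), hZ.mink_comb_vertex,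
    hZ.mink_comb_vertex, hZ.mink_comb_vertex]
  simp [Fin.reduceAdd]
  ring

lemma coord_comb (a : Fin 3 → ℝ) : coord Z (comb Z a) = a := by
  funext k
  rw [coord, hZ.mink_comb_vertex, hZ.mink_comb_vertex, hZ.mink_comb_vertex]
  fin_cases k <;> simp [Fin.reduceAdd] <;> ring

lemma comb_injective : Function.Injective (comb Z) :=
  Function.LeftInverse.injective hZ.coord_comb

lemma linearIndependent : LinearIndependent ℝ Z := by
  rw [Fintype.linearIndependent_iff]
  intro g hg
  have h : comb Z g = comb Z 0 := by
    rw [comb, hg]; simp [comb]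
  exact congrFun (hZ.comb_injective h)

lemma isIdealTriple : IsIdealTriple Z := ⟨hZ.1, hZ.linearIndependent⟩

lemma comb_coord (w : Fin 3 → ℝ) : comb Z (coord Z w) = w := by
  have hli := hZ.linearIndependent
  have hspan := hli.span_eq_top_of_card_eq_finrank' (by simp)
  have hw : w ∈ Submodule.span ℝ (Set.range Z) := by rw [hspan]; trivial
  obtain ⟨a, rfl⟩ := (Submodule.mem_span_range_iff_exists_fun ℝ).1 hw
  exact congrArg (comb Z) (hZ.coord_comb a)

lemma det_ne_zero (i : Fin 3) :
    Matrix.det (Matrix.of ![Z (i + 1), Z (i + 2), Z i]) ≠ 0 := by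
  have n1 : i + 1 ≠ i := by fin_cases i <;> decide
  have n2 : i + 2 ≠ i := by fin_cases i <;> decide
  have n3 : i + 1 ≠ i + 2 := by fin_cases i <;> decide
  -- The square of the determinant is minus the Gram determinant, because the form has signature (2,
  -- 1).
  have h : ∀ u v w : Fin 3 → ℝ, mink u u = 0 → mink v v = 0 → mink w w = 0 → mink u v = -2 →
      mink u w = -2 → mink v w = -2 → Matrix.det (Matrix.of ![u, v, w]) ^ 2 = 16 := by
    intro u v w h1 h2 h3 h4 h5 h6
    have e : Matrix.det (Matrix.of ![u, v, w]) ^ 2 =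
        -(mink u u * (mink v v * mink w w - mink v w ^ 2)
          - mink u v * (mink u v * mink w w - mink v w * mink u w)
          + mink u w * (mink u v * mink v w - mink v v * mink u w)) := by
      rw [det_eq]; simp only [mink]; ring
    rw [e, h1, h2, h3, h4, h5, h6]; norm_num
  have := h _ _ _ (hZ.1 (i + 1)).1 (hZ.1 (i + 2)).1 (hZ.1 i).1 (hZ.2 _ _ n3) (hZ.2 _ _ n1)
    (hZ.2 _ _ n2)
  intro h0
  rw [h0] at this
  norm_num at this

lemma comb_mem (a : Bary) : mink (comb Z a.1) (comb Z a.1) = -1 ∧ 0 < comb Z a.1 2 := by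
  constructor
  · rw [hZ.mink_comb_comb]
    linarith [a.2.2]
  · have h : comb Z a.1 2 = a.1 0 * Z 0 2 + a.1 1 * Z 1 2 + a.1 2 * Z 2 2 := by
      simp [comb, Fin.sum_univ_three]
    have hs := a.size_pos 0
    have h0 := mul_nonneg (a.nonneg 0) (hZ.1 0).2.le
    have h1 := mul_nonneg (a.nonneg 1) (hZ.1 1).2.le
    have h2 := mul_nonneg (a.nonneg 2) (hZ.1 2).2.le
    rw [h]
    rcases (a.nonneg 1).lt_or_eq with h3 | h3
    · have := mul_pos h3 (hZ.1 1).2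
      linarith
    · have h4 : 0 < a.1 2 := by
        simp only [Bary.size, zero_add] at hs
        linarith
      have := mul_pos h4 (hZ.1 2).2
      linarith

lemma norm_coord {w : Fin 3 → ℝ} (hw : mink w w = -1) : 4 * (coord Z w 0 * coord Z w 1
    + coord Z w 1 * coord Z w 2 + coord Z w 2 * coord Z w 0) = 1 := by
  rw [← hZ.comb_coord w, hZ.mink_comb_comb] at hw
  linarith

lemma coord_nonneg {w : HypPlane} (hw : w ∈ idealTriangle Z) (k : Fin 3) :
    0 ≤ coord Z w.1 k := by
  obtain ⟨a, ha, h⟩ := hw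
  have : coord Z w.1 = a := by rw [h]; exact hZ.coord_comb a
  rw [this]; exact ha k

/-- An ideal triangle is parametrized by coordinates. -/
def baryHomeo : Bary ≃ₜ idealTriangle Z where
  toFun a := ⟨⟨comb Z a.1, hZ.comb_mem a⟩, a.1, a.nonneg, rfl⟩
  invFun w := ⟨coord Z w.1.1, hZ.coord_nonneg w.2, hZ.norm_coord w.1.2.1⟩
  left_inv a := Subtype.ext (hZ.coord_comb a.1)
  right_inv w := Subtype.ext (Subtype.ext (hZ.comb_coord w.1.1))
  continuous_toFun := by
    refine Continuous.subtype_mk (Continuous.subtype_mk ?_ _) _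
    exact continuous_finsetSum _ fun k _ => (Bary.continuous_coord k).smul continuous_const
  continuous_invFun := by
    refine Continuous.subtype_mk (continuous_pi fun k => ?_) _
    have h : ∀ j, Continuous fun w : idealTriangle Z => w.1.1 j := fun j =>
      (continuous_apply j).comp (continuous_subtype_val.comp continuous_subtype_val)
    unfold coord mink
    fun_prop

lemma baryHomeo_coe (a : Bary) : (hZ.baryHomeo a).1.1 = comb Z a.1 := rfl

lemma baryHomeo_symm_coe (w : idealTriangle Z) : (hZ.baryHomeo.symm w).1 = coord Z w.1.1 := rfl

lemma hdist_baryHomeo (a b : Bary) :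
    hdist (hZ.baryHomeo a).1 (hZ.baryHomeo b).1 = Bary.hypDist a b := by
  rw [hdist, Bary.hypDist, baryHomeo_coe, baryHomeo_coe, hZ.mink_comb_comb, neg_neg, Bary.coshDist]

lemma hypDist_baryHomeo_symm (x y : idealTriangle Z) :
    Bary.hypDist (hZ.baryHomeo.symm x) (hZ.baryHomeo.symm y) = hdist x.1 y.1 := by
  rw [← hZ.hdist_baryHomeo, Homeomorph.apply_symm_apply, Homeomorph.apply_symm_apply]

lemma mem_idealSide_iff {w : idealTriangle Z} {i : Fin 3} :
    w.1 ∈ idealSide Z i ↔ (hZ.baryHomeo.symm w).1 i = 0 := by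
  rw [hZ.baryHomeo_symm_coe]
  constructor
  · rintro ⟨a, -, hi, h⟩
    rw [h]
    exact (congrFun (hZ.coord_comb a) i).trans hi
  · exact fun h => ⟨coord Z w.1.1, hZ.coord_nonneg w.2, h, (hZ.comb_coord _).symm⟩

lemma baryHomeo_mem_idealSide {a : Bary} {i : Fin 3} :
    (hZ.baryHomeo a).1 ∈ idealSide Z i ↔ a.1 i = 0 := by
  rw [hZ.mem_idealSide_iff, Homeomorph.symm_apply_apply]

lemma coord_pos_of_mem_idealInterior {w : idealTriangle Z} (h : w.1 ∈ idealInterior Z)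
    (k : Fin 3) : 0 < (hZ.baryHomeo.symm w).1 k := by
  rw [hZ.baryHomeo_symm_coe]
  obtain ⟨a, ha, h⟩ := h
  rw [h]
  exact (ha k).trans_eq (congrFun (hZ.coord_comb a) k).symm

end IsNormalized

lemma idealSide_subset_idealTriangle (Z : Fin 3 → Fin 3 → ℝ) (i : Fin 3) :
    idealSide Z i ⊆ idealTriangle Z := fun _ ⟨a, ha, _, h⟩ => ⟨a, ha, h⟩

lemma isNormalized_stdVertex : IsNormalized stdVertex := by
  refine ⟨fun k => ⟨by simp [mink_stdVertex], ?_⟩, fun i j h => by simp [mink_stdVertex, h]⟩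
  fin_cases k <;> simp [stdVertex]

/-- Coordinates on the standard ideal triangle. -/
def stdBary : StdTriangle ≃ₜ Bary := isNormalized_stdVertex.baryHomeo.symm

lemma stdBary_sidePoint (i : Fin 3) (s : ℝ) : stdBary (sidePoint i s) = Bary.side i s := by
  rw [stdBary, Homeomorph.symm_apply_eq]
  refine Subtype.ext (Subtype.ext ?_)
  rw [IsNormalized.baryHomeo_coe, comb_cyclic _ _ i, Bary.side_self, Bary.side_add_one,
    Bary.side_add_two, zero_smul, zero_add]
  rfl

lemma stdBary_symm_side (i : Fin 3) (s : ℝ) : stdBary.symm (Bary.side i s) = sidePoint i s := by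
  rw [← stdBary_sidePoint, Homeomorph.symm_apply_apply]

lemma hdist_sidePoint (i : Fin 3) (s t : ℝ) :
    hdist (sidePoint i s).1 (sidePoint i t).1 = |s - t| := by
  rw [← isNormalized_stdVertex.hypDist_baryHomeo_symm]
  change Bary.hypDist (stdBary _) (stdBary _) = _
  rw [stdBary_sidePoint, stdBary_sidePoint, Bary.hypDist_side]

/-! ## Stretch maps -/

section
variable {Z Z' : Fin 3 → Fin 3 → ℝ} (hZ : IsNormalized Z) (hZ' : IsNormalized Z')

/-- The stretch map with factor `exp t` between two ideal triangles. -/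
def stretchMap (t : ℝ) : idealTriangle Z ≃ₜ idealTriangle Z' :=
  hZ.baryHomeo.symm.trans ((Bary.stretch t).trans hZ'.baryHomeo)

lemma hdist_stretchMap (t : ℝ) (x y : idealTriangle Z) :
    hdist (stretchMap hZ hZ' t x).1 (stretchMap hZ hZ' t y).1 =
      Bary.hypDist (Bary.stretch t (hZ.baryHomeo.symm x)) (Bary.stretch t (hZ.baryHomeo.symm y)) :=
  hZ'.hdist_baryHomeo _ _

lemma isExpandingStretch_stretchMap {t : ℝ} (ht : 0 < t) :
    IsExpandingStretch (Real.exp t) (stretchMap hZ hZ' t) where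
  lipschitz x y := by
    rw [hdist_stretchMap, ← hZ.hypDist_baryHomeo_symm]
    exact Bary.hypDist_stretch_le ht.le _ _
  side i := by
    refine ⟨i, fun x => ?_, fun x y hx hy => ?_⟩
    · rw [hZ.mem_idealSide_iff, stretchMap, Homeomorph.trans_apply, Homeomorph.trans_apply,
        hZ'.baryHomeo_mem_idealSide, Bary.stretch_coord_eq_zero_iff]
    · obtain ⟨s, hs⟩ := Bary.coord_eq_zero_iff.1 (hZ.mem_idealSide_iff.1 hx)
      obtain ⟨s', hs'⟩ := Bary.coord_eq_zero_iff.1 (hZ.mem_idealSide_iff.1 hy)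
      rw [hdist_stretchMap, ← hZ.hypDist_baryHomeo_symm, hs, hs', Bary.stretch_side,
        Bary.stretch_side, Bary.hypDist_side, Bary.hypDist_side, ← mul_sub, abs_mul,
        abs_of_pos (Real.exp_pos t)]
  strict C hC hint := by
    obtain ⟨L, hL, h⟩ := Bary.exists_hypDist_stretch_le_of_isCompact ht
      (hC.image hZ.baryHomeo.symm.continuous) (by
        rintro _ ⟨x, hx, rfl⟩ k
        exact hZ.coord_pos_of_mem_idealInterior (hint x hx) k)
    refine ⟨L, hL, fun x hx y hy => ?_⟩
    rw [hdist_stretchMap, ← hZ.hypDist_baryHomeo_symm]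
    exact h _ (Set.mem_image_of_mem _ hx) _ (Set.mem_image_of_mem _ hy)

lemma stretchMap_symm (t : ℝ) : (stretchMap hZ hZ' t).symm = stretchMap hZ' hZ (-t) := by
  ext1 x
  change hZ.baryHomeo ((Bary.stretch t).symm _) = _
  rw [Bary.stretch_symm_apply]; rfl

theorem isStretchMap_stretchMap (t : ℝ) : IsStretchMap (Real.exp t) (stretchMap hZ hZ' t) := by
  rcases lt_trichotomy t 0 with ht | rfl | ht
  · refine Or.inr (Or.inr ⟨Real.exp_pos t, Real.exp_lt_one_iff.2 ht, ?_⟩)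
    rw [stretchMap_symm, ← Real.exp_neg]
    exact isExpandingStretch_stretchMap hZ' hZ (by linarith)
  · refine Or.inr (Or.inl ⟨Real.exp_zero, fun x y => ?_⟩)
    rw [hdist_stretchMap, Bary.stretch_zero, Bary.stretch_zero, hZ.hypDist_baryHomeo_symm]
  · exact Or.inl ⟨Real.one_lt_exp_iff.2 ht, isExpandingStretch_stretchMap hZ hZ' ht⟩

end

/-! ## Ideal triples -/

lemma idealTriangle_smul {Z : Fin 3 → Fin 3 → ℝ} {t : Fin 3 → ℝ} (ht : ∀ k, 0 < t k) :
    idealTriangle (fun k => t k • Z k) = idealTriangle Z := by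
  ext w
  constructor
  · rintro ⟨a, ha, h⟩
    exact ⟨fun k => a k * t k, fun k => mul_nonneg (ha k) (ht k).le, by simpa [mul_smul] using h⟩
  · rintro ⟨a, ha, h⟩
    refine ⟨fun k => a k / t k, fun k => div_nonneg (ha k) (ht k).le, ?_⟩
    rw [h]
    exact Finset.sum_congr rfl fun k _ => by rw [smul_smul, div_mul_cancel₀ _ (ht k).ne']

lemma idealSide_smul {Z : Fin 3 → Fin 3 → ℝ} {t : Fin 3 → ℝ} (ht : ∀ k, 0 < t k) (i : Fin 3) :
    idealSide (fun k => t k • Z k) i = idealSide Z i := by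
  ext w
  constructor
  · rintro ⟨a, ha, hi, h⟩
    exact ⟨fun k => a k * t k, fun k => mul_nonneg (ha k) (ht k).le, by simp [hi],
      by simpa [mul_smul] using h⟩
  · rintro ⟨a, ha, hi, h⟩
    refine ⟨fun k => a k / t k, fun k => div_nonneg (ha k) (ht k).le, by simp [hi], ?_⟩
    rw [h]
    exact Finset.sum_congr rfl fun k _ => by rw [smul_smul, div_mul_cancel₀ _ (ht k).ne']

lemma IsIdealTriple.mink_neg {r : Fin 3 → Fin 3 → ℝ} (hr : IsIdealTriple r) {i j : Fin 3}
    (hij : i ≠ j) : mink (r i) (r j) < 0 := by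
  refine mink_neg_of_linearIndependent (hr.1 i) (hr.1 j) ?_
  have := hr.2.comp ![i, j] (by
    intro a b; fin_cases a <;> fin_cases b <;> simp [hij, hij.symm])
  convert this using 1
  funext k; fin_cases k <;> rfl

/-- The equations `t i * t j * ⟨r i, r j⟩ = -2` are solved by `t 0 ^ 2 = 2 P / (Q S)` and its cyclic
analogues, where `P`, `Q`, `S` are the negated products opposite to the vertices `0`, `1`, `2`. -/
lemma IsIdealTriple.exists_normalized {r : Fin 3 → Fin 3 → ℝ} (hr : IsIdealTriple r) :
    ∃ t : Fin 3 → ℝ, (∀ k, 0 < t k) ∧ IsNormalized fun k => t k • r k := by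
  have aux : ∀ p q s : ℝ, 0 < p → 0 < q → 0 < s →
      √(2 * p / (q * s)) * √(2 * q / (s * p)) * s = 2 := by
    intro p q s hp hq hs
    rw [← Real.sqrt_mul (by positivity)]
    have : 2 * p / (q * s) * (2 * q / (s * p)) = (2 / s) ^ 2 := by field_simp
    rw [this, Real.sqrt_sq (by positivity), div_mul_cancel₀ _ hs.ne']
  have h0 : 0 < -mink (r 1) (r 2) := neg_pos.2 (hr.mink_neg (by decide))
  have h1 : 0 < -mink (r 2) (r 0) := neg_pos.2 (hr.mink_neg (by decide))
  have h2 : 0 < -mink (r 0) (r 1) := neg_pos.2 (hr.mink_neg (by decide))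
  obtain ⟨P, hP⟩ : ∃ P, P = -mink (r 1) (r 2) := ⟨_, rfl⟩
  obtain ⟨Q, hQ⟩ : ∃ Q, Q = -mink (r 2) (r 0) := ⟨_, rfl⟩
  obtain ⟨S, hS⟩ : ∃ S, S = -mink (r 0) (r 1) := ⟨_, rfl⟩
  rw [← hP] at h0
  rw [← hQ] at h1
  rw [← hS] at h2
  have ht : ∀ k, 0 < (![√(2 * P / (Q * S)), √(2 * Q / (S * P)), √(2 * S / (P * Q))] : Fin 3 → ℝ) k := by
    intro k; fin_cases k <;> simp <;> positivity
  refine ⟨_, ht, fun k => smul_mem_lightCone (ht k) (hr.1 k), fun i j hij => ?_⟩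
  have a1 := aux P Q S h0 h1 h2
  have a2 := aux Q S P h1 h2 h0
  have a3 := aux S P Q h2 h0 h1
  rw [mink_smul_left, mink_smul_right]
  have e1 := mink_comm (r 1) (r 2)
  have e2 := mink_comm (r 2) (r 0)
  have e3 := mink_comm (r 0) (r 1)
  fin_cases i <;> fin_cases j <;> simp at hij ⊢
  · rw [show mink (r 0) (r 1) = -S by linarith]; linarith
  · rw [show mink (r 0) (r 2) = -Q by linarith]; linarith
  · rw [show mink (r 1) (r 0) = -S by linarith]; linarith
  · rw [show mink (r 1) (r 2) = -P by linarith]; linarith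
  · rw [show mink (r 2) (r 0) = -Q by linarith]; linarith
  · rw [show mink (r 2) (r 1) = -P by linarith]; linarith

/-- Three positive numbers are determined by their pairwise products. -/
lemma eq_of_pairwise_mul_eq {s t : Fin 3 → ℝ} (hs : ∀ k, 0 < s k) (ht : ∀ k, 0 < t k)
    (h : ∀ i : Fin 3, s (i + 1) * s (i + 2) = t (i + 1) * t (i + 2)) (k : Fin 3) : s k = t k := by
  have e1 : k + 1 + 1 = k + 2 := by rw [add_assoc]; rfl
  have e2 : k + 1 + 2 = k := by rw [add_assoc]; simp
  have e3 : k + 2 + 1 = k := by rw [add_assoc]; simp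
  have e4 : k + 2 + 2 = k + 1 := by rw [add_assoc]; rfl
  have h0 := h k
  have h1 := h (k + 1)
  have h2 := h (k + 2)
  rw [e1, e2] at h1
  rw [e3, e4] at h2
  have p := mul_pos (ht (k + 1)) (ht (k + 2))
  have : s k ^ 2 * (t (k + 1) * t (k + 2)) = t k ^ 2 * (t (k + 1) * t (k + 2)) := by
    calc s k ^ 2 * (t (k + 1) * t (k + 2)) = (s (k + 2) * s k) * (s k * s (k + 1)) := by
          rw [← h0]; ring
      _ = _ := by rw [h1, h2]; ring
  exact (sq_eq_sq₀ (hs k).le (ht k).le).1 (mul_right_cancel₀ p.ne' this)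

/-! ## Unfolding an ideal triangle over a side -/

/-- The triple of the triangle glued along its side `j` to the side `i` of the triangle of `Z`,
where `log m` is the shift between the distinguished points of the sides. -/
def unfold (m : ℝ) (i j : Fin 3) (Z : Fin 3 → Fin 3 → ℝ) (k : Fin 3) : Fin 3 → ℝ :=
  if k = j then -Z i + (1 + m) • Z (i + 1) + (1 + m⁻¹) • Z (i + 2)
  else if k = j + 1 then m⁻¹ • Z (i + 2) else m • Z (i + 1)

section
variable (m : ℝ) (i j : Fin 3) (Z : Fin 3 → Fin 3 → ℝ)

lemma unfold_self : unfold m i j Z j =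
    -Z i + (1 + m) • Z (i + 1) + (1 + m⁻¹) • Z (i + 2) := if_pos rfl

lemma unfold_add_one : unfold m i j Z (j + 1) = m⁻¹ • Z (i + 2) := by
  have : j + 1 ≠ j := by fin_cases j <;> decide
  rw [unfold, if_neg this, if_pos rfl]

lemma unfold_add_two : unfold m i j Z (j + 2) = m • Z (i + 1) := by
  have h1 : j + 2 ≠ j := by fin_cases j <;> decide
  have h2 : j + 2 ≠ j + 1 := by fin_cases j <;> decide
  rw [unfold, if_neg h1, if_neg h2]

end

/-- Crossing a side and returning is the identity; this makes the transitions of the labels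
invertible. -/
lemma unfold_unfold {m : ℝ} (hm : m ≠ 0) (i j : Fin 3) (Z : Fin 3 → Fin 3 → ℝ) :
    unfold m j i (unfold m i j Z) = Z := by
  refine funext ((Fin.forall_cyclic i).2 ⟨?_, ?_, ?_⟩)
  · rw [unfold_self, unfold_self, unfold_add_one, unfold_add_two]
    funext k
    simp only [Pi.add_apply, Pi.neg_apply, Pi.smul_apply, smul_eq_mul]
    field_simp
    ring
  · rw [unfold_add_one, unfold_add_two, smul_smul, inv_mul_cancel₀ hm, one_smul]
  · rw [unfold_add_two, unfold_add_one, smul_smul, mul_inv_cancel₀ hm, one_smul]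

lemma IsNormalized.unfold {Z : Fin 3 → Fin 3 → ℝ} (hZ : IsNormalized Z) {m : ℝ} (hm : 0 < m)
    (i j : Fin 3) : IsNormalized (unfold m i j Z) := by
  have n0 : i ≠ i + 1 := by fin_cases i <;> decide
  have n1 : i ≠ i + 2 := by fin_cases i <;> decide
  have n2 : i + 1 ≠ i + 2 := by fin_cases i <;> decide
  have m0 := hm.ne'
  have h0 := (hZ.1 i).1
  have h1 := (hZ.1 (i + 1)).1
  have h2 := (hZ.1 (i + 2)).1
  have h01 := hZ.2 _ _ n0
  have h02 := hZ.2 _ _ n1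
  have h12 := hZ.2 _ _ n2
  have h10 := hZ.2 _ _ n0.symm
  have h20 := hZ.2 _ _ n1.symm
  have h21 := hZ.2 _ _ n2.symm
  have hneg : ∀ u v, mink (-u) v = -mink u v := fun u v => by
    rw [← neg_one_smul ℝ u, mink_smul_left]; ring
  have hneg' : ∀ u v, mink u (-v) = -mink u v := fun u v => by rw [mink_comm, hneg, mink_comm]
  have p1 := smul_mem_lightCone (inv_pos.2 hm) (hZ.1 (i + 2))
  have p2 := smul_mem_lightCone hm (hZ.1 (i + 1))
  have q01 : mink (_root_.unfold m i j Z j) (_root_.unfold m i j Z (j + 1)) = -2 := by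
    rw [unfold_self, unfold_add_one]
    simp only [mink_add_left, mink_smul_left, mink_smul_right, hneg, h02, h12, h2]
    field_simp; ring
  have q02 : mink (_root_.unfold m i j Z j) (_root_.unfold m i j Z (j + 2)) = -2 := by
    rw [unfold_self, unfold_add_two]
    simp only [mink_add_left, mink_smul_left, mink_smul_right, hneg, h01, h21, h1]
    field_simp; ring
  have q12 : mink (_root_.unfold m i j Z (j + 1)) (_root_.unfold m i j Z (j + 2)) = -2 := by
    rw [unfold_add_one, unfold_add_two]
    simp only [mink_smul_left, mink_smul_right, h21]
    field_simp
  have q00 : mink (_root_.unfold m i j Z j) (_root_.unfold m i j Z j) = 0 := by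
    rw [unfold_self]
    simp only [mink_add_left, mink_add_right, mink_smul_left, mink_smul_right, hneg, hneg', h0, h1,
      h2, h01, h02, h12, h10, h20, h21]
    field_simp; ring
  rw [← unfold_add_one m i j Z] at p1
  rw [← unfold_add_two m i j Z] at p2
  -- The new apex is null; its negative product with a vector of the positive cone puts it on the
  -- same half of the cone.
  have p0 : _root_.unfold m i j Z j ∈ lightCone :=
    mem_lightCone_of_mink_neg q00 p1 (by rw [q01]; norm_num)
  refine ⟨(Fin.forall_cyclic j).2 ⟨p0, p1, p2⟩, (Fin.forall_cyclic j).2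
    ⟨(Fin.forall_cyclic j).2 ⟨fun h => (h rfl).elim, fun _ => q01, fun _ => q02⟩,
    (Fin.forall_cyclic j).2 ⟨fun _ => by rw [mink_comm, q01], fun h => (h rfl).elim, fun _ => q12⟩,
    (Fin.forall_cyclic j).2 ⟨fun _ => by rw [mink_comm, q02], fun _ => by rw [mink_comm, q12],
      fun h => (h rfl).elim⟩⟩⟩

lemma det_unfold {Z : Fin 3 → Fin 3 → ℝ} (m : ℝ) (i j : Fin 3) :
    Matrix.det (Matrix.of ![Z (i + 1), Z (i + 2), unfold m i j Z j]) =
      -Matrix.det (Matrix.of ![Z (i + 1), Z (i + 2), Z i]) := by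
  rw [unfold_self, det_eq, det_eq]
  simp only [Pi.add_apply, Pi.neg_apply, Pi.smul_apply, smul_eq_mul]
  ring

lemma det_smul (a b c : ℝ) (u v w : Fin 3 → ℝ) :
    Matrix.det (Matrix.of ![a • u, b • v, c • w]) =
      a * b * c * Matrix.det (Matrix.of ![u, v, w]) := by
  rw [det_eq, det_eq]
  simp only [Pi.smul_apply, smul_eq_mul]
  ring

/-- Across the common side the coordinate of the opposite vertex changes its sign. -/
lemma coord_unfold (Z : Fin 3 → Fin 3 → ℝ) (m : ℝ) (i j : Fin 3) (w : Fin 3 → ℝ) :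
    coord (unfold m i j Z) w j = -coord Z w i := by
  have h2 : mink w (unfold m i j Z j) = -mink w (Z i) + (1 + m) * mink w (Z (i + 1))
      + (1 + m⁻¹) * mink w (Z (i + 2)) := by
    rw [unfold_self]
    simp only [mink, Pi.add_apply, Pi.neg_apply, Pi.smul_apply, smul_eq_mul]
    ring
  rw [coord, coord, h2, unfold_add_one, unfold_add_two, mink_smul_right, mink_smul_right]
  ring

/-! ## Sections of locally constant systems over a quotient -/

section
open Set

variable {S F ι X : Type*} [TopologicalSpace S] {π : S → F}

/-- Permutation-valued transition functions on an open saturated cover of a quotient space. -/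
structure TransitionSystem (π : S → F) (ι X : Type*) where
  dom : ι → Set S
  isOpen_dom : ∀ k, IsOpen (dom k)
  saturated : ∀ k r r', π r = π r' → r ∈ dom k → r' ∈ dom k
  exists_mem : ∀ r, ∃ k, r ∈ dom k
  perm : ι → S → Equiv.Perm X
  isOpen_perm : ∀ k e, IsOpen {r | r ∈ dom k ∧ perm k r = e}
  -- `perm k r` converts the label carried by the representative `r` into chart `k`. It may differ
  -- between representatives of one point, but the change of charts must not.
  compat : ∀ k l r r', π r = π r' → r ∈ dom k → r ∈ dom l →
    perm l r * (perm k r)⁻¹ = perm l r' * (perm k r')⁻¹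

namespace TransitionSystem

variable (A : TransitionSystem π ι X)

lemma isOpen_perm_perm (k l : ι) (P : Equiv.Perm X → Equiv.Perm X → Prop) :
    IsOpen {r | r ∈ A.dom k ∧ r ∈ A.dom l ∧ P (A.perm k r) (A.perm l r)} := by
  have : {r | r ∈ A.dom k ∧ r ∈ A.dom l ∧ P (A.perm k r) (A.perm l r)} =
      ⋃ (e : Equiv.Perm X) (e' : Equiv.Perm X) (_ : P e e'),
        {r | r ∈ A.dom k ∧ A.perm k r = e} ∩ {r | r ∈ A.dom l ∧ A.perm l r = e'} := by
    ext r
    simp only [mem_iUnion, mem_inter_iff, Set.mem_ofPred_eq]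
    constructor
    · rintro ⟨h1, h2, h3⟩
      exact ⟨_, _, h3, ⟨h1, rfl⟩, h2, rfl⟩
    · rintro ⟨e, e', h, ⟨h1, rfl⟩, h2, rfl⟩
      exact ⟨h1, h2, h⟩
  rw [this]
  exact isOpen_iUnion fun e => isOpen_iUnion fun e' => isOpen_iUnion fun _ =>
    (A.isOpen_perm k e).inter (A.isOpen_perm l e')

variable [TopologicalSpace F] (hπ : IsQuotientMap π)

/-- A representative of a point of the quotient. -/
def rep (b : F) : S := (hπ.surjective b).choose

lemma π_rep (b : F) : π (rep hπ b) = b := (hπ.surjective b).choose_spec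

/-- A chart about a point of the quotient. -/
def index (b : F) : ι := (A.exists_mem (rep hπ b)).choose

lemma mem_dom_index {r : S} {b : F} (h : π r = b) : r ∈ A.dom (A.index hπ b) :=
  A.saturated _ _ _ ((π_rep hπ b).trans h.symm) (A.exists_mem (rep hπ b)).choose_spec

variable [TopologicalSpace X] [DiscreteTopology X]

/-- The covering space of the quotient with fibre `X` that is defined by the transition functions. -/
def core : FiberBundleCore ι F X where
  baseSet k := {b | rep hπ b ∈ A.dom k}
  isOpen_baseSet k := by
    rw [← hπ.isOpen_preimage]
    convert A.isOpen_dom k using 1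
    ext r
    exact ⟨A.saturated k _ _ (π_rep hπ _), A.saturated k _ _ (π_rep hπ _).symm⟩
  indexAt := A.index hπ
  mem_baseSet_at b := A.mem_dom_index hπ (π_rep hπ b)
  coordChange k l b v := (A.perm l (rep hπ b) * (A.perm k (rep hπ b))⁻¹) v
  coordChange_self k b _ v := by simp
  continuousOn_coordChange k l := by
    rw [continuousOn_prod_of_discrete_right]
    intro v
    have hset : {b | (b, v) ∈ ({b | rep hπ b ∈ A.dom k} ∩ {b | rep hπ b ∈ A.dom l}) ×ˢ
        (univ : Set X)} = {b | rep hπ b ∈ A.dom k ∧ rep hπ b ∈ A.dom l} := by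
      ext b; simp
    rw [hset]
    intro b hb
    refine ContinuousAt.continuousWithinAt ?_
    rw [ContinuousAt, nhds_discrete X, Filter.tendsto_pure]
    have ho : IsOpen {b' | rep hπ b' ∈ A.dom k ∧ rep hπ b' ∈ A.dom l ∧
        (A.perm l (rep hπ b') * (A.perm k (rep hπ b'))⁻¹) v =
          (A.perm l (rep hπ b) * (A.perm k (rep hπ b))⁻¹) v} := by
      rw [← hπ.isOpen_preimage]
      convert A.isOpen_perm_perm k l (fun e e' => (e' * e⁻¹) v =
          (A.perm l (rep hπ b) * (A.perm k (rep hπ b))⁻¹) v) using 1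
      ext r
      have e := π_rep hπ (π r)
      constructor
      · rintro ⟨h1, h2, h3⟩
        refine ⟨A.saturated k _ _ e h1, A.saturated l _ _ e h2, ?_⟩
        rw [← A.compat k l _ _ e h1 h2]; exact h3
      · rintro ⟨h1, h2, h3⟩
        refine ⟨A.saturated k _ _ e.symm h1, A.saturated l _ _ e.symm h2, ?_⟩
        rw [← A.compat k l _ _ e.symm h1 h2]; exact h3
    exact Filter.mem_of_superset (ho.mem_nhds ⟨hb.1, hb.2, rfl⟩) fun b' h => h.2.2
  coordChange_comp i j k b _ v := by simp

variable {E : Type*} [TopologicalSpace E] [SimplyConnectedSpace E] [LocallyPathConnectedSpace E]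

/-- Parallel sections exist over simply connected spaces. -/
theorem exists_section {p : E → F} (hp : Continuous p) (e₀ : E) (v₀ : X) :
    ∃ q : E → X, q e₀ = v₀ ∧ ∀ {B : Type} [TopologicalSpace B] (f : B → S) (h : B → E),
      Continuous f → Continuous h → (∀ b, p (h b) = π (f b)) →
      IsLocallyConstant fun b => (A.perm (A.index hπ (p (h b))) (f b))⁻¹ (q (h b)) := by
  let Z := A.core hπ
  have hcov : IsCoveringMap Z.proj := FiberBundle.isCoveringMap (F := X) (E := Z.Fiber)
  -- The section is a lift of `p` to the covering space; its fibre component is the label in the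
  -- preferred chart of each point.
  obtain ⟨P, ⟨hP0, hP⟩, -⟩ := hcov.existsUnique_continuousMap_lifts ⟨p, hp⟩ e₀
    (⟨p e₀, v₀⟩ : Z.TotalSpace) rfl
  have hPp : ∀ e, (P e).1 = p e := fun e => congrFun hP e
  refine ⟨fun e => (P e).2, ?_, ?_⟩
  · change (P e₀).2 = v₀
    rw [hP0]
  intro B _ f h hf hh hfh
  rw [IsLocallyConstant.iff_eventually_eq]
  intro b
  let k := A.index hπ (p (h b))
  have hk : f b ∈ A.dom k := A.mem_dom_index hπ (hfh b).symm
  have hP1 : ∀ b', f b' ∈ A.dom k → (P (h b')) ∈ (Z.localTriv k).source := by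
    intro b' hb'
    rw [Z.mem_localTriv_source]
    change rep hπ (P (h b')).1 ∈ A.dom k
    rw [hPp]
    exact A.saturated k _ _ ((hfh b').symm.trans (π_rep hπ _).symm) hb'
  have hcont : ContinuousAt (fun b' => (Z.localTriv k (P (h b'))).2) b :=
    continuous_snd.continuousAt.comp
      (ContinuousAt.comp (f := fun b' => P (h b')) ((Z.localTriv k).continuousOn.continuousAt
        ((Z.localTriv k).open_source.mem_nhds (hP1 b hk))) (P.continuous.comp hh).continuousAt)
  rw [ContinuousAt, nhds_discrete X, Filter.tendsto_pure] at hcont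
  have hopen : IsOpen (f ⁻¹' {r | r ∈ A.dom k ∧ A.perm k r = A.perm k (f b)}) :=
    (A.isOpen_perm k _).preimage hf
  -- The preferred chart may jump near `b`, so labels are rewritten in the fixed chart `k`, where
  -- the lift and the permutations are locally constant.
  have key : ∀ b', f b' ∈ A.dom k →
      (A.perm (A.index hπ (p (h b'))) (f b'))⁻¹ (P (h b')).2 =
        (A.perm k (f b'))⁻¹ (Z.localTriv k (P (h b'))).2 := by
    intro b' hb'
    have e1 : (Z.localTriv k (P (h b'))).2 =
        (A.perm k (rep hπ (p (h b'))) * (A.perm (A.index hπ (p (h b'))) (rep hπ (p (h b'))))⁻¹)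
          (P (h b')).2 := by
      rw [Z.localTriv_apply, ← hPp]; rfl
    have er := (hfh b').symm.trans (π_rep hπ (p (h b'))).symm
    have hb2 := A.mem_dom_index hπ (hfh b').symm
    rw [e1, ← A.compat _ k _ _ er hb2 hb']
    exact ((Equiv.symm_apply_apply (A.perm k (f b')) _)).symm
  filter_upwards [hopen.mem_nhds ⟨hk, rfl⟩, hcont] with b' h1 h2
  rw [key b' h1.1, key b hk, h1.2, h2]

end TransitionSystem

end

/-! ## Topology of the ideal triangle -/

lemma IsLocalHomeomorph.locallyPathConnectedSpace {X Y : Type*} [TopologicalSpace X]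
    [TopologicalSpace Y] [LocallyPathConnectedSpace Y] {f : X → Y} (hf : IsLocalHomeomorph f) :
    LocallyPathConnectedSpace X := by
  refine ⟨fun x => Filter.hasBasis_self.2 fun u hu => ?_⟩
  obtain ⟨e, hx, -⟩ := hf x
  have h1 : e.symm ⁻¹' u ∩ e.target ∈ 𝓝 (e x) := by
    refine Filter.inter_mem ?_ (e.open_target.mem_nhds (e.map_source hx))
    have := e.symm.continuousAt (e.map_source hx)
    rw [ContinuousAt, e.left_inv hx] at this
    exact this hu
  obtain ⟨V, ⟨hV, hVp⟩, hVu⟩ := (LocallyPathConnectedSpace.path_connected_basis (e x)).mem_iff.1 h1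
  refine ⟨e.symm '' V, ?_, ?_, ?_⟩
  · have : e.symm '' V = e.source ∩ e ⁻¹' V := e.symm_image_eq_source_inter_preimage
      fun y hy => (hVu hy).2
    rw [this]
    exact Filter.inter_mem (e.open_source.mem_nhds hx) (e.continuousAt hx hV)
  · exact hVp.image' (e.symm.continuousOn.mono fun y hy => (hVu hy).2)
  · rintro _ ⟨y, hy, rfl⟩
    exact (hVu hy).1

/-- Affine model of an ideal triangle: a triangle without its vertices. -/
def affineTriangle : Set (Fin 3 → ℝ) :=
  {b | (∀ k, 0 ≤ b k) ∧ (∀ k, b k < 1) ∧ b 0 + b 1 + b 2 = 1}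

lemma convex_affineTriangle : Convex ℝ affineTriangle := by
  rintro x ⟨hx1, hx2, hx3⟩ y ⟨hy1, hy2, hy3⟩ a b ha hb hab
  simp only [affineTriangle, Set.mem_ofPred_eq, Pi.add_apply, Pi.smul_apply, smul_eq_mul]
  refine ⟨fun k => add_nonneg (mul_nonneg ha (hx1 k)) (mul_nonneg hb (hy1 k)), fun k => ?_, ?_⟩
  · have h1 := hx2 k
    have h2 := hy2 k
    rcases ha.lt_or_eq with h | h
    · nlinarith
    · have : b = 1 := by linarith
      rw [← h, this]; linarith
  · linear_combination a * hx3 + b * hy3 + hab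

lemma affineTriangle_pos (b : affineTriangle) :
    0 < b.1 0 * b.1 1 + b.1 1 * b.1 2 + b.1 2 * b.1 0 := by
  obtain ⟨b, h1, h2, h3⟩ := b
  have h : b 0 * b 1 + b 1 * b 2 + b 2 * b 0 =
    b 0 * (1 - b 0) + b 1 * b 2 := by linear_combination (b 0) * h3
  change 0 < b 0 * b 1 + b 1 * b 2 + b 2 * b 0
  rcases (h1 0).lt_or_eq with h0 | h0
  · rw [h]
    have := mul_pos h0 (sub_pos.2 (h2 0))
    have := mul_nonneg (h1 1) (h1 2)
    linarith
  · rw [h, ← h0]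
    have e1 : 0 < b 1 := by linarith [h2 2]
    have e2 : 0 < b 2 := by linarith [h2 1]
    have := mul_pos e1 e2
    linarith

lemma Bary.sum_pos (a : Bary) : 0 < a.1 0 + a.1 1 + a.1 2 := by
  have h1 := a.size_pos 0
  have h2 := a.nonneg 0
  simp only [Bary.size, zero_add] at h1
  linarith

/-- Radial projection. -/
def Bary.homeoAffine : Bary ≃ₜ affineTriangle where
  toFun a := ⟨fun k => a.1 k / (a.1 0 + a.1 1 + a.1 2),
    fun k => div_nonneg (a.nonneg k) a.sum_pos.le,
    fun k => by
      rw [div_lt_one a.sum_pos]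
      have := a.size_pos k
      have h : a.1 0 + a.1 1 + a.1 2 = a.1 k + Bary.size k a := by
        fin_cases k <;> simp [Bary.size, Fin.reduceAdd] <;> ring
      linarith,
    by have := a.sum_pos.ne'; field_simp⟩
  invFun b := ⟨fun k => b.1 k / (2 * √(b.1 0 * b.1 1 + b.1 1 * b.1 2 + b.1 2 * b.1 0)),
    fun k => div_nonneg (b.2.1 k) (by positivity), by
      have h := affineTriangle_pos b
      have h1 := Real.sq_sqrt h.le
      have h2 := (Real.sqrt_pos.2 h).ne'
      generalize √(b.1 0 * b.1 1 + b.1 1 * b.1 2 + b.1 2 * b.1 0) = s at h1 h2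
      field_simp
      rw [h1]; ring⟩
  left_inv a := by
    refine Subtype.ext (funext fun k => ?_)
    have hs := a.sum_pos
    have e : a.1 0 / (a.1 0 + a.1 1 + a.1 2) * (a.1 1 / (a.1 0 + a.1 1 + a.1 2))
        + a.1 1 / (a.1 0 + a.1 1 + a.1 2) * (a.1 2 / (a.1 0 + a.1 1 + a.1 2))
        + a.1 2 / (a.1 0 + a.1 1 + a.1 2) * (a.1 0 / (a.1 0 + a.1 1 + a.1 2))
        = (1 / (2 * (a.1 0 + a.1 1 + a.1 2))) ^ 2 := by
      have := a.2.2
      field_simp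
      linarith
    simp only
    rw [e, Real.sqrt_sq (by positivity)]
    field_simp
  right_inv b := by
    refine Subtype.ext (funext fun k => ?_)
    have h := (Real.sqrt_pos.2 (affineTriangle_pos b)).ne'
    have h3 := b.2.2.2
    simp only
    rw [← add_div, ← add_div, h3]
    generalize √_ = s at h
    field_simp
  continuous_toFun := by
    refine Continuous.subtype_mk (continuous_pi fun k => ?_) _
    exact (Bary.continuous_coord k).div (((Bary.continuous_coord 0).add
      (Bary.continuous_coord 1)).add (Bary.continuous_coord 2)) fun a => a.sum_pos.ne'
  continuous_invFun := by
    refine Continuous.subtype_mk (continuous_pi fun k => ?_) _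
    have hc : ∀ j, Continuous fun b : affineTriangle => b.1 j := fun j =>
      (continuous_apply j).comp continuous_subtype_val
    refine Continuous.div (hc k) (continuous_const.mul ((((hc 0).mul (hc 1)).add
      ((hc 1).mul (hc 2))).add ((hc 2).mul (hc 0))).sqrt) fun b => ?_
    have := Real.sqrt_pos.2 (affineTriangle_pos b)
    positivity

/-- The affine model of the standard ideal triangle. -/
def stdAffine : StdTriangle ≃ₜ affineTriangle := stdBary.trans Bary.homeoAffine

/-- Together with local path connectedness, this is what lets charts of faces lift to the covering.
Both come from convexity of the affine model. -/
instance : ContractibleSpace StdTriangle := by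
  have : ContractibleSpace affineTriangle :=
    convex_affineTriangle.contractibleSpace ⟨stdAffine (sidePoint 0 0), (stdAffine (sidePoint 0 0)).2⟩
  exact stdAffine.contractibleSpace

instance : LocallyPathConnectedSpace StdTriangle := by
  have : LocallyPathConnectedSpace affineTriangle := convex_affineTriangle.locallyPathConnectedSpace
  exact stdAffine.isLocalHomeomorph.locallyPathConnectedSpace

lemma continuous_sidePoint (i : Fin 3) : Continuous (sidePoint i) := by
  refine Continuous.subtype_mk (Continuous.subtype_mk ?_ _) _
  unfold sideVec
  fun_prop

/-! ## Lifted triangles -/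

namespace GluingData

variable (G : GluingData)

/-- The gluing map of the side `x`, in the arclength parameters. -/
def glue (x : G.Face × Fin 3) (s : ℝ) : ℝ := -(G.scale x * s + G.shift x)

lemma glue_pair_glue (x : G.Face × Fin 3) (s : ℝ) : G.glue (G.pair x) (G.glue x s) = s := by
  have h1 := G.scale_pair x
  have h2 := G.shift_pair x
  have h3 := (G.scale_pos x).ne'
  rw [glue, glue]
  have : G.shift (G.pair x) = G.shift x * G.scale (G.pair x) := by
    rw [← h2, mul_assoc, mul_comm (G.scale x), h1, mul_one]
  linear_combination s * h1 - this

lemma glue_glue_pair (x : G.Face × Fin 3) (s : ℝ) : G.glue x (G.glue (G.pair x) s) = s := by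
  have := G.glue_pair_glue (G.pair x) s
  rwa [G.pair_pair] at this

lemma continuous_glue (x : G.Face × Fin 3) : Continuous (G.glue x) := by
  unfold glue; fun_prop

end GluingData

section
variable {E F : Type*} [TopologicalSpace E] [TopologicalSpace F] {H : BrokenHyperbolicStructure F}
  {p : E → F}

lemma BrokenHyperbolicStructure.continuous_chart (H : BrokenHyperbolicStructure F) (f : H.Face) :
    Continuous (H.chart f) :=
  H.isQuotientMap_chart.continuous.comp (continuous_sigmaMk (σ := fun _ : H.Face => StdTriangle)
    (i := f))

lemma BrokenHyperbolicStructure.locallyPathConnectedSpace (H : BrokenHyperbolicStructure F) :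
    LocallyPathConnectedSpace F := H.isQuotientMap_chart.locallyPathConnectedSpace

lemma BrokenHyperbolicStructure.chart_sidePoint (H : BrokenHyperbolicStructure F) {f g : H.Face}
    {i j : Fin 3} (h : H.pair (f, i) = (g, j)) (s : ℝ) :
    H.chart f (sidePoint i s) = H.chart g (sidePoint j (H.glue (f, i) s)) :=
  (H.chart_eq_iff _ _ _ _).2 (Or.inr ⟨i, j, s, h, rfl, rfl⟩)

namespace LiftedFace

section
variable {T T' T'' : LiftedFace H p} {i j k l : Fin 3}

lemma Adj.symm (h : T.Adj i T' j) : T'.Adj j T i := by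
  have h1 : H.pair (T'.face, j) = (T.face, i) := by rw [← h.1, H.pair_pair]
  refine ⟨h1, fun s => ?_⟩
  have h2 := h.2 (H.glue (T'.face, j) s)
  have e := H.glue_glue_pair (T.face, i) s
  rw [h.1] at e
  change _ = T'.lift (sidePoint j (H.glue (T.face, i) (H.glue (T'.face, j) s))) at h2
  rw [e] at h2
  exact h2.symm

lemma Adj.lift_eq (h : T.Adj i T' j) (s : ℝ) :
    T.lift (sidePoint i s) = T'.lift (sidePoint j (H.glue (T.face, i) s)) := h.2 s

end

variable (hp : IsCoveringMap p)
include hp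

lemma exists_lift (f : H.Face) (y : StdTriangle) (e : E) (h : p e = H.chart f y) :
    ∃ T : LiftedFace H p, T.face = f ∧ T.lift y = e := by
  obtain ⟨L, ⟨h1, h2⟩, -⟩ := hp.existsUnique_continuousMap_lifts
    ⟨H.chart f, H.continuous_chart f⟩ y e h
  exact ⟨⟨f, L, L.continuous, fun x => congrFun h2 x⟩, rfl, h1⟩

lemma exists_lift_eq (e : E) : ∃ (T : LiftedFace H p) (y : StdTriangle), T.lift y = e := by
  obtain ⟨⟨f, y⟩, h⟩ := H.isQuotientMap_chart.surjective (p e)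
  obtain ⟨T, -, hT⟩ := exists_lift hp f y e h.symm
  exact ⟨T, y, hT⟩

lemma ext_of_lift_eq {T T' : LiftedFace H p} (hf : T.face = T'.face) {y : StdTriangle}
    (h : T.lift y = T'.lift y) : T = T' := by
  have : T.lift = T'.lift := hp.eq_of_comp_eq T.continuous_lift T'.continuous_lift
    (funext fun x => by simp [T.lift_spec, T'.lift_spec, hf]) y h
  cases T
  cases T'
  simp_all

lemma adj_of_lift_eq {T T' : LiftedFace H p} {i j : Fin 3}
    (hpair : H.pair (T.face, i) = (T'.face, j)) {s : ℝ}
    (h : T.lift (sidePoint i s) = T'.lift (sidePoint j (H.glue (T.face, i) s))) :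
    T.Adj i T' j := by
  refine ⟨hpair, fun t => ?_⟩
  have := hp.eq_of_comp_eq (T.continuous_lift.comp (continuous_sidePoint i))
    (T'.continuous_lift.comp ((continuous_sidePoint j).comp (H.continuous_glue (T.face, i))))
    (funext fun t => by
      simp only [Function.comp_apply, T.lift_spec, T'.lift_spec]
      exact H.chart_sidePoint hpair t) s h
  exact congrFun this t

lemma exists_adj (T : LiftedFace H p) (i : Fin 3) : ∃ T' j, T.Adj i T' j := by
  obtain ⟨⟨g, j⟩, hx⟩ : ∃ x, H.pair (T.face, i) = x := ⟨_, rfl⟩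
  obtain ⟨T', rfl, hT'⟩ := exists_lift hp g (sidePoint j (H.glue (T.face, i) 0))
    (T.lift (sidePoint i 0)) (by rw [T.lift_spec]; exact H.chart_sidePoint hx 0)
  exact ⟨T', j, adj_of_lift_eq hp hx hT'.symm⟩

lemma Adj.unique {T T' T'' : LiftedFace H p} {i j k : Fin 3} (h : T.Adj i T' j)
    (h' : T.Adj i T'' k) : T' = T'' ∧ j = k := by
  have e := h.1.symm.trans h'.1
  simp only [Prod.mk.injEq] at e
  obtain ⟨e1, rfl⟩ := e
  exact ⟨ext_of_lift_eq hp e1 ((h.lift_eq 0).symm.trans (h'.lift_eq 0)), rfl⟩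

lemma lift_eq_lift {T T' : LiftedFace H p} {y y' : StdTriangle} (h : T.lift y = T'.lift y') :
    (T = T' ∧ y = y') ∨ ∃ i j s, T.Adj i T' j ∧ y = sidePoint i s ∧
      y' = sidePoint j (H.glue (T.face, i) s) := by
  have h1 := congrArg p h
  rw [T.lift_spec, T'.lift_spec, H.chart_eq_iff] at h1
  rcases h1 with ⟨h1, rfl⟩ | ⟨i, j, s, h1, rfl, rfl⟩
  · exact Or.inl ⟨ext_of_lift_eq hp h1 h, rfl⟩
  · exact Or.inr ⟨i, j, s, adj_of_lift_eq hp h1 h, rfl, rfl⟩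

/-- The topology of `E` is coherent with the lifted triangles: on a sheet of the local homeomorphism
`p`, openness can be tested in `F`, which carries the quotient topology of the charts, and every
chart through a point below lifts through the point above. -/
lemma isOpen_iff {U : Set E} : IsOpen U ↔ ∀ T : LiftedFace H p, IsOpen (T.lift ⁻¹' U) := by
  refine ⟨fun h T => h.preimage T.continuous_lift, fun h => ?_⟩
  rw [isOpen_iff_mem_nhds]
  intro e he
  obtain ⟨φ, heφ, rfl⟩ := hp.isLocalHomeomorph e
  have h1 : IsOpen (φ '' (U ∩ φ.source)) := by
    rw [← H.isQuotientMap_chart.isOpen_preimage, isOpen_sigma_iff]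
    intro f
    rw [isOpen_iff_mem_nhds]
    rintro y ⟨e', he', hy⟩
    obtain ⟨T, rfl, hT⟩ := exists_lift hp f y e' hy
    have h2 : T.lift ⁻¹' (U ∩ φ.source) ∈ 𝓝 y :=
      ((h T).inter (φ.open_source.preimage T.continuous_lift)).mem_nhds
        (by rw [Set.mem_inter_iff, Set.mem_preimage, Set.mem_preimage, hT]; exact he')
    refine Filter.mem_of_superset h2 fun x hx => ⟨T.lift x, hx, T.lift_spec x⟩
  have h2 : φ ⁻¹' (φ '' (U ∩ φ.source)) ∩ φ.source ∈ 𝓝 e :=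
    Filter.inter_mem ((φ.continuousAt heφ) (h1.mem_nhds ⟨e, ⟨he, heφ⟩, rfl⟩))
      (φ.open_source.mem_nhds heφ)
  refine Filter.mem_of_superset h2 ?_
  rintro x ⟨⟨x', ⟨hx', hx's⟩, hxx'⟩, hxs⟩
  rwa [← φ.injOn hx's hxs hxx']

lemma continuous_of_comp_lift {Y : Type*} [TopologicalSpace Y] {D : E → Y}
    (h : ∀ T : LiftedFace H p, Continuous fun y => D (T.lift y)) : Continuous D :=
  ⟨fun _ hO => (isOpen_iff hp).2 fun T => hO.preimage (h T)⟩

/-- Maps on the lifted triangles that agree on common sides glue to a map on the covering space. -/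
lemma exists_glued {Y : Type*} [TopologicalSpace Y] (A : LiftedFace H p → StdTriangle → Y)
    (hA : ∀ T, Continuous (A T)) (hadj : ∀ T i T' j, T.Adj i T' j → ∀ s,
      A T (sidePoint i s) = A T' (sidePoint j (H.glue (T.face, i) s))) :
    ∃ D : E → Y, Continuous D ∧ ∀ T y, D (T.lift y) = A T y := by
  choose T y h using exists_lift_eq (H := H) hp
  have key : ∀ T' y', A (T (T'.lift y')) (y (T'.lift y')) = A T' y' := by
    intro T' y'
    rcases lift_eq_lift hp (h (T'.lift y')) with ⟨h1, h2⟩ | ⟨i, j, s, h1, h2, h3⟩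
    · rw [h1, h2]
    · exact (congrArg (A _) h2).trans ((hadj _ _ _ _ h1 s).trans (congrArg (A T') h3).symm)
  refine ⟨fun e => A (T e) (y e), continuous_of_comp_lift (H := H) hp fun T' => ?_, key⟩
  simp only [key]
  exact hA T'

/-- Any two lifted triangles are connected by a chain of adjacent ones. -/
theorem induction_adj [PreconnectedSpace E] {P : LiftedFace H p → Prop} {T₀ : LiftedFace H p}
    (h₀ : P T₀) (hadj : ∀ T i T' j, T.Adj i T' j → P T → P T') (T : LiftedFace H p) : P T := by
  -- The union of the triangles with property `P`. Its preimage in each triangle is everything or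
  -- empty, so it is clopen.
  let O : Set E := {e | ∃ (T : LiftedFace H p) (y : StdTriangle), P T ∧ T.lift y = e}
  have hO : ∀ (T : LiftedFace H p) y, T.lift y ∈ O → P T := by
    rintro T y ⟨T', y', h1, h2⟩
    rcases lift_eq_lift hp h2 with ⟨rfl, -⟩ | ⟨i, j, s, h3, -, -⟩
    · exact h1
    · exact hadj _ _ _ _ h3 h1
  have h1 : IsClopen O := by
    constructor
    · rw [← isOpen_compl_iff, isOpen_iff hp]
      intro T
      by_cases hT : P T
      · convert isOpen_empty
        refine Set.eq_empty_of_forall_notMem fun y hy => hy ⟨T, y, hT, rfl⟩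
      · convert isOpen_univ
        exact Set.eq_univ_of_forall fun y hy => hT (hO T y hy)
    · rw [isOpen_iff hp]
      intro T
      by_cases hT : P T
      · convert isOpen_univ
        exact Set.eq_univ_of_forall fun y => ⟨T, y, hT, rfl⟩
      · convert isOpen_empty
        exact Set.eq_empty_of_forall_notMem fun y hy => hT (hO T y hy)
  have h2 := h1.eq_univ ⟨_, T₀, sidePoint 0 0, h₀, rfl⟩
  exact hO T (sidePoint 0 0) (by rw [h2]; trivial)

end LiftedFace

/-! ### Labels of the lifted triangles -/

/-- The points of the standard triangle that are nearest to the side `i`. -/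
def collar (i : Fin 3) : Set StdTriangle :=
  {y | (stdBary y).1 i < (stdBary y).1 (i + 1) ∧ (stdBary y).1 i < (stdBary y).1 (i + 2)}

lemma continuous_stdBary_coord (k : Fin 3) : Continuous fun y => (stdBary y).1 k :=
  (Bary.continuous_coord k).comp stdBary.continuous

lemma isOpen_collar (i : Fin 3) : IsOpen (collar i) :=
  (isOpen_lt (continuous_stdBary_coord _) (continuous_stdBary_coord _)).inter
    (isOpen_lt (continuous_stdBary_coord _) (continuous_stdBary_coord _))

lemma eq_of_mem_collar {i j : Fin 3} {y : StdTriangle} (hi : y ∈ collar i) (hj : y ∈ collar j) :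
    i = j := by
  obtain ⟨h1, h2⟩ := hi
  obtain ⟨h3, h4⟩ := hj
  by_contra hne
  have : j = i + 1 ∨ j = i + 2 := by revert hne; fin_cases i <;> fin_cases j <;> decide
  rcases this with rfl | rfl
  · have e : i + 1 + 2 = i := by rw [add_assoc]; simp
    rw [e] at h4; linarith
  · have e : i + 2 + 1 = i := by rw [add_assoc]; simp
    rw [e] at h3; linarith

lemma sidePoint_mem_collar (i : Fin 3) (s : ℝ) : sidePoint i s ∈ collar i := by
  have h1 := Real.exp_pos s
  have h2 := Real.exp_pos (-s)
  constructor
  · rw [stdBary_sidePoint, Bary.side_self, Bary.side_add_one]; positivity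
  · rw [stdBary_sidePoint, Bary.side_self, Bary.side_add_two]; positivity

lemma exists_eq_sidePoint {i : Fin 3} {y : StdTriangle} (h : (stdBary y).1 i = 0) :
    ∃ s, y = sidePoint i s := by
  obtain ⟨s, hs⟩ := Bary.coord_eq_zero_iff.1 h
  exact ⟨s, by rw [← stdBary_symm_side, ← hs, Homeomorph.symm_apply_apply]⟩

/-- The points of the triangles nearest to the triangle-edge pair `x`. -/
def sideCollar (H : BrokenHyperbolicStructure F) (x : H.Face × Fin 3) :
    Set (Σ _ : H.Face, StdTriangle) := {r | r.1 = x.1 ∧ r.2 ∈ collar x.2}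

lemma isOpen_sideCollar (x : H.Face × Fin 3) : IsOpen (sideCollar H x) := by
  rw [isOpen_sigma_iff]
  intro f
  by_cases h : f = x.1
  · convert isOpen_collar x.2 using 1
    ext y; exact ⟨fun hy => hy.2, fun hy => ⟨h, hy⟩⟩
  · convert isOpen_empty
    exact Set.eq_empty_of_forall_notMem fun y hy => h hy.1

lemma eq_of_mem_sideCollar {x y : H.Face × Fin 3} {r : Σ _ : H.Face, StdTriangle}
    (hx : r ∈ sideCollar H x) (hy : r ∈ sideCollar H y) : x = y :=
  Prod.ext (hx.1.symm.trans hy.1) (eq_of_mem_collar hx.2 hy.2)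

lemma sidePoint_mem_sideCollar (f : H.Face) (i : Fin 3) (s : ℝ) :
    (⟨f, sidePoint i s⟩ : Σ _ : H.Face, StdTriangle) ∈ sideCollar H (f, i) :=
  ⟨rfl, sidePoint_mem_collar i s⟩

/-- Open saturated sets of the disjoint union of the triangles: the interiors of the triangles, and
the neighbourhoods of the edges. -/
def labelDom (H : BrokenHyperbolicStructure F) :
    Option (H.Face × Fin 3) → Set (Σ _ : H.Face, StdTriangle)
  | none => {r | ∀ k, 0 < (stdBary r.2).1 k}
  | some x => sideCollar H x ∪ sideCollar H (H.pair x)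

lemma isOpen_labelDom : ∀ k, IsOpen (labelDom H k)
  | none => by
    rw [isOpen_sigma_iff]
    intro f
    have : Sigma.mk f ⁻¹' labelDom H none = ⋂ k, {y : StdTriangle | 0 < (stdBary y).1 k} := by
      ext y; simp [labelDom]
    rw [this]
    exact isOpen_iInter_of_finite fun k => isOpen_lt continuous_const (continuous_stdBary_coord k)
  | some _ => (isOpen_sideCollar _).union (isOpen_sideCollar _)

lemma notMem_labelDom_none (f : H.Face) (i : Fin 3) (s : ℝ) :
    (⟨f, sidePoint i s⟩ : Σ _ : H.Face, StdTriangle) ∉ labelDom H none := by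
  intro h
  have := h i
  simp only [stdBary_sidePoint, Bary.side_self] at this
  exact lt_irrefl _ this

lemma labelDom_saturated (k : Option (H.Face × Fin 3)) (r r' : Σ _ : H.Face, StdTriangle)
    (h : H.chart r.1 r.2 = H.chart r'.1 r'.2) (hr : r ∈ labelDom H k) : r' ∈ labelDom H k := by
  obtain ⟨f, y⟩ := r
  obtain ⟨f', y'⟩ := r'
  rcases (H.chart_eq_iff _ _ _ _).1 h with ⟨h1, h2⟩ | ⟨i, j, s, h1, h2, h3⟩
  · dsimp only at h1 h2
    subst h1 h2
    exact hr
  dsimp only at h1 h2 h3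
  subst h2 h3
  cases k with
  | none => exact absurd hr (notMem_labelDom_none f i s)
  | some x =>
    have h4 := sidePoint_mem_sideCollar (H := H) f' j (H.glue (f, i) s)
    rcases hr with hr | hr
    · right
      rw [eq_of_mem_sideCollar hr (sidePoint_mem_sideCollar f i s), h1]
      exact h4
    · left
      rw [← H.pair_pair x, eq_of_mem_sideCollar hr (sidePoint_mem_sideCollar f i s), h1]
      exact h4

lemma exists_mem_labelDom (r : Σ _ : H.Face, StdTriangle) : ∃ k, r ∈ labelDom H k := by
  obtain ⟨f, y⟩ := r
  by_cases h : ∀ k, 0 < (stdBary y).1 k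
  · exact ⟨none, h⟩
  · push Not at h
    obtain ⟨i, hi⟩ := h
    obtain ⟨s, rfl⟩ := exists_eq_sidePoint (le_antisymm hi ((stdBary y).nonneg i))
    exact ⟨some (f, i), Or.inl (sidePoint_mem_sideCollar f i s)⟩

section
variable {X : Type*} (g : H.Face × Fin 3 → Equiv.Perm X)

open Classical in
/-- Labels near an edge are compared with those on one of its sides. -/
def labelPerm : Option (H.Face × Fin 3) → (Σ _ : H.Face, StdTriangle) → Equiv.Perm X
  | none, _ => 1
  | some x, r => if r ∈ sideCollar H x then 1 else g (H.pair x)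

lemma isOpen_labelPerm (k : Option (H.Face × Fin 3)) (e : Equiv.Perm X) :
    IsOpen {r | r ∈ labelDom H k ∧ labelPerm g k r = e} := by
  cases k with
  | none =>
    by_cases h : (1 : Equiv.Perm X) = e
    · simpa [labelPerm, h] using isOpen_labelDom none
    · simp [labelPerm, h]
  | some x =>
    have : {r | r ∈ labelDom H (some x) ∧ labelPerm g (some x) r = e} =
        {r | r ∈ sideCollar H x ∧ 1 = e} ∪ {r | r ∈ sideCollar H (H.pair x) ∧ g (H.pair x) = e} := by
      ext r
      constructor
      · rintro ⟨h1, h2⟩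
        by_cases h : r ∈ sideCollar H x
        · exact Or.inl ⟨h, by rw [← h2]; exact (if_pos h).symm⟩
        · exact Or.inr ⟨h1.resolve_left h, by rw [← h2]; exact (if_neg h).symm⟩
      · rintro (⟨h1, h2⟩ | ⟨h1, h2⟩)
        · exact ⟨Or.inl h1, (if_pos h1).trans h2⟩
        · have h : r ∉ sideCollar H x := fun h => H.pair_ne x (eq_of_mem_sideCollar h1 h)
          exact ⟨Or.inr h1, (if_neg h).trans h2⟩
    rw [this]
    have haux : ∀ (x : H.Face × Fin 3) (P : Prop), IsOpen {r | r ∈ sideCollar H x ∧ P} := by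
      intro x P
      by_cases h : P
      · simpa [h] using isOpen_sideCollar x
      · simp [h]
    exact (haux _ _).union (haux _ _)

variable (hg : ∀ x, g (H.pair x) * g x = 1)
include hg

/-- A point of an edge lies in no interior chart. In an edge chart one of the two faces serves as
reference: if it is the face being left, `hg` cancels the transition there and back; otherwise both
sides equal `g (f, i)`. -/
lemma labelPerm_glue {f f' : H.Face} {i j : Fin 3} (h : H.pair (f, i) = (f', j)) (s : ℝ)
    {k : Option (H.Face × Fin 3)} (hk : ⟨f, sidePoint i s⟩ ∈ labelDom H k) :
    labelPerm g k ⟨f, sidePoint i s⟩ =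
      labelPerm g k ⟨f', sidePoint j (H.glue (f, i) s)⟩ * g (f, i) := by
  have h1 := sidePoint_mem_sideCollar (H := H) f i s
  have h2 := sidePoint_mem_sideCollar (H := H) f' j (H.glue (f, i) s)
  cases k with
  | none => exact absurd hk (notMem_labelDom_none f i s)
  | some x =>
    rcases hk with hk | hk
    · have hx := eq_of_mem_sideCollar hk h1
      subst hx
      have h3 : (⟨f', sidePoint j (H.glue (f, i) s)⟩ : Σ _ : H.Face, StdTriangle) ∉
          sideCollar H (f, i) := fun h' =>
        H.pair_ne (f, i) (h.trans (eq_of_mem_sideCollar h2 h'))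
      simp only [labelPerm, if_pos h1, if_neg h3, hg]
    · have hx := eq_of_mem_sideCollar hk h1
      have hx' : x = (f', j) := by rw [← H.pair_pair x, hx, h]
      subst hx'
      have h3 : (⟨f, sidePoint i s⟩ : Σ _ : H.Face, StdTriangle) ∉
          sideCollar H (f', j) := fun h' =>
        H.pair_ne (f', j) (hx.trans (eq_of_mem_sideCollar h1 h'))
      simp only [labelPerm, if_pos h2, if_neg h3, hx, one_mul]

/-- Transport of labels: `g x` is the transition across the side `x`. -/
def labelSystem : TransitionSystem (fun r : (Σ _ : H.Face, StdTriangle) => H.chart r.1 r.2)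
      (Option (H.Face × Fin 3)) X where
  dom := labelDom H
  isOpen_dom := isOpen_labelDom
  saturated := labelDom_saturated
  exists_mem := exists_mem_labelDom
  perm := labelPerm g
  isOpen_perm := isOpen_labelPerm g
  compat k l r r' h hk hl := by
    obtain ⟨f, y⟩ := r
    obtain ⟨f', y'⟩ := r'
    rcases (H.chart_eq_iff _ _ _ _).1 h with ⟨h1, h2⟩ | ⟨i, j, s, h1, h2, h3⟩
    · dsimp only at h1 h2
      subst h1 h2
      rfl
    dsimp only at h1 h2 h3
    subst h2 h3
    rw [labelPerm_glue g hg h1 s hk, labelPerm_glue g hg h1 s hl]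
    change _ = labelPerm g l ⟨f', sidePoint j (H.glue (f, i) s)⟩ *
      (labelPerm g k ⟨f', sidePoint j (H.glue (f, i) s)⟩)⁻¹
    group

/-- The lifted triangles can be labelled with prescribed transitions across their sides. -/
theorem exists_labelling [SimplyConnectedSpace E] (hp : IsCoveringMap p) (T₀ : LiftedFace H p)
    (x₀ : X) : ∃ l : LiftedFace H p → X, l T₀ = x₀ ∧
      ∀ T i T' j, T.Adj i T' j → l T' = g (T.face, i) (l T) := by
  have := H.locallyPathConnectedSpace
  have : LocallyPathConnectedSpace E := hp.isLocalHomeomorph.locallyPathConnectedSpace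
  let _ : TopologicalSpace X := ⊥
  have : DiscreteTopology X := ⟨rfl⟩
  let A := labelSystem g hg
  have hπ := H.isQuotientMap_chart
  let y₀ := sidePoint 0 0
  obtain ⟨q, hq0, hq⟩ := A.exists_section hπ hp.continuous (T₀.lift y₀)
    (A.perm (A.index hπ (p (T₀.lift y₀))) ⟨T₀.face, y₀⟩ x₀)
  let l : LiftedFace H p → StdTriangle → X := fun T y =>
    (A.perm (A.index hπ (p (T.lift y))) ⟨T.face, y⟩)⁻¹ (q (T.lift y))
  -- The triangle is connected, so its locally constant label does not depend on the point where it
  -- is read.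
  have hl : ∀ T y y', l T y = l T y' := fun T y y' =>
    (hq (fun y => (⟨T.face, y⟩ : Σ _ : H.Face, StdTriangle)) T.lift
      (continuous_sigmaMk (σ := fun _ : H.Face => StdTriangle)) T.continuous_lift
      T.lift_spec).apply_eq_of_preconnectedSpace y y'
  refine ⟨fun T => l T y₀, ?_, fun T i T' j h => ?_⟩
  · simp only [l, hq0]
    exact Equiv.symm_apply_apply _ _
  · beta_reduce
    rw [hl T' y₀ (sidePoint j (H.glue (T.face, i) 0)), hl T y₀ (sidePoint i 0)]
    simp only [l]
    rw [← h.lift_eq]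
    have h1 := A.mem_dom_index hπ (r := ⟨T.face, sidePoint i 0⟩) (T.lift_spec (sidePoint i 0)).symm
    have h2 : A.perm (A.index hπ (p (T.lift (sidePoint i 0)))) ⟨T.face, sidePoint i 0⟩ =
        A.perm (A.index hπ (p (T.lift (sidePoint i 0))))
          ⟨T'.face, sidePoint j (H.glue (T.face, i) 0)⟩ * g (T.face, i) :=
      labelPerm_glue g hg h.1 0 h1
    rw [h2, mul_inv_rev, ← Equiv.Perm.mul_apply, mul_inv_cancel_left]

end

end

section
variable {E F : Type*} [TopologicalSpace E] [TopologicalSpace F] {H : BrokenHyperbolicStructure F}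
  {p : E → F}

/-! ## Normalized developments -/

/-- Change of the rescaling factor and of the normalized triple across the side `x`. -/
def developStep (H : BrokenHyperbolicStructure F) (x : H.Face × Fin 3)
    (a : {c : ℝ // 0 < c} × (Fin 3 → Fin 3 → ℝ)) : {c : ℝ // 0 < c} × (Fin 3 → Fin 3 → ℝ) :=
  (⟨a.1.1 / H.scale x, div_pos a.1.2 (H.scale_pos x)⟩,
    unfold (Real.exp (a.1.1 / H.scale x * H.shift x)) x.2 (H.pair x).2 a.2)

lemma developStep_pair (x : H.Face × Fin 3) (a : {c : ℝ // 0 < c} × (Fin 3 → Fin 3 → ℝ)) :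
    developStep H (H.pair x) (developStep H x a) = a := by
  have h0 := (H.scale_pos x).ne'
  have h1 := (H.scale_pos (H.pair x)).ne'
  have h2 := H.scale_pair x
  have e : a.1.1 / H.scale x / H.scale (H.pair x) = a.1.1 := by
    rw [div_div, mul_comm, h2, div_one]
  refine Prod.ext (Subtype.ext e) ?_
  simp only [developStep, e, H.pair_pair]
  have e2 : a.1.1 * H.shift (H.pair x) = a.1.1 / H.scale x * H.shift x := by
    rw [← H.shift_pair x]; field_simp
  rw [e2]
  exact unfold_unfold (Real.exp_pos _).ne' _ _ _

/-- `developStep` as a permutation. -/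
def developPerm (H : BrokenHyperbolicStructure F) (x : H.Face × Fin 3) :
    Equiv.Perm ({c : ℝ // 0 < c} × (Fin 3 → Fin 3 → ℝ)) where
  toFun := developStep H x
  invFun := developStep H (H.pair x)
  left_inv := developStep_pair x
  right_inv a := by
    have := developStep_pair (H.pair x) a
    rwa [H.pair_pair] at this

/-- Rescaling factors, and normalized triples of light-like vectors, of the lifted triangles. -/
structure IsNormalizedDevelopment (p : E → F) (c : LiftedFace H p → ℝ)
    (Z : LiftedFace H p → Fin 3 → Fin 3 → ℝ) : Prop where
  scale_pos : ∀ T, 0 < c T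
  normalized : ∀ T, IsNormalized (Z T)
  scale_adj : ∀ T i T' j, T.Adj i T' j → c T' * H.scale (T.face, i) = c T
  unfold_adj : ∀ T i T' j, T.Adj i T' j →
    Z T' = unfold (Real.exp (c T' * H.shift (T.face, i))) i j (Z T)

theorem exists_isNormalizedDevelopment [SimplyConnectedSpace E] (hp : IsCoveringMap p)
    (T₀ : LiftedFace H p) {Z₀ : Fin 3 → Fin 3 → ℝ} (hZ₀ : IsNormalized Z₀) :
    ∃ c Z, IsNormalizedDevelopment (H := H) p c Z ∧ c T₀ = 1 ∧ Z T₀ = Z₀ := by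
  obtain ⟨l, h0, h⟩ := exists_labelling (developPerm H)
    (fun x => Equiv.ext fun a => developStep_pair x a) hp T₀ (⟨1, one_pos⟩, Z₀)
  have h1 : ∀ T i T' j, T.Adj i T' j → (l T').1.1 = (l T).1.1 / H.scale (T.face, i) := by
    intro T i T' j hadj
    rw [h T i T' j hadj]; rfl
  have h2 : ∀ T i T' j, T.Adj i T' j →
      (l T').2 = unfold (Real.exp ((l T').1.1 * H.shift (T.face, i))) i j (l T).2 := by
    intro T i T' j hadj
    have hj : (H.pair (T.face, i)).2 = j := by rw [hadj.1]
    rw [h1 T i T' j hadj, h T i T' j hadj, ← hj]; rfl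
  refine ⟨fun T => (l T).1.1, fun T => (l T).2, ⟨fun T => (l T).1.2, ?_, ?_, h2⟩, ?_, ?_⟩
  · refine LiftedFace.induction_adj hp (T₀ := T₀) (by simpa [h0] using hZ₀) ?_
    intro T i T' j hadj hT
    rw [h2 T i T' j hadj]
    exact hT.unfold (Real.exp_pos _) _ _
  · intro T i T' j hadj
    simp only [h1 T i T' j hadj]
    exact div_mul_cancel₀ _ (H.scale_pos _).ne'
  · simp [h0]
  · simp [h0]

/-! ## Existence and uniqueness of the development -/

/-- Turning about the vertex `i + 2` of `T`, one leaves through side `i + 2 + 1 = i` and arrives at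
the vertex `j + 1` of `T'`. -/
lemma Decoration.depth_add_one (dec : Decoration H) {T T' : LiftedFace H p} {i j : Fin 3}
    (h : T.Adj i T' j) : dec.depth (T'.face, j + 1) =
      H.scale (T.face, i) * dec.depth (T.face, i + 2) + H.shift (T.face, i) := by
  have e : i + 2 + 1 = i := by rw [add_assoc]; simp
  have := dec.depth_next (T.face, i + 2)
  simp only [GluingData.next, GluingData.exitSide, e, h.1] at this
  exact this

lemma Decoration.depth_add_two (dec : Decoration H) {T T' : LiftedFace H p} {i j : Fin 3}
    (h : T.Adj i T' j) : dec.depth (T'.face, j + 2) =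
      H.scale (T.face, i) * dec.depth (T.face, i + 1) - H.shift (T.face, i) := by
  have h1 := dec.depth_add_one h.symm
  have h2 := H.scale_pair (T.face, i)
  have h3 := H.shift_pair (T.face, i)
  rw [h.1] at h2 h3
  rw [h1]
  linear_combination (-dec.depth (T'.face, j + 2)) * h2 - h3

namespace IsNormalizedDevelopment

variable {c : LiftedFace H p → ℝ} {Z : LiftedFace H p → Fin 3 → Fin 3 → ℝ}
  (hcZ : IsNormalizedDevelopment p c Z)
include hcZ

/-- Scaling the vectors by `exp (c * depth)` moves the tangent horocycles apart by the rescaled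
depths, so products `-2` become `-2 exp (c δ)`. The scalars `m` and `m⁻¹` of `unfold` cancel the
shifts in the rule for depths, hence the vectors are shared. -/
lemma isDevelopment (dec : Decoration H) {T₀ : LiftedFace H p} {r : Fin 3 → Fin 3 → ℝ}
    {t : Fin 3 → ℝ} (ht : ∀ k, 0 < t k) (hc : c T₀ = 1) (hZ : Z T₀ = fun k => t k • r k) :
    IsDevelopment dec p T₀ r c fun T k => Real.exp (c T * dec.depth (T.face, k)) • Z T k where
  scale_base := hc
  scale_adj := hcZ.scale_adj
  mem_cone T k := smul_mem_lightCone (Real.exp_pos _) ((hcZ.normalized T).1 k)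
  base k := ⟨Real.exp (c T₀ * dec.depth (T₀.face, k)) * t k,
    mul_pos (Real.exp_pos _) (ht k), by rw [hZ, smul_smul]⟩
  lambda T i := by
    have hne : i + 1 ≠ i + 2 := by fin_cases i <;> decide
    rw [lambdaCone, lambdaOfDist, mink_smul_left, mink_smul_right, (hcZ.normalized T).2 _ _ hne,
      horoDist, mul_add, Real.exp_add]
    congr 1
    ring
  share T i T' j h := by
    have hs := hcZ.scale_adj T i T' j h
    have hZ := hcZ.unfold_adj T i T' j h
    constructor
    · rw [hZ, unfold_add_one, dec.depth_add_one h, smul_smul, ← Real.exp_neg, ← Real.exp_add,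
        ← hs]
      ring_nf
    · rw [hZ, unfold_add_two, dec.depth_add_two h, smul_smul, ← Real.exp_add, ← hs]
      ring_nf
  opposite T i T' j h := by
    rw [hcZ.unfold_adj T i T' j h, det_smul, det_smul, det_unfold]
    have hd := (hcZ.normalized T).det_ne_zero i
    generalize Matrix.det (Matrix.of ![Z T (i + 1), Z T (i + 2), Z T i]) = d at hd ⊢
    have := sq_pos_of_ne_zero hd
    rw [mul_mul_mul_comm, mul_neg, ← sq, mul_neg, neg_lt_zero]
    positivity

end IsNormalizedDevelopment

lemma sqrt_two_mul_exp_injective {x y : ℝ} (hx : 0 ≤ x) (h : √x = lambdaOfDist y) :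
    x = 2 * Real.exp y :=
  (Real.sqrt_inj hx (by positivity)).1 h

lemma IsDevelopment.mink_eq {dec : Decoration H} {T₀ : LiftedFace H p} {r : Fin 3 → Fin 3 → ℝ}
    {c : LiftedFace H p → ℝ} {z : LiftedFace H p → Fin 3 → Fin 3 → ℝ}
    (h : IsDevelopment dec p T₀ r c z) (T : LiftedFace H p) (i : Fin 3) :
    mink (z T (i + 1)) (z T (i + 2)) = -(2 * Real.exp (c T * horoDist dec (T.face, i))) := by
  have h1 := mink_nonpos (h.mem_cone T (i + 1)) (h.mem_cone T (i + 2))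
  have := sqrt_two_mul_exp_injective (by linarith) (h.lambda T i)
  linarith

/-- A development is determined by its values on one triangle. -/
theorem IsDevelopment.unique [SimplyConnectedSpace E] (hp : IsCoveringMap p) {dec : Decoration H}
    {T₀ : LiftedFace H p} {r : Fin 3 → Fin 3 → ℝ} (hr : IsIdealTriple r)
    {c c' : LiftedFace H p → ℝ} {z z' : LiftedFace H p → Fin 3 → Fin 3 → ℝ}
    (h : IsDevelopment dec p T₀ r c z) (h' : IsDevelopment dec p T₀ r c' z') :
    c = c' ∧ z = z' := by
  have key : ∀ T, c T = c' T ∧ z T = z' T := by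
    refine LiftedFace.induction_adj hp (T₀ := T₀) ⟨h.scale_base.trans h'.scale_base.symm, ?_⟩ ?_
    · choose t ht hz using h.base
      choose t' ht' hz' using h'.base
      -- On the base triangle only three positive factors are free, and the λ-lengths prescribe
      -- their pairwise products.
      have : ∀ k, t k = t' k := eq_of_pairwise_mul_eq ht ht' fun i => by
        have hne : i + 1 ≠ i + 2 := by fin_cases i <;> decide
        have e := h.mink_eq T₀ i
        have e' := h'.mink_eq T₀ i
        rw [h.scale_base, hz, hz, mink_smul_left, mink_smul_right] at e
        rw [h'.scale_base, hz', hz', mink_smul_left, mink_smul_right, ← e] at e'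
        refine mul_right_cancel₀ (hr.mink_neg hne).ne ?_
        linarith
      funext k
      rw [hz, hz', this]
    · rintro T i T' j hadj ⟨hc, hz⟩
      have hc' : c T' = c' T' := by
        refine mul_right_cancel₀ (H.scale_pos (T.face, i)).ne' ?_
        rw [h.scale_adj T i T' j hadj, h'.scale_adj T i T' j hadj, hc]
      obtain ⟨s1, s2⟩ := h.share T i T' j hadj
      obtain ⟨s1', s2'⟩ := h'.share T i T' j hadj
      rw [hz] at s1 s2
      refine ⟨hc', funext ((Fin.forall_cyclic j).2 ⟨?_, s1.trans s1'.symm, s2.trans s2'.symm⟩)⟩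
      have o := h.opposite T i T' j hadj
      have o' := h'.opposite T i T' j hadj
      rw [hz] at o
      have j1 : j + 1 + 1 = j + 2 := by rw [add_assoc]; rfl
      have j2 : j + 1 + 2 = j := by rw [add_assoc]; simp
      have j3 : j + 2 + 1 = j := by rw [add_assoc]; simp
      have j4 : j + 2 + 2 = j + 1 := by rw [add_assoc]; rfl
      have m1 := h.mink_eq T' (j + 1)
      have m1' := h'.mink_eq T' (j + 1)
      have m2 := h.mink_eq T' (j + 2)
      have m2' := h'.mink_eq T' (j + 2)
      rw [j1, j2, s2] at m1
      rw [j1, j2, s2'] at m1'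
      rw [j3, j4, s1] at m2
      rw [j3, j4, s1'] at m2'
      -- Across a side only the opposite vertex is new: two λ-lengths give its products with the
      -- shared vectors, and the condition `opposite` gives its side.
      refine eq_of_mink_eq_of_det (h.mem_cone T' j).1 (h'.mem_cone T' j).1 (v := z' T (i + 1))
        (w := z' T (i + 2)) ?_ ?_ o o'
      · rw [mink_comm, m1, mink_comm, m1', hc']
      · rw [m2, m2', hc']
  exact ⟨funext fun T => (key T).1, funext fun T => (key T).2⟩

/-! ## The developing map -/

lemma continuous_coord (W : Fin 3 → Fin 3 → ℝ) (k : Fin 3) :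
    Continuous fun w : HypPlane => coord W w.1 k := by
  have h : ∀ j, Continuous fun w : HypPlane => w.1 j := fun j =>
    (continuous_apply j).comp continuous_subtype_val
  have hm : ∀ v : Fin 3 → ℝ, Continuous fun w : HypPlane => mink w.1 v := fun v =>
    (((h 0).mul_const _).add ((h 1).mul_const _)).sub ((h 2).mul_const _)
  exact (((hm _).sub (hm _)).sub (hm _)).div_const 4

namespace IsNormalizedDevelopment

variable {c : LiftedFace H p → ℝ} {Z : LiftedFace H p → Fin 3 → Fin 3 → ℝ}
  (hcZ : IsNormalizedDevelopment p c Z)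
include hcZ

/-- The homeomorphism of the standard triangle to the ideal triangle of a lifted triangle. -/
def triangleHomeo (T : LiftedFace H p) : StdTriangle ≃ₜ idealTriangle (Z T) :=
  stdBary.trans ((Bary.stretch (Real.log (c T))).trans (hcZ.normalized T).baryHomeo)

lemma triangleHomeo_sidePoint (T : LiftedFace H p) (i : Fin 3) (s : ℝ) :
    hcZ.triangleHomeo T (sidePoint i s) =
      (hcZ.normalized T).baryHomeo (Bary.side i (c T * s)) := by
  rw [triangleHomeo, Homeomorph.trans_apply, Homeomorph.trans_apply, stdBary_sidePoint,
    Bary.stretch_side, Real.exp_log (hcZ.scale_pos T)]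

lemma triangleHomeo_sidePoint_coe (T : LiftedFace H p) (i : Fin 3) (s : ℝ) :
    (hcZ.triangleHomeo T (sidePoint i s)).1.1 =
      (Real.exp (-(c T * s)) / 2) • Z T (i + 1) + (Real.exp (c T * s) / 2) • Z T (i + 2) := by
  rw [hcZ.triangleHomeo_sidePoint, IsNormalized.baryHomeo_coe, comb_cyclic _ _ i, Bary.side_self,
    Bary.side_add_one, Bary.side_add_two, zero_smul, zero_add]

/-- Side parameters are multiplied by the factor of each triangle, so `c T' * scale = c T` matches
the homothety, and the scalar in `unfold` matches its shift. -/
lemma triangleHomeo_adj {T T' : LiftedFace H p} {i j : Fin 3} (h : T.Adj i T' j) (s : ℝ) :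
    (hcZ.triangleHomeo T (sidePoint i s)).1 =
      (hcZ.triangleHomeo T' (sidePoint j (H.glue (T.face, i) s))).1 := by
  refine Subtype.ext ?_
  rw [triangleHomeo_sidePoint_coe, triangleHomeo_sidePoint_coe, hcZ.unfold_adj T i T' j h,
    unfold_add_one, unfold_add_two, smul_smul, smul_smul, ← Real.exp_neg,
    div_mul_eq_mul_div, div_mul_eq_mul_div, ← Real.exp_add, ← Real.exp_add, add_comm]
  have hs := hcZ.scale_adj T i T' j h
  rw [← hs, GluingData.glue]
  congr 4 <;> ring_nf

lemma coord_adj {T T' : LiftedFace H p} {i j : Fin 3} (h : T.Adj i T' j) (w : Fin 3 → ℝ) :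
    coord (Z T') w j = -coord (Z T) w i := by
  rw [hcZ.unfold_adj T i T' j h, coord_unfold]

lemma exists_eq_triangleHomeo_sidePoint {T : LiftedFace H p} {w : HypPlane}
    (hw : w ∈ idealTriangle (Z T)) {i : Fin 3} (h : coord (Z T) w.1 i = 0) :
    ∃ s, (hcZ.triangleHomeo T (sidePoint i s)).1 = w := by
  obtain ⟨s, hs⟩ := Bary.coord_eq_zero_iff.1
    (((hcZ.normalized T).baryHomeo_symm_coe ⟨w, hw⟩ ▸ h :
      ((hcZ.normalized T).baryHomeo.symm ⟨w, hw⟩).1 i = 0))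
  refine ⟨s / c T, ?_⟩
  rw [hcZ.triangleHomeo_sidePoint, mul_div_cancel₀ _ (hcZ.scale_pos T).ne', ← hs,
    Homeomorph.apply_symm_apply]

/-- The sum is `-1 / 2` times the product of `w` with the third vertex. So a point is never beyond
two sides of a triangle at once. -/
lemma coord_add_pos (T : LiftedFace H p) (w : HypPlane) {i j : Fin 3} (hij : i ≠ j) :
    0 < coord (Z T) w.1 i + coord (Z T) w.1 j := by
  have h0 := w.mink_neg ((hcZ.normalized T).1 0)
  have h1 := w.mink_neg ((hcZ.normalized T).1 1)
  have h2 := w.mink_neg ((hcZ.normalized T).1 2)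
  fin_cases i <;> fin_cases j <;> simp [coord, Fin.reduceAdd] at hij ⊢ <;> linarith

end IsNormalizedDevelopment

/-- Chains of adjacent lifted triangles without backtracking that start at `T` and enter the last
triangle through its side `j`. -/
inductive LiftedFace.Chain (T : LiftedFace H p) : LiftedFace H p → Fin 3 → Prop
  | step {i T' j} : T.Adj i T' j → Chain T T' j
  | cons {T' j i T'' k} : Chain T T' j → i ≠ j → T'.Adj i T'' k → Chain T T'' k

lemma LiftedFace.eq_or_chain [PreconnectedSpace E] (hp : IsCoveringMap p) (T T' : LiftedFace H p) :
    T' = T ∨ ∃ j, T.Chain T' j := by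
  refine LiftedFace.induction_adj hp (P := fun T' => T' = T ∨ ∃ j, T.Chain T' j) (T₀ := T)
    (Or.inl rfl) ?_ T'
  rintro T' i T'' k hadj (rfl | ⟨j, hT'⟩)
  · exact Or.inr ⟨k, .step hadj⟩
  by_cases hij : i = j
  · subst hij
    cases hT' with
    | step h => exact Or.inl (LiftedFace.Adj.unique hp hadj h.symm).1
    | cons h1 h2 h3 =>
      obtain ⟨rfl, rfl⟩ := LiftedFace.Adj.unique hp hadj h3.symm
      exact Or.inr ⟨_, h1⟩
  · exact Or.inr ⟨k, .cons hT' hij hadj⟩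

namespace IsNormalizedDevelopment

variable {c : LiftedFace H p → ℝ} {Z : LiftedFace H p → Fin 3 → Fin 3 → ℝ}
  (hcZ : IsNormalizedDevelopment p c Z)
include hcZ

/-- Coordinates change sign across a common side. In a longer chain the exit coordinate in the
previous triangle is nonpositive, so by `coord_add_pos` its entrance coordinate is positive. By
induction that triangle is adjacent to `T` with `w` on the common side, where the entrance
coordinate is zero: a contradiction. Only chains of length one survive. -/
lemma adj_of_chain {T T' : LiftedFace H p} {j : Fin 3} (h : T.Chain T' j) {w : HypPlane}
    (hw : w ∈ idealTriangle (Z T)) (hj : 0 ≤ coord (Z T') w.1 j) :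
    ∃ i, T.Adj i T' j ∧ coord (Z T) w.1 i = 0 := by
  induction h with
  | @step i T' j h =>
    have h1 := (hcZ.normalized T).coord_nonneg hw i
    rw [hcZ.coord_adj h] at hj
    exact ⟨i, h, by linarith⟩
  | @cons T' j i T'' k h hij hadj ih =>
    rw [hcZ.coord_adj hadj] at hj
    have h1 := hcZ.coord_add_pos T' w hij
    obtain ⟨i', h2, h3⟩ := ih (by linarith)
    have h4 := hcZ.coord_adj h2 w.1
    linarith

/-- The ideal triangles of the development have disjoint interiors. -/
lemma lift_eq_of_triangleHomeo_eq [PreconnectedSpace E] (hp : IsCoveringMap p)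
    {T T' : LiftedFace H p} {y y' : StdTriangle}
    (h : (hcZ.triangleHomeo T y).1 = (hcZ.triangleHomeo T' y').1) : T.lift y = T'.lift y' := by
  rcases LiftedFace.eq_or_chain hp T T' with rfl | ⟨j, hj⟩
  · rw [(hcZ.triangleHomeo T').injective (Subtype.ext h)]
  · have hw := (hcZ.triangleHomeo T y).2
    have hw' := (hcZ.triangleHomeo T' y').2
    rw [← h] at hw'
    obtain ⟨i, hadj, hi⟩ := hcZ.adj_of_chain hj hw ((hcZ.normalized T').coord_nonneg hw' j)
    obtain ⟨s, hs⟩ := hcZ.exists_eq_triangleHomeo_sidePoint hw hi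
    have e1 : sidePoint i s = y := (hcZ.triangleHomeo T).injective (Subtype.ext hs)
    rw [hcZ.triangleHomeo_adj hadj] at hs
    have e2 : sidePoint j (H.glue (T.face, i) s) = y' :=
      (hcZ.triangleHomeo T').injective (Subtype.ext (hs.trans h))
    rw [← e1, ← e2, hadj.lift_eq]

lemma mem_idealTriangle {T : LiftedFace H p} {w : HypPlane} (h : ∀ k, 0 ≤ coord (Z T) w.1 k) :
    w ∈ idealTriangle (Z T) :=
  ⟨_, h, ((hcZ.normalized T).comb_coord w.1).symm⟩

/-- A neighbourhood of a point of a triangle is covered by the triangle and an adjacent one. -/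
lemma mem_nhds_of_forall (hp : IsCoveringMap p) (T : LiftedFace H p) (y : StdTriangle)
    {N : Set HypPlane}
    (h : ∀ T' y', T'.lift y' = T.lift y → N ∪ (idealTriangle (Z T'))ᶜ ∈ 𝓝 (hcZ.triangleHomeo T y).1) :
    N ∈ 𝓝 (hcZ.triangleHomeo T y).1 := by
  obtain ⟨w, hw⟩ : ∃ w, w = (hcZ.triangleHomeo T y).1 := ⟨_, rfl⟩
  rw [← hw] at h ⊢
  have hwT : w ∈ idealTriangle (Z T) := by rw [hw]; exact (hcZ.triangleHomeo T y).2
  have hT := h T y rfl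
  by_cases hpos : ∀ k, 0 < coord (Z T) w.1 k
  · have hev : ∀ᶠ v in 𝓝 w, ∀ k, 0 < coord (Z T) v.1 k := by
      rw [Filter.eventually_all]
      exact fun k => (continuous_coord (Z T) k).continuousAt.eventually (lt_mem_nhds (hpos k))
    filter_upwards [hT, hev] with v hv1 hv2
    exact hv1.resolve_right fun hc => hc (hcZ.mem_idealTriangle fun k => (hv2 k).le)
  · push Not at hpos
    obtain ⟨i, hi⟩ := hpos
    have hi0 := le_antisymm hi ((hcZ.normalized T).coord_nonneg hwT i)
    obtain ⟨T', j, hadj⟩ := LiftedFace.exists_adj hp T i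
    obtain ⟨s, hs⟩ := hcZ.exists_eq_triangleHomeo_sidePoint hwT hi0
    have e1 : sidePoint i s = y := (hcZ.triangleHomeo T).injective (Subtype.ext (hs.trans hw))
    have hT' := h T' (sidePoint j (H.glue (T.face, i) s)) (by rw [← e1, hadj.lift_eq])
    have hj0 : coord (Z T') w.1 j = 0 := by rw [hcZ.coord_adj hadj, hi0, neg_zero]
    have hev : ∀ T : LiftedFace H p, ∀ i, coord (Z T) w.1 i = 0 →
        ∀ᶠ v in 𝓝 w, 0 < coord (Z T) v.1 (i + 1) ∧ 0 < coord (Z T) v.1 (i + 2) := by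
      intro T i h0
      have n1 : i ≠ i + 1 := by fin_cases i <;> decide
      have n2 : i ≠ i + 2 := by fin_cases i <;> decide
      have p1 := hcZ.coord_add_pos T w n1
      have p2 := hcZ.coord_add_pos T w n2
      rw [h0, zero_add] at p1 p2
      exact ((continuous_coord (Z T) _).continuousAt.eventually (lt_mem_nhds p1)).and
        ((continuous_coord (Z T) _).continuousAt.eventually (lt_mem_nhds p2))
    filter_upwards [hT, hT', hev T i hi0, hev T' j hj0] with v h1 h2 h3 h4
    -- The sign of coordinate `i` decides which of the two triangles along the side contains `v`;
    -- near `w` the other coordinates stay positive.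
    rcases le_total 0 (coord (Z T) v.1 i) with h5 | h5
    · exact h1.resolve_right fun hc => hc (hcZ.mem_idealTriangle
        ((Fin.forall_cyclic i).2 ⟨h5, h3.1.le, h3.2.le⟩))
    · have h6 : 0 ≤ coord (Z T') v.1 j := by rw [hcZ.coord_adj hadj]; linarith
      exact h2.resolve_right fun hc => hc (hcZ.mem_idealTriangle
        ((Fin.forall_cyclic j).2 ⟨h6, h4.1.le, h4.2.le⟩))

/-- The developing map. -/
theorem exists_developingMap [PreconnectedSpace E] (hp : IsCoveringMap p) :
    ∃ D : E → HypPlane, IsOpenEmbedding D ∧ ∀ T y, D (T.lift y) = (hcZ.triangleHomeo T y).1 := by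
  obtain ⟨D, hD, h⟩ := LiftedFace.exists_glued (H := H) hp
    (fun T y => (hcZ.triangleHomeo T y).1)
    (fun T => continuous_subtype_val.comp (hcZ.triangleHomeo T).continuous)
    (fun T i T' j hadj s => hcZ.triangleHomeo_adj hadj s)
  refine ⟨D, IsOpenEmbedding.of_continuous_injective_isOpenMap hD ?_ ?_, h⟩
  · intro e e' hee
    obtain ⟨T, y, rfl⟩ := LiftedFace.exists_lift_eq (H := H) hp e
    obtain ⟨T', y', rfl⟩ := LiftedFace.exists_lift_eq (H := H) hp e'
    rw [h, h] at hee
    exact hcZ.lift_eq_of_triangleHomeo_eq hp hee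
  · intro U hU
    rw [isOpen_iff_mem_nhds]
    rintro _ ⟨e, he, rfl⟩
    obtain ⟨T, y, rfl⟩ := LiftedFace.exists_lift_eq (H := H) hp e
    rw [h]
    -- The image of `U` is relatively open in each triangle only; adding the complement of the
    -- triangle turns this into a neighbourhood in the plane.
    refine hcZ.mem_nhds_of_forall hp T y fun T' y' hT' => ?_
    have h1 : IsOpen (hcZ.triangleHomeo T' '' (T'.lift ⁻¹' U)) :=
      (hcZ.triangleHomeo T').isOpenMap _ (hU.preimage T'.continuous_lift)
    obtain ⟨O, hO, hO'⟩ := isOpen_induced_iff.1 h1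
    have hw : (hcZ.triangleHomeo T y).1 = (hcZ.triangleHomeo T' y').1 := by
      rw [← h, ← h, hT']
    refine Filter.mem_of_superset (hO.mem_nhds (?_ : (hcZ.triangleHomeo T y).1 ∈ O)) ?_
    · rw [hw]
      change hcZ.triangleHomeo T' y' ∈ Subtype.val ⁻¹' O
      rw [hO']
      exact ⟨y', by rw [Set.mem_preimage, hT']; exact he, rfl⟩
    · intro v hv
      by_cases hvT : v ∈ idealTriangle (Z T')
      · left
        have : (⟨v, hvT⟩ : idealTriangle (Z T')) ∈ Subtype.val ⁻¹' O := hv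
        rw [hO'] at this
        obtain ⟨x, hx, hxv⟩ := this
        exact ⟨T'.lift x, hx, by rw [h, hxv]⟩
      · exact Or.inr hvT

section
variable {D : E → HypPlane} (hDT : ∀ T y, D (T.lift y) = (hcZ.triangleHomeo T y).1)
include hDT

lemma range_lift (T : LiftedFace H p) : Set.range (fun x => D (T.lift x)) = idealTriangle (Z T) := by
  simp only [hDT]
  rw [show (fun x => (hcZ.triangleHomeo T x).1) = Subtype.val ∘ hcZ.triangleHomeo T from rfl,
    Set.range_comp, (hcZ.triangleHomeo T).surjective.range_eq, Set.image_univ, Subtype.range_coe]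

lemma range_side (T : LiftedFace H p) (i : Fin 3) :
    Set.range (fun s => D (T.lift (sidePoint i s))) = idealSide (Z T) i := by
  simp only [hDT]
  ext w
  constructor
  · rintro ⟨s, rfl⟩
    simp only [hcZ.triangleHomeo_sidePoint]
    exact (hcZ.normalized T).baryHomeo_mem_idealSide.2 (Bary.side_self i _)
  · intro hw
    have hwT := idealSide_subset_idealTriangle _ _ hw
    exact hcZ.exists_eq_triangleHomeo_sidePoint hwT
      ((hcZ.normalized T).mem_idealSide_iff (w := ⟨w, hwT⟩).1 hw)

lemma realizesDevelopment (dec : Decoration H) (hD : IsOpenEmbedding D) :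
    RealizesDevelopment dec p c
      (fun T k => Real.exp (c T * dec.depth (T.face, k)) • Z T k) D where
  isOpenEmbedding := hD
  image_face T := by
    rw [hcZ.range_lift hDT, idealTriangle_smul fun k => Real.exp_pos _]
  image_side T i := by
    rw [hcZ.range_side hDT, idealSide_smul fun k => Real.exp_pos _]
  homothety T i s t := by
    rw [hDT, hDT, hcZ.triangleHomeo_sidePoint, hcZ.triangleHomeo_sidePoint,
      IsNormalized.hdist_baryHomeo, Bary.hypDist_side, hdist_sidePoint, ← mul_sub, abs_mul,
      abs_of_pos (hcZ.scale_pos T)]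
  horocycle_head T i := by
    have e2 : i + 2 + 1 = i := by rw [add_assoc]; simp
    have e3 : i + 2 + 2 = i + 1 := by rw [add_assoc]; rfl
    rw [hDT, hcZ.triangleHomeo_sidePoint]
    change mink (comb (Z T) _) _ = -1
    rw [mink_smul_right, (hcZ.normalized T).mink_comb_vertex, e2, e3, Bary.side_self,
      Bary.side_add_one, Real.exp_neg]
    have := Real.exp_pos (c T * dec.depth (T.face, i + 2))
    field_simp
    ring
  horocycle_tail T i := by
    have e2 : i + 1 + 1 = i + 2 := by rw [add_assoc]; rfl
    have e3 : i + 1 + 2 = i := by rw [add_assoc]; simp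
    rw [hDT, hcZ.triangleHomeo_sidePoint]
    change mink (comb (Z T) _) _ = -1
    rw [mink_smul_right, (hcZ.normalized T).mink_comb_vertex, e2, e3, Bary.side_self,
      Bary.side_add_two, mul_neg, Real.exp_neg]
    have := Real.exp_pos (c T * dec.depth (T.face, i + 1))
    field_simp
    ring

end

end IsNormalizedDevelopment

/-! ## The action of the covering translations -/

/-- The image of a lifted triangle under a covering translation. -/
def LiftedFace.translate (α : coveringTranslations p) (T : LiftedFace H p) : LiftedFace H p where
  face := T.face
  lift x := α.1 (T.lift x)
  continuous_lift := α.1.continuous.comp T.continuous_lift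
  lift_spec x := (α.2 _).trans (T.lift_spec x)

lemma LiftedFace.Adj.translate {T T' : LiftedFace H p} {i j : Fin 3} (h : T.Adj i T' j)
    (α : coveringTranslations p) : (T.translate α).Adj i (T'.translate α) j :=
  ⟨h.1, fun s => congrArg α.1 (h.2 s)⟩

namespace IsNormalizedDevelopment

variable {c : LiftedFace H p → ℝ} {Z : LiftedFace H p → Fin 3 → Fin 3 → ℝ}
  (hcZ : IsNormalizedDevelopment p c Z)
include hcZ

/-- The change of `c` across a side depends only on the face below, which covering translations
preserve. So the ratio `c (α T) / c T` is the same for all triangles; this makes it multiplicative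
in `α`. -/
lemma scale_translate [PreconnectedSpace E] (hp : IsCoveringMap p) (T₀ : LiftedFace H p)
    (α : coveringTranslations p) (T : LiftedFace H p) :
    c (T.translate α) * c T₀ = c (T₀.translate α) * c T := by
  refine LiftedFace.induction_adj hp
    (P := fun T => c (T.translate α) * c T₀ = c (T₀.translate α) * c T) (T₀ := T₀) rfl ?_ T
  intro T i T' j h hT
  have h1 := hcZ.scale_adj T i T' j h
  have h2 := hcZ.scale_adj _ i _ j (h.translate α)
  change c (T'.translate α) * H.scale (T.face, i) = _ at h2
  refine mul_right_cancel₀ (H.scale_pos (T.face, i)).ne' ?_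
  rw [← h1, ← h2] at hT
  linarith

/-- The stretch homomorphism of a development. -/
def stretchHom [PreconnectedSpace E] (hp : IsCoveringMap p) (T₀ : LiftedFace H p) :
    coveringTranslations p →* {t : ℝ // 0 < t} where
  toFun α := ⟨c (T₀.translate α) / c T₀, div_pos (hcZ.scale_pos _) (hcZ.scale_pos _)⟩
  map_one' := Subtype.ext (div_self (hcZ.scale_pos T₀).ne')
  map_mul' α β := by
    refine Subtype.ext ?_
    change c (T₀.translate (α * β)) / c T₀ = c (T₀.translate α) / c T₀ * (c (T₀.translate β) / c T₀)
    have h := hcZ.scale_translate hp T₀ α (T₀.translate β)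
    have h0 := (hcZ.scale_pos T₀).ne'
    change c (T₀.translate (α * β)) * c T₀ = _ at h
    field_simp
    linarith

theorem isCoveringHyperbolicStructure [PreconnectedSpace E] (hp : IsCoveringMap p)
    (T₀ : LiftedFace H p) {D : E → HypPlane} (hD : IsOpenEmbedding D)
    (hDT : ∀ T y, D (T.lift y) = (hcZ.triangleHomeo T y).1) :
    IsCoveringHyperbolicStructure H p (hcZ.stretchHom hp T₀) D where
  isLocalHomeomorph := hD.isLocalHomeomorph
  geodesic T := by
    refine ⟨?_, Z T, (hcZ.normalized T).isIdealTriple, hcZ.range_lift hDT T, hcZ.range_side hDT T⟩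
    intro x y h
    simp only [hDT] at h
    exact (hcZ.triangleHomeo T).injective (Subtype.ext h)
  stretch α T := by
    have hφ : (hcZ.stretchHom hp T₀ α : ℝ) = c (T.translate α) / c T := by
      change c (T₀.translate α) / c T₀ = _
      rw [div_eq_div_iff (hcZ.scale_pos _).ne' (hcZ.scale_pos _).ne',
        hcZ.scale_translate hp T₀ α T]
    have hpos : 0 < c (T.translate α) / c T := div_pos (hcZ.scale_pos _) (hcZ.scale_pos _)
    refine ⟨Z T, Z (T.translate α), (hcZ.normalized _).isIdealTriple,
      (hcZ.normalized _).isIdealTriple, hcZ.range_lift hDT T,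
      hcZ.range_lift hDT (T.translate α), stretchMap (hcZ.normalized T)
        (hcZ.normalized (T.translate α)) (Real.log (c (T.translate α) / c T)), ?_, ?_⟩
    · rw [hφ]
      have := isStretchMap_stretchMap (hcZ.normalized T)
        (hcZ.normalized (T.translate α)) (Real.log (c (T.translate α) / c T))
      rwa [Real.exp_log hpos] at this
    · intro x hx
      have e1 : (⟨D (T.lift x), hx⟩ : idealTriangle (Z T)) = hcZ.triangleHomeo T x :=
        Subtype.ext (hDT T x)
      rw [e1]
      change _ = D ((T.translate α).lift x)
      rw [hDT]
      congr 1
      simp only [stretchMap, triangleHomeo, Homeomorph.trans_apply, Homeomorph.symm_apply_apply]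
      -- The flow property: time `log (c T)` followed by time `log (c (α T) / c T)` is time `log (c
      -- (α T))`, the one used on the image triangle.
      rw [← Bary.stretch_add, Real.log_div (hcZ.scale_pos _).ne' (hcZ.scale_pos _).ne',
        add_sub_cancel]

end IsNormalizedDevelopment

end

/-- Let `H` be a broken hyperbolic structure on the ideally triangulated connected surface `F` with
a decoration, `p : E → F` the universal covering, `T₀` a lifted triangle and `r` the vertices of an
ideal triangle. Then the development exists and is unique, and it is realized by a map to the
hyperbolic plane whose hyperbolic structure is a covering hyperbolic structure. -/
theorem propositionB10 {E F : Type*} [TopologicalSpace E] [TopologicalSpace F]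
    [ConnectedSpace F] [SimplyConnectedSpace E]
    (H : BrokenHyperbolicStructure F) (dec : Decoration H)
    (p : E → F) (hp : IsCoveringMap p)
    (T₀ : LiftedFace H p) (r : Fin 3 → Fin 3 → ℝ) (hr : IsIdealTriple r) :
    (∃! cz : (LiftedFace H p → ℝ) × (LiftedFace H p → Fin 3 → Fin 3 → ℝ),
      IsDevelopment dec p T₀ r cz.1 cz.2) ∧
    ∀ c z, IsDevelopment dec p T₀ r c z →
      ∃ (D : E → HypPlane) (φ : coveringTranslations p →* {t : ℝ // 0 < t}),
        RealizesDevelopment dec p c z D ∧ IsCoveringHyperbolicStructure H p φ D := by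
  obtain ⟨t, ht, hZ₀⟩ := hr.exists_normalized
  obtain ⟨c, Z, hcZ, hc, hZ⟩ := exists_isNormalizedDevelopment hp T₀ hZ₀
  have hdev := hcZ.isDevelopment dec ht hc hZ
  refine ⟨⟨(c, _), hdev, fun cz h => ?_⟩, fun c' z' h' => ?_⟩
  · obtain ⟨h1, h2⟩ := h.unique hp hr hdev
    exact Prod.ext h1 h2
  · obtain ⟨rfl, rfl⟩ := h'.unique hp hr hdev
    obtain ⟨D, hD, hDT⟩ := hcZ.exists_developingMap hp
    exact ⟨D, hcZ.stretchHom hp T₀, hcZ.realizesDevelopment hDT dec hD,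
      hcZ.isCoveringHyperbolicStructure hp T₀ hD hDT⟩

end
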